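/- An arithmetic circuit is a labeled directed acyclic graph with exactly one sink (the output gate), in which every gate has fanin $0$ or $2$; the gates of fanin $0$ are labeled with the constant $-1$ or with a variable $X_i$, and the gates of fanin $2$ (whose two children may coincide) are labeled with $+$ or $\times$. It computes a polynomial with integer coefficients in the obvious way. Circuits are written down over a fixed finite alphabet as a list of their gates in topological order, the indices of variables and of children being written in unary; a monomial is written down as the list of the exponents of its variables, in binary. ACIT (arithmetic circuit identity testing) is the set of (encodings of) arithmetic circuits that compute the zero polynomial. ML-ZMC is the set of (encodings of) pairs $(C,m)$ of an arithmetic circuit $C$ and a monomial $m$ such that the polynomial computed by $C$ is multilinear (of degree at most $1$ in each variable) and $m$ has coefficient $0$ in it. ML-ZMC and ACIT are equivalent under logspace many-one reductions: there is a word function $f$, computable by a deterministic Turing machine with a read-only input tape, a write-only output tape and $O(\log n)$ cells of work space on inputs of length $n$, such that for all words $w$, $w \in \text{ML-ZMC}$ if and only if $f(w) \in \text{ACIT}$; and there is such a function $g$ such that for all words $w$, $w \in \text{ACIT}$ if and only if $g(w) \in \text{ML-ZMC}$. -/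

import Mathlib

/-! ### Deterministic logspace transducers and logspace many-one reductions -/

namespace Logspace

/-- A head move. -/
inductive Move
  | left
  | stay
  | right

/-- The new position of a head on a one-sided tape; moving left at cell `0` does nothing. -/
def Move.apply : Move → ℕ → ℕ
  | left, p => p - 1
  | stay, p => p
  | right, p => p + 1

/-- What the input head can read: the two endmarkers, or a letter of the input word. -/
inductive InputCell (σ : Type)
  | leftEnd
  | rightEnd
  | letter (a : σ)

/-- The content of cell `p` of the read-only input tape holding the word `x`: the left endmarker in
cell `0`, the word in the cells `1, …, |x|`, the right endmarker in cell `|x| + 1`. -/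
def inputCell {σ : Type} (x : List σ) : ℕ → InputCell σ
  | 0 => .leftEnd
  | p + 1 =>
    match x[p]? with
    | some a => .letter a
    | none => .rightEnd

/-- What a machine does in one step: the next state, the move of the input head, for every work
tape the symbol to be written and the move of the head, and possibly one letter to be appended to
the write-only output tape. -/
structure Action (Q Γ τ : Type) (k : ℕ) where
  next : Q
  inMove : Move
  write : Fin k → Γ
  workMove : Fin k → Move
  output : Option τ

/-- A deterministic Turing machine with a two-way read-only input tape over `σ`, `k` work tapes over
a finite alphabet `Γ`, and a one-way write-only output tape over `τ`. The machine halts when the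
transition function returns `none`. -/
structure Transducer (σ τ : Type) where
  Q : Type
  finite_Q : Finite Q
  start : Q
  Γ : Type
  finite_Γ : Finite Γ
  blank : Γ
  k : ℕ
  δ : Q → InputCell σ → (Fin k → Γ) → Option (Action Q Γ τ k)

namespace Transducer

variable {σ τ : Type}

/-- A configuration of the machine. -/
structure Cfg (M : Transducer σ τ) where
  state : M.Q
  inPos : ℕ
  work : Fin M.k → ℕ → M.Γ
  workPos : Fin M.k → ℕ
  out : List τ

/-- The initial configuration: all heads on cell `0`, blank work tapes, empty output. -/
def init (M : Transducer σ τ) : M.Cfg where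
  state := M.start
  inPos := 0
  work := fun _ _ => M.blank
  workPos := fun _ => 0
  out := []

/-- One step on the input `x` (`none` if the machine halts). The input head cannot move beyond the
endmarkers. -/
def step (M : Transducer σ τ) (x : List σ) (c : M.Cfg) : Option M.Cfg :=
  (M.δ c.state (inputCell x c.inPos) (fun t => c.work t (c.workPos t))).map fun a =>
    { state := a.next
      inPos := min (a.inMove.apply c.inPos) (x.length + 1)
      work := fun t => Function.update (c.work t) (c.workPos t) (a.write t)
      workPos := fun t => (a.workMove t).apply (c.workPos t)
      out := c.out ++ a.output.toList }

/-- On the input `x` the machine halts with the output `y`. -/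
def HaltsWith (M : Transducer σ τ) (x : List σ) (y : List τ) : Prop :=
  ∃ c, StateTransition.Reaches (M.step x) M.init c ∧ M.step x c = none ∧ c.out = y

/-- On the input `x` the machine only ever visits the first `s` cells of each work tape. -/
def UsesSpaceAtMost (M : Transducer σ τ) (x : List σ) (s : ℕ) : Prop :=
  ∀ c, StateTransition.Reaches (M.step x) M.init c → ∀ t, c.workPos t < s

end Transducer

/-- The word function `f` is computable in logarithmic space: some machine halts on every input `x`
with the output `f x`, using at most `O(log |x|)` work cells. -/
def Computable {σ τ : Type} (f : List σ → List τ) : Prop :=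
  ∃ (M : Transducer σ τ) (c : ℕ), ∀ x,
    M.HaltsWith x (f x) ∧ M.UsesSpaceAtMost x (c * (Nat.log 2 x.length + 1))

/-- Logspace many-one reducibility of languages. -/
def Reducible {σ τ : Type} (A : Language σ) (B : Language τ) : Prop :=
  ∃ f : List σ → List τ, Computable f ∧ ∀ x, x ∈ A ↔ f x ∈ B

/-- Equivalence of languages under logspace many-one reductions. -/
def Equivalent {σ τ : Type} (A : Language σ) (B : Language τ) : Prop :=
  Reducible A B ∧ Reducible B A

end Logspace

/-! ### Arithmetic circuits and the two decision problems -/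

namespace Arith

/-- A gate: an input gate labelled with the constant `-1` or with a variable, or a computation gate
of fanin two, given with its two (possibly equal) children. -/
inductive Gate
  | negOne
  | var (i : ℕ)
  | add (u v : ℕ)
  | mul (u v : ℕ)

/-- The children of a gate. -/
def Gate.children : Gate → List ℕ
  | negOne => []
  | var _ => []
  | add u v => [u, v]
  | mul u v => [u, v]

/-- An arithmetic circuit: a nonempty labelled acyclic graph of gates, numbered `0, 1, …` in
topological order, in which the last gate is the only sink (the output gate). -/
structure Circuit where
  gates : List Gate
  nonempty : gates ≠ []
  acyclic : ∀ (i : ℕ) (g : Gate), gates[i]? = some g → ∀ u ∈ g.children, u < i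
  oneSink : ∀ i, i + 1 < gates.length → ∃ g ∈ gates, i ∈ g.children

/-- The polynomial computed by a gate, given those computed by the gates before it. -/
noncomputable def Gate.poly (vals : List (MvPolynomial ℕ ℤ)) : Gate → MvPolynomial ℕ ℤ
  | negOne => -1
  | var i => MvPolynomial.X i
  | add u v => vals.getD u 0 + vals.getD v 0
  | mul u v => vals.getD u 0 * vals.getD v 0

/-- The polynomials computed by the gates of a topologically ordered list of gates. -/
noncomputable def gatePolys (gates : List Gate) : List (MvPolynomial ℕ ℤ) :=
  gates.foldl (fun vals g => vals ++ [g.poly vals]) []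

/-- The polynomial computed by a circuit, i.e. by its output gate. -/
noncomputable def Circuit.poly (C : Circuit) : MvPolynomial ℕ ℤ :=
  (gatePolys C.gates).getD (C.gates.length - 1) 0

/-- A polynomial is multilinear if its degree in each variable is at most `1`. -/
def IsMultilinear (p : MvPolynomial ℕ ℤ) : Prop :=
  ∀ i, p.degreeOf i ≤ 1

/-- The alphabet in which instances are written. -/
inductive Sym
  | negOne
  | var
  | add
  | mul
  | tick
  | sep
  | pow
  | bit (b : Bool)

/-- The encoding of a gate: its kind, then the index of the variable or the numbers of the two
children, as tally numbers. -/
def Gate.encode : Gate → List Sym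
  | negOne => [.negOne]
  | var i => .var :: List.replicate i .tick
  | add u v => .add :: (List.replicate u .tick ++ .sep :: List.replicate v .tick)
  | mul u v => .mul :: (List.replicate u .tick ++ .sep :: List.replicate v .tick)

/-- The encoding of a circuit: the encodings of its gates, in order. -/
def Circuit.encode (C : Circuit) : List Sym :=
  C.gates.flatMap Gate.encode

/-- The monomial with the exponents `e`: the variable `X i` has the exponent `e[i]`, or `0` if the
list is too short. -/
def monomialOf (e : List ℕ) : ℕ →₀ ℕ :=
  e.toFinsupp

/-- The encoding of a monomial: the list of its exponents, in binary (least significant bit first,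
without superfluous zeros). -/
def encodeMonomial (e : List ℕ) : List Sym :=
  e.flatMap fun a => .pow :: a.bits.map .bit

/-- Arithmetic circuit identity testing: does the circuit compute the zero polynomial? -/
def ACIT : Language Sym :=
  {w | ∃ C : Circuit, w = C.encode ∧ C.poly = 0}

/-- Does the circuit compute a multilinear polynomial in which the given monomial has the
coefficient `0`? -/
def MLZMC : Language Sym :=
  {w | ∃ (C : Circuit) (e : List ℕ), w = C.encode ++ encodeMonomial e ∧
    IsMultilinear C.poly ∧ C.poly.coeff (monomialOf e) = 0}

end Arith

/-! From identity testing to coefficient testing: a circuit is evaluated at huge integers. Let `n`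
be the input length and `t = n + 1`. The polynomial has degree below `2 ^ t` in each variable and
coefficients below `2 ^ 2 ^ t` in absolute value. The substitution `X j ↦ 2 ^ 2 ^ ((j + 1) * t)`
sends a monomial to `2 ^ (2 ^ t * w)`, where `w` has the exponents as its digits in base `2 ^ t`.
Distinct monomials have distinct `w`, and modulo the next multiple of `2 ^ t` in the exponent the
lowest term cannot be cancelled, so a nonzero polynomial has a nonzero value (`eval_ne_zero`). The
points arise by repeated squaring (`powers_spec`). The new circuit computes a constant, which is
multilinear and whose coefficient at the empty monomial is the value.

From coefficient testing to identity testing: finite differences. The sum `∑ (-1) ^ i * choose d i *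
i ^ k` over `i ≤ d` vanishes for `k < d` and is `± d!` for `k = d`. For `d = 2`, scaling the single
variable `X i` by `0, 1, 2` tests whether its degree is at most `1`
(`scaledSum_single_eq_zero_iff`). For the coefficient of the monomial `e`, the variables outside its
support are set to `0`, those inside are scaled by `0, …, d`, and `d` is the number of binary digits
in `e`. In a multilinear polynomial only the product of all variables of the support can reach the
degree `d`, and it does so exactly if `e` itself is multilinear (`scaledSum_support_eq_zero_iff`). A
recursion that involves no division produces `d!` times the alternating sum (`weightedSum_eq`). The
tests are merged into one by a sum of squares, which over the integers is zero only if every summand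
is (`sum_sq_eq_zero_iff`).

Both circuits end with a chain of gates of value `0` that uses every gate, so that there is one sink
(`absorb_spec`).

For logarithmic space, the reductions are written as loop programs whose loops run at most `|x| + 2`
rounds each. Their registers are polynomially bounded (`Prog.cost_le`) and hence have `O(log |x|)`
bits. The programs are translated into while programs (`exec_low`), these into flow graphs
(`Exec.run`), and these into a transducer with one work tape, where a cell holds one bit of every
register (`Run.transducer`). Words that encode no instance have to be recognized (`eval_checkProg`);
they are mapped to the empty word, which encodes nothing. -/

namespace Logspace

/-! ### Register machines and their simulation by a one-tape transducer -/

/-- Register operations that one sweep over the binary representations can perform. -/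
inductive Arith (ρ : Type)
  | inc (r : ρ)
  | copy (r r' : ρ)
  | clear (r : ρ)
  | cmp (r r' : ρ)

namespace Arith

variable {ρ : Type} [DecidableEq ρ]

/-- The effect of an operation on the registers. -/
def apply : Arith ρ → (ρ → ℕ) → ρ → ℕ
  | inc r, v => Function.update v r (v r + 1)
  | copy r r', v => Function.update v r (v r')
  | clear r, v => Function.update v r 0
  | cmp _ _, v => v

/-- The answer of an operation; only comparisons give information. -/
def result : Arith ρ → (ρ → ℕ) → Ordering
  | cmp r r', v => compare (v r) (v r')
  | _, _ => .eq

/-- The initial state of the sweep; for `inc` the state `.gt` stands for a carry. -/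
def start : Arith ρ → Ordering
  | inc _ => .gt
  | _ => .eq

/-- The treatment of one column of bits during a sweep from the least significant bit on. -/
def column : Arith ρ → Ordering → (ρ → Bool) → Ordering × (ρ → Bool)
  | inc r, o, v =>
    if o = .gt then (if v r then .gt else .eq, Function.update v r (!v r)) else (.eq, v)
  | copy r r', _, v => (.eq, Function.update v r (v r'))
  | clear r, _, v => (.eq, Function.update v r false)
  | cmp r r', o, v => (if v r = v r' then o else if v r then .gt else .lt, v)

open Classical in
/-- A complete sweep; a new column is added at the end if a carry is left. -/
noncomputable def sweep (A : Arith ρ) : Ordering → List (ρ → Bool) → List (ρ → Bool) × Ordering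
  | o, [] =>
    (if (A.column o fun _ => false).2 = (fun _ => false) then []
      else [(A.column o fun _ => false).2], (A.column o fun _ => false).1)
  | o, v :: vs =>
    ((A.column o v).2 :: (sweep A (A.column o v).1 vs).1, (sweep A (A.column o v).1 vs).2)

end Arith

/-- The numbers represented by a list of columns of bits. -/
def colVal {ρ : Type} : List (ρ → Bool) → ρ → ℕ
  | [], _ => 0
  | v :: vs, r => (v r).toNat + 2 * colVal vs r

namespace Arith

variable {ρ : Type} [DecidableEq ρ]

theorem sweep_inc_eq (r : ρ) (cols : List (ρ → Bool)) :
    colVal (sweep (inc r) .eq cols).1 = colVal cols ∧ (sweep (inc r) .eq cols).2 = .eq := by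
  induction cols with
  | nil => simp [sweep, column]
  | cons v vs ih =>
    simp only [sweep, column]
    refine ⟨?_, ih.2⟩
    funext q
    have := congrFun ih.1 q
    simp [colVal, this]

/-- Adding the carry flips a bit; it survives only if the bit was `1`, and past the last column it
becomes a new column. -/
theorem sweep_inc_gt (r : ρ) (cols : List (ρ → Bool)) :
    colVal (sweep (inc r) .gt cols).1 = Function.update (colVal cols) r (colVal cols r + 1) ∧
      (sweep (inc r) .gt cols).2 = .eq := by
  induction cols with
  | nil =>
    have h : ¬ (Function.update (fun _ : ρ => false) r true = fun _ => false) := by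
      intro h
      have := congrFun h r
      simp at this
    simp only [sweep, column, if_true, Bool.not_false, h, if_false, Bool.false_eq_true]
    refine ⟨?_, trivial⟩
    funext q
    by_cases hq : q = r <;> simp [colVal, Function.update_apply, hq]
  | cons v vs ih =>
    cases hv : v r
    · simp only [sweep, column, hv, if_true, Bool.not_false, Bool.false_eq_true, if_false]
      refine ⟨?_, (sweep_inc_eq r vs).2⟩
      funext q
      have := congrFun (sweep_inc_eq r vs).1 q
      by_cases hq : q = r
      · subst hq
        simp [colVal, this, hv, add_comm]
      · simp [colVal, this, hq]
    · simp only [sweep, column, hv, if_true, Bool.not_true]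
      refine ⟨?_, ih.2⟩
      funext q
      have := congrFun ih.1 q
      by_cases hq : q = r
      · subst hq
        simp [colVal, this, hv]
        ring
      · simp [colVal, this, hq]

theorem sweep_copy (r r' : ρ) (o : Ordering) (cols : List (ρ → Bool)) :
    colVal (sweep (copy r r') o cols).1 = Function.update (colVal cols) r (colVal cols r') ∧
      (sweep (copy r r') o cols).2 = .eq := by
  induction cols generalizing o with
  | nil =>
    simp only [sweep, column, Function.update_eq_self_iff]
    refine ⟨?_, trivial⟩
    funext q
    by_cases hq : q = r <;> simp [colVal, Function.update_apply, hq]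
  | cons v vs ih =>
    simp only [sweep, column]
    refine ⟨?_, (ih _).2⟩
    funext q
    have := congrFun (ih .eq).1 q
    by_cases hq : q = r
    · subst hq
      simp [colVal, this]
    · simp [colVal, this, hq]

theorem sweep_clear (r : ρ) (o : Ordering) (cols : List (ρ → Bool)) :
    colVal (sweep (clear r) o cols).1 = Function.update (colVal cols) r 0 ∧
      (sweep (clear r) o cols).2 = .eq := by
  induction cols generalizing o with
  | nil =>
    simp only [sweep, column, Function.update_eq_self_iff]
    refine ⟨?_, trivial⟩
    funext q
    by_cases hq : q = r <;> simp [colVal, Function.update_apply, hq]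
  | cons v vs ih =>
    simp only [sweep, column]
    refine ⟨?_, (ih _).2⟩
    funext q
    have := congrFun (ih .eq).1 q
    by_cases hq : q = r
    · subst hq
      simp [colVal, this]
    · simp [colVal, this, hq]

/-- Later columns are more significant and override earlier ones, so the state `o` collected so far
only breaks ties. -/
theorem sweep_cmp (r r' : ρ) (o : Ordering) (cols : List (ρ → Bool)) :
    colVal (sweep (cmp r r') o cols).1 = colVal cols ∧
      (sweep (cmp r r') o cols).2 = (compare (colVal cols r) (colVal cols r')).then o := by
  induction cols generalizing o with
  | nil => simp [sweep, column, colVal]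
  | cons v vs ih =>
    simp only [sweep, column]
    refine ⟨?_, ?_⟩
    · funext q
      have := congrFun (ih (if v r = v r' then o else if v r then .gt else .lt)).1 q
      simp [colVal, this]
    · rw [(ih _).2]
      simp only [colVal]
      rcases lt_trichotomy (colVal vs r) (colVal vs r') with h | h | h
      · rw [compare_lt_iff_lt.2 h, compare_lt_iff_lt.2]
        · rfl
        · cases v r <;> cases v r' <;> simp <;> omega
      · rw [h]
        cases v r <;> cases v r' <;> simp
        · rw [compare_lt_iff_lt.2 (by omega)]
          rfl
        · rw [compare_gt_iff_gt.2 (by omega)]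
          rfl
      · rw [compare_gt_iff_gt.2 h, compare_gt_iff_gt.2]
        · rfl
        · cases v r <;> cases v r' <;> simp <;> omega

theorem sweep_spec (A : Arith ρ) (cols : List (ρ → Bool)) :
    colVal (A.sweep A.start cols).1 = A.apply (colVal cols) ∧
      (A.sweep A.start cols).2 = A.result (colVal cols) := by
  cases A with
  | inc r => exact sweep_inc_gt r cols
  | copy r r' => exact sweep_copy r r' _ cols
  | clear r => exact sweep_clear r _ cols
  | cmp r r' =>
    refine ⟨(sweep_cmp r r' _ cols).1, ?_⟩
    rw [(sweep_cmp r r' _ cols).2]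
    simp [start, result]

/-- This is the source of the space bound: a new column is written only if it contains a `1`, so
some register has then become at least `2 ^ cols.length`. -/
theorem sweep_length (A : Arith ρ) (o : Ordering) (cols : List (ρ → Bool)) :
    (A.sweep o cols).1.length = cols.length ∨
      (A.sweep o cols).1.length = cols.length + 1 ∧
        ∃ r, 2 ^ cols.length ≤ colVal (A.sweep o cols).1 r := by
  induction cols generalizing o with
  | nil =>
    by_cases h : (A.column o fun _ => false).2 = fun _ => false
    · left
      simp [sweep, h]
    · right
      obtain ⟨r, hr⟩ : ∃ r, (A.column o fun _ => false).2 r ≠ false := by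
        by_contra hc
        push Not at hc
        exact h (funext hc)
      refine ⟨by simp [sweep, h], r, ?_⟩
      have hr' : (A.column o fun _ => false).2 r = true := by simpa using hr
      simp [sweep, h, colVal, hr']
  | cons v vs ih =>
    rcases ih (A.column o v).1 with h | ⟨h, r, hr⟩
    · left
      simp [sweep, h]
    · right
      refine ⟨by simp [sweep, h], r, ?_⟩
      simp only [sweep, colVal, List.length_cons, pow_succ]
      omega

end Arith

/-- The operations of a register machine with control store `F` and registers `ρ`. -/
inductive Op (σ τ F ρ : Type)
  | upd (φ : F → InputCell σ → F)
  | emit (a : τ)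
  | move (mv : Move)
  | arith (A : Arith ρ) (φ : F → Ordering → F)

/-- The store of a register machine. -/
structure RegStore (τ F ρ : Type) where
  ctl : F
  reg : ρ → ℕ
  head : ℕ
  out : List τ

variable {σ τ F ρ : Type} [DecidableEq ρ]

/-- The effect of an operation on the input `x`. -/
def Op.exec (x : List σ) : Op σ τ F ρ → RegStore τ F ρ → RegStore τ F ρ
  | upd φ, s => { s with ctl := φ s.ctl (inputCell x s.head) }
  | emit a, s => { s with out := s.out ++ [a] }
  | move mv, s => { s with head := min (mv.apply s.head) (x.length + 1) }
  | arith A φ, s => { s with ctl := φ s.ctl (A.result s.reg), reg := A.apply s.reg }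

/-- A flow graph of operations. -/
structure Flow (σ τ F ρ : Type) where
  N : Type
  finite_N : Finite N
  entry : N
  op : N → Op σ τ F ρ
  next : N → F → Option N

/-- The graph leads from the node `n` with the store `s` to its exit with the store `s'`, and no
register exceeds `B` on the way. -/
inductive Flow.Run (G : Flow σ τ F ρ) (x : List σ) (B : ℕ) :
    G.N → RegStore τ F ρ → RegStore τ F ρ → Prop
  | exit {n s} (hB : ∀ r, ((G.op n).exec x s).reg r ≤ B)
      (h : G.next n ((G.op n).exec x s).ctl = none) : Flow.Run G x B n s ((G.op n).exec x s)
  | step {n m s s'} (hB : ∀ r, ((G.op n).exec x s).reg r ≤ B)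
      (h : G.next n ((G.op n).exec x s).ctl = some m)
      (h' : Flow.Run G x B m ((G.op n).exec x s) s') : Flow.Run G x B n s s'

namespace Flow

/-- The states of the transducer that simulates a flow graph. -/
inductive TState (N F : Type)
  | boot
  | halt
  | node (n : N) (f : F)
  | sweep (n : N) (f : F) (o : Ordering)
  | back (n : N) (f : F)

theorem TState.finite (N F : Type) [Finite N] [Finite F] : Finite (TState N F) := by
  let e : TState N F → Unit ⊕ Unit ⊕ (N × F) ⊕ (N × F × Ordering) ⊕ (N × F)
    | .boot => .inl ()
    | .halt => .inr (.inl ())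
    | .node n f => .inr (.inr (.inl (n, f)))
    | .sweep n f o => .inr (.inr (.inr (.inl (n, f, o))))
    | .back n f => .inr (.inr (.inr (.inr (n, f))))
  refine Finite.of_injective e ?_
  intro a b h
  cases a <;> cases b <;> simp_all [e]

/-- The tape alphabet: blank, the mark in cell `0`, and columns of bits. -/
abbrev TSym (ρ : Type) : Type := Option (Option (ρ → Bool))

/-- The state in which the simulation of the next node begins. -/
def after (G : Flow σ τ F ρ) (n : G.N) (f : F) : TState G.N F :=
  match G.next n f with
  | some m => .node m f
  | none => .halt

open Classical in
/-- The transition function of the transducer that simulates a flow graph. -/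
noncomputable def trans (G : Flow σ τ F ρ) (f₀ : F) :
    TState G.N F → InputCell σ → TSym ρ → Option (Action (TState G.N F) (TSym ρ) τ 1)
  | .boot, _, _ => some ⟨.node G.entry f₀, .stay, fun _ => some none, fun _ => .stay, none⟩
  | .halt, _, _ => none
  | .node n f, c, g =>
    match G.op n with
    | .upd φ => some ⟨G.after n (φ f c), .stay, fun _ => g, fun _ => .stay, none⟩
    | .emit a => some ⟨G.after n f, .stay, fun _ => g, fun _ => .stay, some a⟩
    | .move mv => some ⟨G.after n f, mv, fun _ => g, fun _ => .stay, none⟩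
    | .arith A _ => some ⟨.sweep n f A.start, .stay, fun _ => g, fun _ => .right, none⟩
  | .sweep n f o, _, g =>
    match G.op n with
    | .arith A φ =>
      match g with
      | none => some ⟨.back n (φ f (A.column o fun _ => false).1), .stay,
          fun _ => if (A.column o fun _ => false).2 = (fun _ => false) then none
            else some (some (A.column o fun _ => false).2), fun _ => .left, none⟩
      | some (some v) => some ⟨.sweep n f (A.column o v).1, .stay,
          fun _ => some (some (A.column o v).2), fun _ => .right, none⟩
      | some none => none
    | _ => none
  | .back n f, _, g =>
    if g = some none then some ⟨G.after n f, .stay, fun _ => g, fun _ => .stay, none⟩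
    else some ⟨.back n f, .stay, fun _ => g, fun _ => .left, none⟩

/-- The transducer that simulates a flow graph. -/
noncomputable def transducer [Finite F] [Finite ρ] (G : Flow σ τ F ρ) (f₀ : F) :
    Transducer σ τ where
  Q := TState G.N F
  finite_Q := by
    have := G.finite_N
    exact TState.finite _ _
  start := .boot
  Γ := TSym ρ
  finite_Γ := inferInstance
  blank := none
  k := 1
  δ := fun q c g => G.trans f₀ q c (g 0)

/-- The work tape holding the given columns. -/
def tape (cols : List (ρ → Bool)) : ℕ → TSym ρ
  | 0 => some none
  | i + 1 => cols[i]?.map some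

omit [DecidableEq ρ] in
theorem update_tape (u w : List (ρ → Bool)) (v v' : ρ → Bool) :
    Function.update (tape (u ++ v :: w)) (u.length + 1) (some (some v')) =
      tape (u ++ v' :: w) := by
  funext i
  rcases i with _ | i
  · simp [tape]
  · simp only [Function.update_apply, tape, add_left_inj]
    rcases lt_trichotomy i u.length with h | h | h
    · rw [if_neg h.ne, List.getElem?_append_left h, List.getElem?_append_left h]
    · simp [h]
    · rw [if_neg h.ne', List.getElem?_append_right h.le, List.getElem?_append_right h.le]
      obtain ⟨j, hj⟩ : ∃ j, i - u.length = j + 1 := ⟨i - u.length - 1, by omega⟩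
      simp [hj]

omit [DecidableEq ρ] in
theorem update_tape_end (u : List (ρ → Bool)) (v' : ρ → Bool) :
    Function.update (tape u) (u.length + 1) (some (some v')) = tape (u ++ [v']) := by
  funext i
  rcases i with _ | i
  · simp [tape]
  · simp only [Function.update_apply, tape, add_left_inj]
    rcases lt_trichotomy i u.length with h | h | h
    · rw [if_neg h.ne, List.getElem?_append_left h]
    · simp [h]
    · rw [if_neg h.ne', List.getElem?_eq_none h.le, List.getElem?_eq_none (by simpa using h)]

variable [Finite F] [Finite ρ]

/-- A configuration of the simulating transducer. -/
noncomputable def cfg (G : Flow σ τ F ρ) (f₀ : F) (q : TState G.N F) (head : ℕ) (out : List τ)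
    (cols : List (ρ → Bool)) (p : ℕ) : (G.transducer f₀).Cfg where
  state := q
  inPos := head
  work := fun _ => tape cols
  workPos := fun _ => p
  out := out

/-- Some computation path leads from `c` to `c'`, all work head positions before the end being
less than `W`. -/
def Path (M : Transducer σ τ) (x : List σ) (W : ℕ) : M.Cfg → M.Cfg → Prop :=
  Relation.ReflTransGen fun a b => M.step x a = some b ∧ ∀ t, a.workPos t < W

/-- The induction needs the columns `u` already treated. Column `i` lies in cell `i + 1`, behind the
mark, and the sweep ends on the first blank cell, whence the `+ 1` in `hW`. -/
theorem path_sweep (G : Flow σ τ F ρ) (f₀ : F) (x : List σ) (W : ℕ) (n : G.N) (f : F)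
    (head : ℕ) (hh : head ≤ x.length + 1) (out : List τ) (A : Arith ρ) (φ : F → Ordering → F)
    (hA : G.op n = .arith A φ)
    (u cols : List (ρ → Bool)) (o : Ordering) (hW : u.length + cols.length + 1 < W) :
    Path (G.transducer f₀) x W
      (G.cfg f₀ (.sweep n f o) head out (u ++ cols) (u.length + 1))
      (G.cfg f₀ (.back n (φ f (A.sweep o cols).2)) head out (u ++ (A.sweep o cols).1)
        (u.length + cols.length)) := by
  induction cols generalizing u o with
  | nil =>
    refine Relation.ReflTransGen.single ⟨?_, fun _ => by simpa [cfg] using hW⟩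
    by_cases h : (A.column o fun _ => false).2 = fun _ => false
    · simp [Transducer.step, cfg, transducer, trans, hA, tape, h, Arith.sweep, Move.apply, hh]
      funext t
      rw [Function.update_eq_self_iff]
      simp [tape]
    · simp [Transducer.step, cfg, transducer, trans, hA, tape, h, Arith.sweep, Move.apply, hh]
      funext t
      rw [update_tape_end]
  | cons v vs ih =>
    have key := ih (u ++ [(A.column o v).2]) (A.column o v).1
      (by simp only [List.length_append, List.length_cons, List.length_nil] at hW ⊢; omega)
    refine Relation.ReflTransGen.head
      (b := G.cfg f₀ (.sweep n f (A.column o v).1) head out (u ++ (A.column o v).2 :: vs)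
        (u.length + 1 + 1)) ⟨?_, fun _ => by simp [cfg] at hW ⊢; omega⟩ ?_
    · simp [Transducer.step, cfg, transducer, trans, hA, tape, Move.apply, hh]
      funext t
      rw [update_tape]
    · simp only [List.append_assoc, List.cons_append, List.nil_append, List.length_append,
        List.length_cons, List.length_nil, Nat.zero_add] at key
      have e : u.length + (v :: vs).length = u.length + 1 + vs.length := by simp; omega
      rw [e]
      exact key

theorem path_back (G : Flow σ τ F ρ) (f₀ : F) (x : List σ) (W : ℕ) (n : G.N) (f : F)
    (head : ℕ) (hh : head ≤ x.length + 1) (out : List τ)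
    (cols : List (ρ → Bool)) (p : ℕ) (hW : p < W) :
    Path (G.transducer f₀) x W (G.cfg f₀ (.back n f) head out cols p)
      (G.cfg f₀ (G.after n f) head out cols 0) := by
  induction p with
  | zero =>
    refine Relation.ReflTransGen.single ⟨?_, fun _ => by simpa [cfg] using hW⟩
    simp [Transducer.step, cfg, transducer, trans, tape, Move.apply, hh]
    funext t
    rw [Function.update_eq_self_iff]
    simp [tape]
  | succ p ih =>
    refine Relation.ReflTransGen.head ⟨?_, fun _ => by simpa [cfg] using hW⟩ (ih (by omega))
    -- The mark stands only in cell `0`, so the head does not stop at a column.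
    have h : ¬ (cols[p]?.map some = some (none : Option (ρ → Bool))) := by
      cases cols[p]? <;> simp
    simp [Transducer.step, cfg, transducer, trans, tape, Move.apply, hh, h]
    funext t
    rw [Function.update_eq_self_iff]
    simp [tape]

/-- The number of columns never exceeds `B.size`, so the head needs the mark, these columns and one
blank cell: `B.size + 2` cells. -/
theorem path_node (G : Flow σ τ F ρ) (f₀ : F) (x : List σ) (B : ℕ) (n : G.N)
    (s : RegStore τ F ρ) (hh : s.head ≤ x.length + 1) (cols : List (ρ → Bool))
    (hc : colVal cols = s.reg) (hl : cols.length ≤ B.size)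
    (hB : ∀ r, ((G.op n).exec x s).reg r ≤ B) :
    ∃ cols', colVal cols' = ((G.op n).exec x s).reg ∧ cols'.length ≤ B.size ∧
      ((G.op n).exec x s).head ≤ x.length + 1 ∧
      Path (G.transducer f₀) x (B.size + 2) (G.cfg f₀ (.node n s.ctl) s.head s.out cols 0)
        (G.cfg f₀ (G.after n ((G.op n).exec x s).ctl) ((G.op n).exec x s).head
          ((G.op n).exec x s).out cols' 0) := by
  have hself : ∀ t : Fin 1, Function.update (tape cols) 0 (tape cols 0) = tape cols := by simp
  cases h : G.op n with
  | upd φ =>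
    refine ⟨cols, hc, hl, hh, Relation.ReflTransGen.single ⟨?_, fun _ => by simp [cfg]⟩⟩
    simp [Transducer.step, cfg, transducer, trans, h, Move.apply, hh, Op.exec]
  | emit a =>
    refine ⟨cols, hc, hl, hh, Relation.ReflTransGen.single ⟨?_, fun _ => by simp [cfg]⟩⟩
    simp [Transducer.step, cfg, transducer, trans, h, Move.apply, hh, Op.exec]
  | move mv =>
    refine ⟨cols, hc, hl, by simp [Op.exec],
      Relation.ReflTransGen.single ⟨?_, fun _ => by simp [cfg]⟩⟩
    simp [Transducer.step, cfg, transducer, trans, h, Move.apply, Op.exec]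
  | arith A φ =>
    rw [h] at hB
    obtain ⟨h1, h2⟩ := A.sweep_spec cols
    rw [hc] at h1 h2
    refine ⟨(A.sweep A.start cols).1, h1, ?_, hh, ?_⟩
    · rcases A.sweep_length A.start cols with hs | ⟨hs, r, hr⟩
      · rw [hs]
        exact hl
      -- If a column was added, some register is at least `2 ^ cols.length`, and `B` bounds it.
      · rw [hs, Nat.succ_le_iff, Nat.lt_size]
        rw [h1] at hr
        exact hr.trans (hB r)
    · have p2 := path_sweep G f₀ x (B.size + 2) n s.ctl s.head hh s.out A φ h [] cols A.start
        (by simp; omega)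
      have p3 := path_back G f₀ x (B.size + 2) n (φ s.ctl (A.sweep A.start cols).2) s.head hh s.out
        (A.sweep A.start cols).1 cols.length (by omega)
      simp only [List.nil_append, List.length_nil, Nat.zero_add] at p2
      refine Relation.ReflTransGen.head
        (b := G.cfg f₀ (.sweep n s.ctl A.start) s.head s.out cols 1)
        ⟨?_, fun _ => by simp [cfg]⟩ ?_
      · simp [Transducer.step, cfg, transducer, trans, h, Move.apply, hh]
      · have := p2.trans p3
        rw [h2] at this
        exact this

theorem Run.path {G : Flow σ τ F ρ} {x : List σ} {B : ℕ} {n : G.N} {s s' : RegStore τ F ρ}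
    (hr : G.Run x B n s s') (f₀ : F) (hh : s.head ≤ x.length + 1) (cols : List (ρ → Bool))
    (hc : colVal cols = s.reg) (hl : cols.length ≤ B.size) :
    ∃ cols', Path (G.transducer f₀) x (B.size + 2) (G.cfg f₀ (.node n s.ctl) s.head s.out cols 0)
        (G.cfg f₀ .halt s'.head s'.out cols' 0) := by
  induction hr generalizing cols with
  | @exit n s hB h =>
    obtain ⟨cols', -, -, -, hp⟩ := path_node G f₀ x B n s hh cols hc hl hB
    refine ⟨cols', ?_⟩
    simpa [after, h] using hp
  | @step n m s s' hB h h' ih =>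
    obtain ⟨cols₁, hc₁, hl₁, hh₁, hp⟩ := path_node G f₀ x B n s hh cols hc hl hB
    obtain ⟨cols', hp'⟩ := ih hh₁ cols₁ hc₁ hl₁
    refine ⟨cols', Relation.ReflTransGen.trans ?_ hp'⟩
    simp only [after, h] at hp
    exact hp

-- The machine is deterministic, so every reachable configuration lies on the path that leads to the
-- halting one.
omit [DecidableEq ρ] [Finite F] [Finite ρ] in
theorem path_bound {M : Transducer σ τ} {x : List σ} {W : ℕ} {c c' : M.Cfg}
    (hp : Path M x W c c') (hc' : ∀ t, c'.workPos t < W) (hfinal : M.step x c' = none)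
    (d : M.Cfg) (hd : StateTransition.Reaches (M.step x) c d) : ∀ t, d.workPos t < W := by
  induction hp using Relation.ReflTransGen.head_induction_on with
  | refl =>
    rcases Relation.ReflTransGen.cases_head hd with rfl | ⟨e, he, -⟩
    · exact hc'
    · simp [hfinal] at he
  | head h _ ih =>
    rcases Relation.ReflTransGen.cases_head hd with rfl | ⟨e, he, hed⟩
    · exact h.2
    · rw [h.1] at he
      obtain rfl : _ = e := by simpa using he
      exact ih hed

/-- The initial store. -/
def _root_.Logspace.RegStore.init (f₀ : F) : RegStore τ F ρ := ⟨f₀, fun _ => 0, 0, []⟩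

theorem Run.transducer {G : Flow σ τ F ρ} {x : List σ} {B : ℕ} {f₀ : F} {s' : RegStore τ F ρ}
    (hr : G.Run x B G.entry (RegStore.init f₀) s') :
    (G.transducer f₀).HaltsWith x s'.out ∧ (G.transducer f₀).UsesSpaceAtMost x (B.size + 2) := by
  obtain ⟨cols', hp⟩ := hr.path f₀ (by simp [RegStore.init]) [] (by funext r; rfl) (by simp)
  have h0 : Path (G.transducer f₀) x (B.size + 2) (G.transducer f₀).init
      (G.cfg f₀ .halt s'.head s'.out cols' 0) := by
    refine Relation.ReflTransGen.head ⟨?_, fun _ => by simp [Transducer.init]⟩ hp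
    simp [Transducer.step, cfg, Flow.transducer, trans, Transducer.init, Move.apply, RegStore.init]
    -- Writing the mark turns the blank tape into the tape without columns, which represents `0` in
    -- all registers.
    funext t i
    rcases i with _ | i <;> simp [tape]
  have hfinal : (G.transducer f₀).step x (G.cfg f₀ .halt s'.head s'.out cols' 0) = none := by
    simp [Transducer.step, cfg, Flow.transducer, trans]
  refine ⟨⟨_, Relation.ReflTransGen.mono (fun a b h => h.1) _ _ h0, hfinal, rfl⟩, ?_⟩
  exact fun c hc => path_bound h0 (by simp [cfg]) hfinal c hc

end Flow

end Logspace

/-! ### Structured programs and their translation into logspace transducers -/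

namespace Logspace

/-! ### While programs over register machines -/

/-- While programs built from the operations of a register machine. -/
inductive Low (σ τ F ρ : Type)
  | op (a : Op σ τ F ρ)
  | seq (P Q : Low σ τ F ρ)
  | while (φ : F → Bool) (P : Low σ τ F ρ)
  | ite (φ : F → Bool) (P Q : Low σ τ F ρ)

variable {σ τ F ρ : Type}

/-- No register exceeds `B`. -/
def RegStore.Bounded (B : ℕ) (s : RegStore τ F ρ) : Prop := ∀ r, s.reg r ≤ B

namespace Flow

/-- First one graph, then the other. -/
def seq (G H : Flow σ τ F ρ) : Flow σ τ F ρ where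
  N := G.N ⊕ H.N
  finite_N := by
    have := G.finite_N
    have := H.finite_N
    infer_instance
  entry := .inl G.entry
  op := Sum.elim G.op H.op
  next := Sum.elim (fun n f => some (((G.next n f).map Sum.inl).getD (.inr H.entry)))
    (fun n f => (H.next n f).map .inr)

/-- Repeat a graph while a condition holds. -/
def loop (φ : F → Bool) (G : Flow σ τ F ρ) : Flow σ τ F ρ where
  N := Option G.N
  finite_N := by
    have := G.finite_N
    infer_instance
  entry := none
  -- The node `none` does nothing: a successor is chosen only after an operation, and the condition
  -- must be tested before the body.
  op := fun n => n.elim (.upd fun f _ => f) G.op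
  next := fun n f => n.elim (if φ f then some (some G.entry) else none)
    (fun n => some (G.next n f))

/-- Choose between two graphs. -/
def branch (φ : F → Bool) (G H : Flow σ τ F ρ) : Flow σ τ F ρ where
  N := Option (G.N ⊕ H.N)
  finite_N := by
    have := G.finite_N
    have := H.finite_N
    infer_instance
  entry := none
  op := fun n => n.elim (.upd fun f _ => f) (Sum.elim G.op H.op)
  next := fun n f => n.elim (some (some (if φ f then .inl G.entry else .inr H.entry)))
    (Sum.elim (fun n => (G.next n f).map fun m => some (.inl m))
      (fun n => (H.next n f).map fun m => some (.inr m)))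

end Flow

namespace Low

/-- The flow graph of a while program. -/
def flow : Low σ τ F ρ → Flow σ τ F ρ
  | op a => ⟨Unit, inferInstance, (), fun _ => a, fun _ _ => none⟩
  | seq P Q => P.flow.seq Q.flow
  | .while φ P => P.flow.loop φ
  | ite φ P Q => P.flow.branch φ Q.flow

variable [DecidableEq ρ]

/-- Big-step semantics of while programs, with a bound on the registers. -/
inductive Exec (x : List σ) (B : ℕ) : Low σ τ F ρ → RegStore τ F ρ → RegStore τ F ρ → Prop
  | op {a s} (h : (a.exec x s).Bounded B) : Exec x B (op a) s (a.exec x s)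
  | seq {P Q s s' s''} (h : Exec x B P s s') (h' : Exec x B Q s' s'') : Exec x B (seq P Q) s s''
  | while_true {φ P s s' s''} (hφ : φ s.ctl = true) (h : Exec x B P s s')
      (h' : Exec x B (.while φ P) s' s'') : Exec x B (.while φ P) s s''
  | while_false {φ P s} (hφ : φ s.ctl = false) : Exec x B (.while φ P) s s
  | ite_true {φ P Q s s'} (hφ : φ s.ctl = true) (h : Exec x B P s s') : Exec x B (ite φ P Q) s s'
  | ite_false {φ P Q s s'} (hφ : φ s.ctl = false) (h : Exec x B Q s s') : Exec x B (ite φ P Q) s s'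

theorem Exec.mono {x : List σ} {B B' : ℕ} (hB : B ≤ B') {P : Low σ τ F ρ} {s s' : RegStore τ F ρ}
    (h : Exec x B P s s') : Exec x B' P s s' := by
  induction h with
  | op h => exact .op fun r => (h r).trans hB
  | seq _ _ ih ih' => exact .seq ih ih'
  | while_true hφ _ _ ih ih' => exact .while_true hφ ih ih'
  | while_false hφ => exact .while_false hφ
  | ite_true hφ _ ih => exact .ite_true hφ ih
  | ite_false hφ _ ih => exact .ite_false hφ ih

theorem run_seq_right {x : List σ} {B : ℕ} (G : Flow σ τ F ρ) {H : Flow σ τ F ρ} {n : H.N}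
    {s s' : RegStore τ F ρ} (h : H.Run x B n s s') : (G.seq H).Run x B (Sum.inr n) s s' := by
  induction h with
  | @exit n s hB h =>
    exact .exit (G := G.seq H) (n := Sum.inr n) hB (by simp [Flow.seq, h])
  | @step n m s s' hB h _ ih =>
    exact .step (G := G.seq H) (n := Sum.inr n) (m := Sum.inr m) hB (by simp [Flow.seq, h]) ih

theorem run_seq_left {x : List σ} {B : ℕ} {G H : Flow σ τ F ρ} {n : G.N}
    {s s' s'' : RegStore τ F ρ} (h : G.Run x B n s s') (h' : H.Run x B H.entry s' s'') :
    (G.seq H).Run x B (Sum.inl n) s s'' := by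
  induction h with
  | @exit n s hB h =>
    exact .step (G := G.seq H) (n := Sum.inl n) (m := Sum.inr H.entry) hB (by simp [Flow.seq, h])
      (run_seq_right G h')
  | @step n m s s' hB h _ ih =>
    exact .step (G := G.seq H) (n := Sum.inl n) (m := Sum.inl m) hB (by simp [Flow.seq, h]) (ih h')

theorem run_branch_left {x : List σ} {B : ℕ} (φ : F → Bool) {G : Flow σ τ F ρ}
    (H : Flow σ τ F ρ) {n : G.N} {s s' : RegStore τ F ρ} (h : G.Run x B n s s') :
    (G.branch φ H).Run x B (some (Sum.inl n)) s s' := by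
  induction h with
  | @exit n s hB h =>
    exact .exit (G := G.branch φ H) (n := some (Sum.inl n)) hB (by simp [Flow.branch, h])
  | @step n m s s' hB h _ ih =>
    exact .step (G := G.branch φ H) (n := some (Sum.inl n)) (m := some (Sum.inl m)) hB
      (by simp [Flow.branch, h]) ih

theorem run_branch_right {x : List σ} {B : ℕ} (φ : F → Bool) (G : Flow σ τ F ρ)
    {H : Flow σ τ F ρ} {n : H.N} {s s' : RegStore τ F ρ} (h : H.Run x B n s s') :
    (G.branch φ H).Run x B (some (Sum.inr n)) s s' := by
  induction h with
  | @exit n s hB h =>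
    exact .exit (G := G.branch φ H) (n := some (Sum.inr n)) hB (by simp [Flow.branch, h])
  | @step n m s s' hB h _ ih =>
    exact .step (G := G.branch φ H) (n := some (Sum.inr n)) (m := some (Sum.inr m)) hB
      (by simp [Flow.branch, h]) ih

theorem run_loop_body {x : List σ} {B : ℕ} {φ : F → Bool} {G : Flow σ τ F ρ} {n : G.N}
    {s s' s'' : RegStore τ F ρ} (h : G.Run x B n s s')
    (h' : (G.loop φ).Run x B (none : Option G.N) s' s'') :
    (G.loop φ).Run x B (some n) s s'' := by
  induction h with
  | @exit n s hB h =>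
    exact .step (G := G.loop φ) (n := some n) (m := none) hB (by simp [Flow.loop, h]) h'
  | @step n m s s' hB h _ ih =>
    exact .step (G := G.loop φ) (n := some n) (m := some m) hB (by simp [Flow.loop, h]) (ih h')

/-- The bound on the initial store is needed because the idle nodes that test conditions count as
steps of the flow graph. -/
theorem Exec.run {x : List σ} {B : ℕ} {P : Low σ τ F ρ} {s s' : RegStore τ F ρ}
    (h : Exec x B P s s') (hs : s.Bounded B) :
    P.flow.Run x B P.flow.entry s s' ∧ s'.Bounded B := by
  induction h with
  | op h => exact ⟨.exit (G := (Low.op _).flow) h rfl, h⟩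
  | seq _ _ ih ih' => exact ⟨run_seq_left (ih hs).1 (ih' (ih hs).2).1, (ih' (ih hs).2).2⟩
  | @while_true φ P s s' s'' hφ _ _ ih ih' =>
    refine ⟨.step (G := P.flow.loop φ) (n := none) (m := some P.flow.entry) hs ?_
      (run_loop_body (ih hs).1 (ih' (ih hs).2).1), (ih' (ih hs).2).2⟩
    simp [Flow.loop, Op.exec, hφ]
  | @while_false φ P s hφ =>
    refine ⟨.exit (G := P.flow.loop φ) (n := none) hs ?_, hs⟩
    simp [Flow.loop, Op.exec, hφ]
  | @ite_true φ P Q s s' hφ _ ih =>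
    refine ⟨.step (G := P.flow.branch φ Q.flow) (n := none) (m := some (Sum.inl P.flow.entry)) hs ?_
      (run_branch_left φ _ (ih hs).1), (ih hs).2⟩
    simp [Flow.branch, Op.exec, hφ]
  | @ite_false φ P Q s s' hφ _ ih =>
    refine ⟨.step (G := P.flow.branch φ Q.flow) (n := none) (m := some (Sum.inr Q.flow.entry)) hs ?_
      (run_branch_right φ _ (ih hs).1), (ih hs).2⟩
    simp [Flow.branch, Op.exec, hφ]

/-- The invariant is indexed by the number of completed rounds, and the loop makes exactly `k` of
them; the induction is on the rounds that remain. -/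
theorem exec_while_of {x : List σ} {B : ℕ} {φ : F → Bool} {P : Low σ τ F ρ}
    (Inv : ℕ → RegStore τ F ρ → Prop) (k : ℕ)
    (hstep : ∀ i < k, ∀ t, Inv i t → φ t.ctl = true ∧ ∃ t', Exec x B P t t' ∧ Inv (i + 1) t')
    (hend : ∀ t, Inv k t → φ t.ctl = false) {t : RegStore τ F ρ} (h0 : Inv 0 t) :
    ∃ t', Exec x B (.while φ P) t t' ∧ Inv k t' := by
  suffices h : ∀ j ≤ k, ∀ t, Inv (k - j) t → ∃ t', Exec x B (.while φ P) t t' ∧ Inv k t' by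
    exact h k le_rfl t (by simpa using h0)
  intro j
  induction j with
  | zero => exact fun _ t ht => ⟨t, .while_false (hend t ht), ht⟩
  | succ j ih =>
    intro hj t ht
    obtain ⟨hφ, t', he, hi⟩ := hstep _ (by omega) t ht
    have e : k - (j + 1) + 1 = k - j := by omega
    rw [e] at hi
    obtain ⟨t'', he', hi'⟩ := ih (by omega) t' hi
    exact ⟨t'', .while_true hφ he he', hi'⟩

/-- Since `n + 2 ≤ 2 ^ (log n + 2)`, the power has at most `K * (log n + 2) + 1` bits. The base `n +
2` keeps the bound useful for short inputs. -/
theorem size_pow_le (n K : ℕ) : ((n + 2) ^ K).size + 2 ≤ (2 * K + 3) * (Nat.log 2 n + 1) := by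
  have h1 : n + 2 ≤ 2 ^ (Nat.log 2 n + 2) := by
    have := Nat.lt_pow_succ_log_self (b := 2) (by norm_num) n
    have h2 : 2 ≤ 2 ^ (Nat.log 2 n + 1) := by
      rw [pow_succ]
      have : 0 < 2 ^ Nat.log 2 n := by positivity
      omega
    rw [pow_succ]
    simp only [Nat.succ_eq_add_one] at this
    omega
  have h3 : ((n + 2) ^ K).size ≤ (Nat.log 2 n + 2) * K + 1 := by
    rw [Nat.size_le, pow_succ, pow_mul]
    have := Nat.pow_le_pow_left h1 K
    have h4 : 0 < (2 ^ (Nat.log 2 n + 2)) ^ K := by positivity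
    omega
  nlinarith [Nat.zero_le (Nat.log 2 n), Nat.zero_le (K * Nat.log 2 n)]

theorem computable [Finite F] [Finite ρ] (P : Low σ τ F ρ) (f₀ : F) (K : ℕ) (g : List σ → List τ)
    (h : ∀ x, ∃ s', Exec x ((x.length + 2) ^ K) P (RegStore.init f₀) s' ∧ s'.out = g x) :
    Computable g := by
  refine ⟨P.flow.transducer f₀, 2 * K + 3, fun x => ?_⟩
  obtain ⟨s', he, ho⟩ := h x
  have hr := (he.run fun _ => Nat.zero_le _).1.transducer
  rw [ho] at hr
  exact ⟨hr.1, fun c hc t => (hr.2 c hc t).trans_le (size_pow_le _ K)⟩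

end Low

/-! ### Loop programs -/

/-- Loop programs: all loops are bounded by the length of the input up to a constant, so that
the values of the registers are automatically polynomially bounded. -/
inductive Prog (σ τ F R : Type)
  | upd (φ : F → F)
  | emit (a : τ)
  | emitN (r : R) (a : τ)
  | inc (r : R)
  | copy (r r' : R)
  | clear (r : R)
  | len (r : R)
  | read (r : R) (φ : F → Option σ → F)
  | seq (P Q : Prog σ τ F R)
  | ite (φ : F → Bool) (P Q : Prog σ τ F R)
  | ifCmp (ψ : Ordering → Bool) (r r' : R) (P Q : Prog σ τ F R)
  | forN (b : Fin 3) (r : R) (P : Prog σ τ F R)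

/-- The store of a loop program. -/
structure Store (τ F R : Type) where
  ctl : F
  reg : R → ℕ
  out : List τ

namespace Prog

variable {R : Type} [DecidableEq R]

/-- Increment a register. -/
def _root_.Logspace.Store.inc (r : R) (s : Store τ F R) : Store τ F R :=
  { s with reg := Function.update s.reg r (s.reg r + 1) }

/-- The semantics of loop programs. -/
def eval (x : List σ) : Prog σ τ F R → Store τ F R → Store τ F R
  | upd φ, s => { s with ctl := φ s.ctl }
  | emit a, s => { s with out := s.out ++ [a] }
  | emitN r a, s => { s with out := s.out ++ List.replicate (s.reg r) a }
  | inc r, s => s.inc r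
  | copy r r', s => { s with reg := Function.update s.reg r (s.reg r') }
  | clear r, s => { s with reg := Function.update s.reg r 0 }
  | len r, s => { s with reg := Function.update s.reg r x.length }
  | read r φ, s => { s with ctl := φ s.ctl x[s.reg r]? }
  | seq P Q, s => eval x Q (eval x P s)
  | ite φ P Q, s => if φ s.ctl then eval x P s else eval x Q s
  | ifCmp ψ r r' P Q, s => if ψ (compare (s.reg r) (s.reg r')) then eval x P s else eval x Q s
  | forN b r P, s =>
    (fun s => (eval x P s).inc r)^[x.length + b]
      { s with reg := Function.update s.reg r 0 }

/-- Does the program write to the register? -/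
def writes (q : R) : Prog σ τ F R → Bool
  | inc r => r = q
  | copy r _ => r = q
  | clear r => r = q
  | len r => r = q
  | seq P Q => P.writes q || Q.writes q
  | ite _ P Q => P.writes q || Q.writes q
  | ifCmp _ _ _ P Q => P.writes q || Q.writes q
  | forN _ r P => decide (r = q) || P.writes q
  | _ => false

/-- No loop variable is written to in the body of its loop. -/
def wf : Prog σ τ F R → Bool
  | seq P Q => P.wf && Q.wf
  | ite _ P Q => P.wf && Q.wf
  | ifCmp _ _ _ P Q => P.wf && Q.wf
  | forN _ r P => !P.writes r && P.wf
  | _ => true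

/-- A bound on the number of increments. -/
def cost (n : ℕ) : Prog σ τ F R → ℕ
  | inc _ => 1
  | seq P Q => P.cost n + Q.cost n
  | ite _ P Q => P.cost n + Q.cost n
  | ifCmp _ _ _ P Q => P.cost n + Q.cost n
  | forN b _ P => (n + b) * P.cost n
  | _ => 0

-- Sequences add costs and loops multiply them by at most `n + 2`, because `b ≤ 2`; hence a
-- polynomial in `n + 2`.
omit [DecidableEq R] in
theorem cost_le (P : Prog σ τ F R) : ∃ K, ∀ n, P.cost n ≤ (n + 2) ^ K := by
  have hadd : ∀ (u v : ℕ → ℕ), (∃ K, ∀ n, u n ≤ (n + 2) ^ K) → (∃ K, ∀ n, v n ≤ (n + 2) ^ K) →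
      ∃ K, ∀ n, u n + v n ≤ (n + 2) ^ K := by
    rintro u v ⟨K, hK⟩ ⟨L, hL⟩
    refine ⟨max K L + 1, fun n => ?_⟩
    have h1 := (hK n).trans (Nat.pow_le_pow_right (show 0 < n + 2 by omega) (le_max_left K L))
    have h2 := (hL n).trans (Nat.pow_le_pow_right (show 0 < n + 2 by omega) (le_max_right K L))
    rw [pow_succ]
    nlinarith
  induction P with
  | seq P Q ihP ihQ => exact hadd _ _ ihP ihQ
  | ite _ P Q ihP ihQ => exact hadd _ _ ihP ihQ
  | ifCmp _ _ _ P Q ihP ihQ => exact hadd _ _ ihP ihQ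
  | forN b r P ih =>
    obtain ⟨K, hK⟩ := ih
    refine ⟨K + 1, fun n => ?_⟩
    rw [pow_succ, mul_comm _ (n + 2), cost]
    exact Nat.mul_le_mul (by have := b.isLt; omega) (hK n)
  | inc r => exact ⟨0, fun n => by simp [cost]⟩
  | _ => exact ⟨0, fun n => by simp [cost]⟩

/-- The frame rule. As `writes` is computable, its hypothesis is proved by `rfl` for concrete
programs. -/
theorem eval_reg_of_not_writes (x : List σ) (q : R) (P : Prog σ τ F R) (h : P.writes q = false)
    (s : Store τ F R) : (P.eval x s).reg q = s.reg q := by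
  induction P generalizing s with
  | seq P Q ihP ihQ =>
    simp only [writes, Bool.or_eq_false_iff] at h
    rw [eval, ihQ h.2, ihP h.1]
  | ite φ P Q ihP ihQ =>
    simp only [writes, Bool.or_eq_false_iff] at h
    rw [eval]
    split
    · exact ihP h.1 s
    · exact ihQ h.2 s
  | ifCmp ψ r r' P Q ihP ihQ =>
    simp only [writes, Bool.or_eq_false_iff] at h
    rw [eval]
    split
    · exact ihP h.1 s
    · exact ihQ h.2 s
  | forN b r P ih =>
    simp only [writes, Bool.or_eq_false_iff, decide_eq_false_iff_not] at h
    rw [eval]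
    generalize x.length + (b : ℕ) = k
    induction k with
    | zero => simp [Ne.symm h.1]
    | succ k ihk =>
      rw [Function.iterate_succ_apply', Store.inc]
      simp only [Function.update_apply, Ne.symm h.1, if_false]
      rw [ih h.2, ihk]
  | inc r => simp_all [writes, eval, Store.inc, Function.update_apply]; intro e; exact absurd e.symm h
  | copy r => simp_all [writes, eval, Function.update_apply]; intro e; exact absurd e.symm h
  | clear r => simp_all [writes, eval, Function.update_apply]; intro e; exact absurd e.symm h
  | len r => simp_all [writes, eval, Function.update_apply]; intro e; exact absurd e.symm h
  | _ => rfl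

/-- The registers of the machine that executes a loop program. -/
inductive LReg (R : Type)
  | user (r : R)
  | len (b : Fin 3)
  | scratch
  deriving DecidableEq

theorem LReg.finite (R : Type) [Finite R] : Finite (LReg R) := by
  let e : LReg R → R ⊕ Fin 3 ⊕ Unit
    | .user r => .inl r
    | .len b => .inr (.inl b)
    | .scratch => .inr (.inr ())
  refine Finite.of_injective e ?_
  intro a b h
  cases a <;> cases b <;> simp_all [e]

/-- Compare two registers and set the flag if the first one is smaller. -/
def lowLt (r r' : LReg R) : Low σ τ (F × Bool) (LReg R) :=
  .op (.arith (.cmp r r') fun f o => (f.1, o == .lt))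

/-- An arithmetic operation that leaves the control store alone. -/
def lowArith (A : Arith (LReg R)) : Low σ τ (F × Bool) (LReg R) :=
  .op (.arith A fun f _ => f)

/-- Set the flag according to the current input cell. -/
def lowTest (ψ : InputCell σ → Bool) : Low σ τ (F × Bool) (LReg R) :=
  .op (.upd fun f c => (f.1, ψ c))

/-- Is this the left endmarker? -/
def _root_.Logspace.InputCell.isLeftEnd : InputCell σ → Bool
  | .leftEnd => true
  | _ => false

/-- The letter in a cell. -/
def _root_.Logspace.InputCell.letter? : InputCell σ → Option σ
  | .letter a => some a
  | _ => none

/-- Repeat `P` until the register `r`, counted up from `0`, reaches `r'`. -/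
def lowFor (r r' : LReg R) (P : Low σ τ (F × Bool) (LReg R)) : Low σ τ (F × Bool) (LReg R) :=
  .seq (lowArith (.clear r)) (.seq (lowLt r r')
    (.while Prod.snd (.seq P (.seq (lowArith (.inc r)) (lowLt r r')))))

/-- Move the input head to the left end. -/
def lowRewind : Low σ τ (F × Bool) (LReg R) :=
  .seq (lowTest fun c => !c.isLeftEnd)
    (.while Prod.snd (.seq (.op (.move .left)) (lowTest fun c => !c.isLeftEnd)))

/-- The while program of a loop program. -/
def low : Prog σ τ F R → Low σ τ (F × Bool) (LReg R)
  | upd φ => .op (.upd fun f _ => (φ f.1, f.2))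
  | emit a => .op (.emit a)
  | emitN r a => lowFor .scratch (.user r) (.op (.emit a))
  | inc r => lowArith (.inc (.user r))
  | copy r r' => lowArith (.copy (.user r) (.user r'))
  | clear r => lowArith (.clear (.user r))
  | len r => lowArith (.copy (.user r) (.len 0))
  | read r φ => .seq lowRewind (.seq (lowFor .scratch (.user r) (.op (.move .right)))
      (.seq (.op (.move .right)) (.op (.upd fun f c => (φ f.1 c.letter?, f.2)))))
  | seq P Q => .seq P.low Q.low
  | ite φ P Q => .ite (fun f => φ f.1) P.low Q.low
  | ifCmp ψ r r' P Q =>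
    .seq (.op (.arith (.cmp (.user r) (.user r')) fun f o => (f.1, ψ o)))
      (.ite Prod.snd P.low Q.low)
  | forN b r P => lowFor (.user r) (.len b) P.low

/-- The machine store `t` represents the store `s`, and no register exceeds `M`. -/
structure Rep (x : List σ) (M : ℕ) (s : Store τ F R) (t : RegStore τ (F × Bool) (LReg R)) :
    Prop where
  ctl : t.ctl.1 = s.ctl
  user : ∀ r, t.reg (.user r) = s.reg r
  len : ∀ b : Fin 3, t.reg (.len b) = x.length + b
  out : t.out = s.out
  head : t.head ≤ x.length + 1
  bounded : t.Bounded M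

omit [DecidableEq R] in
theorem Rep.mono {x : List σ} {M M' : ℕ} (h : M ≤ M') {s : Store τ F R}
    {t : RegStore τ (F × Bool) (LReg R)} (hr : Rep x M s t) : Rep x M' s t :=
  { hr with bounded := fun r => (hr.bounded r).trans h }

omit [DecidableEq R] in
theorem Rep.le {x : List σ} {M : ℕ} {s : Store τ F R}
    {t : RegStore τ (F × Bool) (LReg R)} (hr : Rep x M s t) (r : R) : s.reg r ≤ M :=
  hr.user r ▸ hr.bounded _

open Low (Exec)

/-- Every comparison overwrites the flag, so the invariant must not depend on it (`hctl`). The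
counter is incremented after the body, which must leave it and the limit unchanged. -/
theorem exec_lowFor {x : List σ} {B : ℕ} (r r' : LReg R) (P : Low σ τ (F × Bool) (LReg R))
    (Inv : ℕ → RegStore τ (F × Bool) (LReg R) → Prop) (k : ℕ)
    (hctl : ∀ i t b, Inv i t → Inv i { t with ctl := (t.ctl.1, b) })
    (hInv : ∀ i t, Inv i t → t.reg r = i ∧ t.reg r' = k ∧ t.Bounded B)
    (hstep : ∀ i < k, ∀ t, Inv i t → ∃ t', Exec x B P t t' ∧ t'.reg r = i ∧ t'.reg r' = k ∧
      Inv (i + 1) { t' with reg := Function.update t'.reg r (i + 1) })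
    {t : RegStore τ (F × Bool) (LReg R)}
    (h0 : Inv 0 { t with reg := Function.update t.reg r 0 }) :
    ∃ t', Exec x B (lowFor r r' P) t t' ∧ Inv k t' := by
  obtain ⟨t', he, hi⟩ := Low.exec_while_of (x := x) (B := B) (φ := Prod.snd)
    (P := .seq P (.seq (lowArith (.inc r)) (lowLt r r')))
    -- The flag tells whether another round is due.
    (fun i t => Inv i t ∧ t.ctl.2 = decide (i < k)) k
    (by
      rintro i hi t ⟨hI, hc⟩
      refine ⟨by simpa [hi] using hc, ?_⟩
      obtain ⟨t', he, hr, hr', hI'⟩ := hstep i hi t hI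
      have hI2 := hctl _ _ (decide (i + 1 < k)) hI'
      refine ⟨_, .seq he (.seq (.op ?_) (.op ?_)), ?_⟩
      · simpa [Op.exec, Arith.apply, RegStore.Bounded, hr] using (hInv _ _ hI').2.2
      · simpa [Op.exec, Arith.apply, RegStore.Bounded, hr] using (hInv _ _ hI').2.2
      · have h3 := (hInv _ _ hI').2.1
        simp only at h3
        simp only [Op.exec, Arith.apply, Arith.result, hr, Function.update_self, h3]
        have e : (compare (i + 1) k == Ordering.lt) = decide (i + 1 < k) := by
          rw [Bool.eq_iff_iff]
          simp [compare_lt_iff_lt]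
        rw [e]
        exact ⟨hI2, rfl⟩)
    (by
      rintro t ⟨-, hc⟩
      simpa using hc)
    (t := { t with reg := Function.update t.reg r 0, ctl := (t.ctl.1, decide (0 < k)) })
    ⟨hctl _ _ _ h0, rfl⟩
  refine ⟨t', .seq (.op ?_) (.seq (.op ?_) ?_), hi.1⟩
  · simpa [Op.exec, Arith.apply, RegStore.Bounded] using (hInv _ _ h0).2.2
  · simpa [Op.exec, Arith.apply, RegStore.Bounded] using (hInv _ _ h0).2.2
  · have h3 := (hInv _ _ h0).2.1
    simp only at h3
    simp only [Op.exec, Arith.apply, Arith.result, Function.update_self, h3]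
    have e : (compare 0 k == Ordering.lt) = decide (0 < k) := by
      rw [Bool.eq_iff_iff]
      simp [compare_lt_iff_lt]
    rw [e]
    exact he

theorem isLeftEnd_inputCell (x : List σ) (p : ℕ) :
    (inputCell x p).isLeftEnd = decide (p = 0) := by
  rcases p with _ | p
  · rfl
  · simp only [inputCell]
    cases x[p]? <;> simp [InputCell.isLeftEnd]

theorem letter?_inputCell (x : List σ) (p : ℕ) :
    (inputCell x (p + 1)).letter? = x[p]? := by
  simp only [inputCell]
  cases x[p]? <;> rfl

theorem exec_lowRewind {x : List σ} {B : ℕ} (t : RegStore τ (F × Bool) (LReg R))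
    (ht : t.head ≤ x.length + 1) (hB : t.Bounded B) :
    ∃ b, Exec x B lowRewind t { t with head := 0, ctl := (t.ctl.1, b) } := by
  obtain ⟨t', he, hi⟩ := Low.exec_while_of (x := x) (B := B) (φ := Prod.snd)
    (P := .seq (.op (.move .left)) (lowTest fun c => !c.isLeftEnd))
    (fun i t' => t' = { t with head := t.head - i, ctl := (t.ctl.1, !decide (t.head - i = 0)) })
    t.head
    (by
      rintro i hi t' rfl
      refine ⟨by simp; omega, _, .seq (.op hB) (.op hB), ?_⟩
      have e : min (t.head - i - 1) (x.length + 1) = t.head - (i + 1) := by omega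
      simp [Op.exec, Move.apply, isLeftEnd_inputCell, e])
    (by
      rintro t' rfl
      simp)
    (t := { t with ctl := (t.ctl.1, !decide (t.head = 0)) }) (by simp)
  refine ⟨!decide (t.head - t.head = 0), .seq (.op hB) ?_⟩
  rw [hi] at he
  simpa [Op.exec, isLeftEnd_inputCell] using he

/-- Apart from loop counters, only `inc` can push a register beyond the present maximum, and by one;
`cost` counts these increments. Loop counters stay below `x.length + 2`, whence `hM`, and the
scratch counter below a register already present. -/
theorem exec_low {x : List σ} (P : Prog σ τ F R) (hP : P.wf = true) (M : ℕ)
    (hM : x.length + 2 ≤ M) (s : Store τ F R) (t : RegStore τ (F × Bool) (LReg R))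
    (hr : Rep x M s t) :
    ∃ t', Exec x (M + P.cost x.length) P.low t t' ∧
      Rep x (M + P.cost x.length) (P.eval x s) t' := by
  induction P generalizing M s t with
  | upd φ =>
    refine ⟨_, .op ?_, ⟨?_, hr.user, hr.len, hr.out, hr.head, ?_⟩⟩
    · exact fun r => hr.bounded r
    · simp [Op.exec, eval, hr.ctl]
    · exact fun r => hr.bounded r
  | emit a =>
    refine ⟨_, .op ?_, ⟨hr.ctl, hr.user, hr.len, ?_, hr.head, ?_⟩⟩
    · exact fun r => hr.bounded r
    · simp [Op.exec, eval, hr.out]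
    · exact fun r => hr.bounded r
  | emitN r a =>
    obtain ⟨t', he, hI⟩ := exec_lowFor (x := x) (B := M) (t := t) .scratch (.user r) (.op (.emit a))
      (fun i t' => t'.reg .scratch = i ∧
        Rep x M { s with out := s.out ++ List.replicate i a } t') (s.reg r)
      (fun i t b h => ⟨h.1, ⟨h.2.ctl, h.2.user, h.2.len, h.2.out, h.2.head, h.2.bounded⟩⟩)
      (fun i t h => ⟨h.1, h.2.user r, h.2.bounded⟩)
      (by
        rintro i hi t ⟨h1, h2⟩
        refine ⟨_, .op h2.bounded, h1, h2.user r, by simp, ?_⟩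
        refine ⟨h2.ctl, fun q => by simpa [Op.exec] using h2.user q,
          fun q => by simpa [Op.exec] using h2.len q, ?_, h2.head, fun q => ?_⟩
        · simp [Op.exec, h2.out, List.replicate_succ']
        · have := h2.bounded q
          have := hr.le r
          simp only [Op.exec, Function.update_apply]
          split <;> omega)
      (by
        refine ⟨by simp, hr.ctl, fun q => by simpa using hr.user q, fun q => by simpa using hr.len q,
          by simpa using hr.out, hr.head, fun q => ?_⟩
        have := hr.bounded q
        simp only [Function.update_apply]
        split <;> omega)
    exact ⟨t', he, hI.2⟩
  | inc r =>
    have hb : ((Op.arith (.inc (.user r)) fun f _ => f : Op σ τ (F × Bool) (LReg R)).exec x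
        t).Bounded (M + 1) := by
      intro q
      have := hr.bounded q
      have := hr.bounded (.user r)
      simp only [Op.exec, Arith.apply, Function.update_apply]
      split <;> omega
    refine ⟨_, .op hb, hr.ctl, fun q => ?_, fun q => ?_, hr.out, hr.head, hb⟩
    · simp [Op.exec, Arith.apply, eval, Store.inc, Function.update_apply, hr.user]
    · simp [Op.exec, Arith.apply, hr.len]
  | copy r r' =>
    have hb : ((Op.arith (.copy (.user r) (.user r')) fun f _ => f :
        Op σ τ (F × Bool) (LReg R)).exec x t).Bounded M := by
      intro q
      have := hr.bounded q
      have := hr.bounded (.user r')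
      simp only [Op.exec, Arith.apply, Function.update_apply]
      split <;> omega
    refine ⟨_, .op hb, hr.ctl, fun q => ?_, fun q => ?_, hr.out, hr.head, hb⟩
    · simp [Op.exec, Arith.apply, eval, Function.update_apply, hr.user]
    · simp [Op.exec, Arith.apply, hr.len]
  | clear r =>
    have hb : ((Op.arith (.clear (.user r)) fun f _ => f :
        Op σ τ (F × Bool) (LReg R)).exec x t).Bounded M := by
      intro q
      have := hr.bounded q
      simp only [Op.exec, Arith.apply, Function.update_apply]
      split <;> omega
    refine ⟨_, .op hb, hr.ctl, fun q => ?_, fun q => ?_, hr.out, hr.head, hb⟩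
    · simp [Op.exec, Arith.apply, eval, Function.update_apply, hr.user]
    · simp [Op.exec, Arith.apply, hr.len]
  | len r =>
    have hb : ((Op.arith (.copy (.user r) (.len 0)) fun f _ => f :
        Op σ τ (F × Bool) (LReg R)).exec x t).Bounded M := by
      intro q
      have := hr.bounded q
      have := hr.bounded (.len 0)
      simp only [Op.exec, Arith.apply, Function.update_apply]
      split <;> omega
    refine ⟨_, .op hb, hr.ctl, fun q => ?_, fun q => ?_, hr.out, hr.head, hb⟩
    · simp [Op.exec, Arith.apply, eval, Function.update_apply, hr.user, hr.len]
    · simp [Op.exec, Arith.apply, hr.len]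
  | read r φ =>
    obtain ⟨b, he⟩ := exec_lowRewind t hr.head hr.bounded
    obtain ⟨t', he', hI⟩ := exec_lowFor (x := x) (B := M)
      (t := { t with head := 0, ctl := (t.ctl.1, b) }) .scratch (.user r) (.op (.move .right))
      (fun i t' => t'.reg .scratch = i ∧ t'.head = min i (x.length + 1) ∧ Rep x M s t')
      (s.reg r)
      (fun i t b h => ⟨h.1, h.2.1,
        ⟨h.2.2.ctl, h.2.2.user, h.2.2.len, h.2.2.out, h.2.2.head, h.2.2.bounded⟩⟩)
      (fun i t h => ⟨h.1, h.2.2.user r, h.2.2.bounded⟩)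
      (by
        rintro i hi t ⟨h1, h1', h2⟩
        refine ⟨_, .op h2.bounded, h1, h2.user r, by simp, ?_, ?_⟩
        · simp only [Op.exec, Move.apply, h1']
          omega
        refine ⟨h2.ctl, fun q => by simpa [Op.exec] using h2.user q,
          fun q => by simpa [Op.exec] using h2.len q, h2.out, by simp [Op.exec], fun q => ?_⟩
        have := h2.bounded q
        have := hr.le r
        simp only [Op.exec, Function.update_apply]
        split <;> omega)
      (by
        refine ⟨by simp, by simp, hr.ctl, fun q => by simpa using hr.user q,
          fun q => by simpa using hr.len q, hr.out, Nat.zero_le _, fun q => ?_⟩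
        have := hr.bounded q
        simp only [Function.update_apply]
        split <;> omega)
    obtain ⟨-, hh, h2⟩ := hI
    refine ⟨_, .seq he (.seq he' (.seq (.op h2.bounded) (.op h2.bounded))), ?_, h2.user, h2.len,
      h2.out, by simp [Op.exec], h2.bounded⟩
    -- Letter `p` is in cell `p + 1`, hence the additional move; beyond the word the head stays on
    -- the right endmarker, which reads as `none`.
    have e : min (min (s.reg r) (x.length + 1) + 1) (x.length + 1) =
        min (s.reg r) x.length + 1 := by omega
    simp only [Op.exec, Move.apply, hh, e, letter?_inputCell, eval, h2.ctl]
    rcases le_total (s.reg r) x.length with h | h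
    · rw [min_eq_left h]
    · rw [min_eq_right h, List.getElem?_eq_none h, List.getElem?_eq_none le_rfl]
  | seq P Q ihP ihQ =>
    simp only [wf, Bool.and_eq_true] at hP
    obtain ⟨t', he, hr'⟩ := ihP hP.1 M hM s t hr
    obtain ⟨t'', he', hr''⟩ := ihQ hP.2 _ (by omega) _ _ hr'
    simp only [cost, ← add_assoc]
    exact ⟨t'', .seq (he.mono (by omega)) he', hr''⟩
  | ite φ P Q ihP ihQ =>
    simp only [wf, Bool.and_eq_true] at hP
    cases h : φ s.ctl
    · obtain ⟨t', he, hr'⟩ := ihQ hP.2 M hM s t hr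
      refine ⟨t', .ite_false (by rw [hr.ctl, h]) (he.mono (by simp only [cost]; omega)), ?_⟩
      simpa [eval, h] using hr'.mono (by simp only [cost]; omega)
    · obtain ⟨t', he, hr'⟩ := ihP hP.1 M hM s t hr
      refine ⟨t', .ite_true (by rw [hr.ctl, h]) (he.mono (by simp only [cost]; omega)), ?_⟩
      simpa [eval, h] using hr'.mono (by simp only [cost]; omega)
  | ifCmp ψ r r' P Q ihP ihQ =>
    simp only [wf, Bool.and_eq_true] at hP
    let t₁ : RegStore τ (F × Bool) (LReg R) :=
      { t with ctl := (t.ctl.1, ψ (compare (s.reg r) (s.reg r'))) }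
    have h1 : (Op.arith (.cmp (.user r) (.user r')) fun f o => (f.1, ψ o) :
        Op σ τ (F × Bool) (LReg R)).exec x t = t₁ := by
      simp [Op.exec, Arith.apply, Arith.result, hr.user, t₁]
    have hr₁ : Rep x M s t₁ := ⟨hr.ctl, hr.user, hr.len, hr.out, hr.head, hr.bounded⟩
    have h2 : Exec x (M + (ifCmp ψ r r' P Q).cost x.length)
        (.op (.arith (.cmp (.user r) (.user r')) fun f o => (f.1, ψ o))) t t₁ := by
      rw [← h1]
      exact .op (h1 ▸ fun q => (hr.bounded q).trans (by simp))
    cases h : ψ (compare (s.reg r) (s.reg r'))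
    · obtain ⟨t', he, hr'⟩ := ihQ hP.2 M hM s t₁ hr₁
      refine ⟨t', .seq h2 (.ite_false h (he.mono (by simp only [cost]; omega))), ?_⟩
      simpa [eval, h] using hr'.mono (by simp only [cost]; omega)
    · obtain ⟨t', he, hr'⟩ := ihP hP.1 M hM s t₁ hr₁
      refine ⟨t', .seq h2 (.ite_true h (he.mono (by simp only [cost]; omega))), ?_⟩
      simpa [eval, h] using hr'.mono (by simp only [cost]; omega)
  | forN b r P ih =>
    simp only [wf, Bool.and_eq_true, Bool.not_eq_true'] at hP
    have hb := b.isLt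
    obtain ⟨t', he, hI⟩ := exec_lowFor (x := x) (B := M + (x.length + b) * P.cost x.length) (t := t)
      (.user r) (.len b) P.low
      (fun i t' => i ≤ x.length + b ∧ t'.reg (.user r) = i ∧
        Rep x (M + i * P.cost x.length) ((fun s => (eval x P s).inc r)^[i]
          { s with reg := Function.update s.reg r 0 }) t') (x.length + b)
      (fun i t b h => ⟨h.1, h.2.1, ⟨h.2.2.ctl, h.2.2.user, h.2.2.len, h.2.2.out, h.2.2.head,
        h.2.2.bounded⟩⟩)
      (fun i t h => ⟨h.2.1, h.2.2.len b, (h.2.2.mono (by gcongr; exact h.1)).bounded⟩)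
      (by
        rintro i hi t ⟨-, h1, h2⟩
        obtain ⟨t', he, hr'⟩ := ih hP.2 _ (by omega) _ _ h2
        -- By well-formedness the body preserves the loop counter, so the loop over the machine
        -- register counts the same rounds as `eval`.
        have hri := eval_reg_of_not_writes x r P hP.1 ((fun s => (eval x P s).inc r)^[i]
          { s with reg := Function.update s.reg r 0 })
        rw [← h2.user r, h1] at hri
        have hc : M + i * P.cost x.length + P.cost x.length ≤
            M + (x.length + b) * P.cost x.length := by
          have := Nat.mul_le_mul_right (P.cost x.length) (Nat.succ_le_of_lt hi)
          rw [Nat.succ_mul] at this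
          omega
        refine ⟨t', he.mono hc, by rw [hr'.user, hri], hr'.len b, by omega, by simp, ?_⟩
        rw [Function.iterate_succ_apply', Nat.succ_mul, ← add_assoc]
        refine ⟨hr'.ctl, fun q => ?_, fun q => by simpa using hr'.len q, hr'.out, hr'.head,
          fun q => ?_⟩
        · generalize (fun s => (eval x P s).inc r)^[i]
            { s with reg := Function.update s.reg r 0 } = s' at *
          simp [Store.inc, Function.update_apply, hri, hr'.user]
        · have := hr'.bounded q
          simp only [Function.update_apply]
          split <;> omega)
      (by
        refine ⟨Nat.zero_le _, by simp, hr.ctl, fun q => ?_, fun q => by simpa using hr.len q,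
          hr.out, hr.head, fun q => ?_⟩
        · simp [Function.update_apply, hr.user]
        have := hr.bounded q
        simp only [Function.update_apply]
        split <;> omega)
    exact ⟨t', he, hI.2.2⟩

/-- Compute the length of the input. -/
def lowInit : Low σ τ (F × Bool) (LReg R) :=
  .seq (.op (.move .right)) (.seq (lowTest fun c => c.letter?.isSome)
    (.seq (.while Prod.snd (.seq (lowArith (.inc (.len 0))) (.seq (.op (.move .right))
      (lowTest fun c => c.letter?.isSome))))
    (.seq (lowArith (.copy (.len 1) (.len 0))) (.seq (lowArith (.inc (.len 1)))
    (.seq (lowArith (.copy (.len 2) (.len 1))) (lowArith (.inc (.len 2))))))))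

/-- The initial store of a loop program. -/
def _root_.Logspace.Store.init (f₀ : F) : Store τ F R := ⟨f₀, fun _ => 0, []⟩

theorem exec_lowInit (x : List σ) (f₀ : F) (b₀ : Bool) :
    ∃ t' : RegStore τ (F × Bool) (LReg R), Exec x (x.length + 2) lowInit
      (RegStore.init (f₀, b₀)) t' ∧ Rep x (x.length + 2) (Store.init f₀) t' := by
  -- After `i` letters the register `len 0` is `i` and the head is on cell `i + 1`; the flag tells
  -- whether a letter is there.
  let st (i : ℕ) : RegStore τ (F × Bool) (LReg R) :=
    ⟨(f₀, decide (i < x.length)), Function.update (fun _ => 0) (.len 0) i, i + 1, []⟩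
  have hst : ∀ i ≤ x.length, (st i).Bounded (x.length + 2) := by
    intro i hi q
    simp only [st, Function.update_apply]
    split <;> omega
  have hsome : ∀ i : ℕ, x[i]?.isSome = decide (i < x.length) := by
    intro i
    rw [Bool.eq_iff_iff]
    simp
  obtain ⟨t', he, hi⟩ := Low.exec_while_of (x := x) (B := x.length + 2) (φ := Prod.snd)
    (P := (.seq (lowArith (.inc (.len 0))) (.seq (.op (.move .right))
      (lowTest fun c => c.letter?.isSome))))
    (fun i t' => t' = st i) x.length
    (by
      rintro i hi t' rfl
      have hb : ∀ c h o, (⟨c, (st (i + 1)).reg, h, o⟩ :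
        RegStore τ (F × Bool) (LReg R)).Bounded (x.length + 2) := fun _ _ _ => hst (i + 1) (by omega)
      refine ⟨by simpa [st] using hi, _, .seq (.op ?_) (.seq (.op ?_) (.op ?_)), ?_⟩
      · simpa [Op.exec, Arith.apply, st] using hb _ _ _
      · simpa [Op.exec, Arith.apply, st] using hb _ _ _
      · simpa [Op.exec, Arith.apply, st] using hb _ _ _
      · have e : min (i + 1 + 1) (x.length + 1) = i + 1 + 1 := by omega
        simp [Op.exec, Arith.apply, st, Move.apply, e, letter?_inputCell, hsome])
    (by
      rintro t' rfl
      simp [st]) (t := st 0) rfl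
  subst hi
  have e3 : ∀ q : Fin 3, q = 0 ∨ q = 1 ∨ q = 2 := by decide
  refine ⟨_, .seq (.op ?_) (.seq (.op ?_) (.seq (s' := st x.length) ?_ (.seq (.op ?_) (.seq (.op ?_) (.seq (.op ?_)
    (.op ?_)))))), ?_⟩
  · exact fun q => Nat.zero_le _
  · exact fun q => Nat.zero_le _
  · convert he using 1
    simp only [Op.exec, RegStore.init, Move.apply, st]
    have e : min (0 + 1) (x.length + 1) = 0 + 1 := by omega
    rw [e, letter?_inputCell, hsome]
    simp
  iterate 4
    · intro q
      rcases q with q | q | _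
      · simp [Op.exec, Arith.apply, st]
      · rcases e3 q with rfl | rfl | rfl <;> simp [Op.exec, Arith.apply, st]
      · simp [Op.exec, Arith.apply, st]
  · refine ⟨rfl, fun q => ?_, fun q => ?_, rfl, ?_, fun q => ?_⟩
    · simp [Op.exec, Arith.apply, st, Store.init]
    · rcases e3 q with rfl | rfl | rfl <;> simp [Op.exec, Arith.apply, st]
    · simp [Op.exec, st]
    · rcases q with q | q | _
      · simp [Op.exec, Arith.apply, st]
      · rcases e3 q with rfl | rfl | rfl <;> simp [Op.exec, Arith.apply, st]
      · simp [Op.exec, Arith.apply, st]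

/-- Loop programs compute logspace functions. -/
theorem computable [Finite F] [Finite R] (P : Prog σ τ F R) (hP : P.wf = true) (f₀ : F) :
    Computable fun x => (P.eval x (Store.init f₀)).out := by
  have := LReg.finite R
  obtain ⟨K, hK⟩ := P.cost_le
  refine Low.computable (.seq lowInit P.low) (f₀, false) (K + 2) _ fun x => ?_
  obtain ⟨t, he, hr⟩ := exec_lowInit (τ := τ) (R := R) x f₀ false
  obtain ⟨t', he', hr'⟩ := exec_low P hP _ le_rfl _ _ hr
  -- The summand `x.length + 2` bounds the registers after initialization; two more factors absorb
  -- it.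
  have hle : x.length + 2 + P.cost x.length ≤ (x.length + 2) ^ (K + 2) := by
    have h1 := hK x.length
    have h2 : 1 ≤ (x.length + 2) ^ K := Nat.one_le_pow _ _ (by omega)
    rw [pow_add]
    generalize (x.length + 2) ^ K = a at *
    have h3 : x.length + 2 ≤ a * (x.length + 2) := Nat.le_mul_of_pos_left _ h2
    nlinarith
  exact ⟨t', .seq (he.mono (by omega)) (he'.mono hle), hr'.out⟩

end Prog

end Logspace

/-! ### Circuits: encodings, values of gates, copies, and a single sink -/

namespace Arith

open MvPolynomial

/-! ### Encodings -/

/-- One step of decoding a word from right to left. -/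
def decodeStep : Sym → ℕ × ℕ × List Gate → ℕ × ℕ × List Gate
  | .tick, (c, v, gs) => (c + 1, v, gs)
  | .sep, (c, _, gs) => (0, c, gs)
  | .negOne, (_, _, gs) => (0, 0, .negOne :: gs)
  | .var, (c, _, gs) => (0, 0, .var c :: gs)
  | .add, (c, v, gs) => (0, 0, .add c v :: gs)
  | .mul, (c, v, gs) => (0, 0, .mul c v :: gs)
  | _, s => s

theorem decode_ticks (k c v : ℕ) (gs : List Gate) :
    (List.replicate k Sym.tick).foldr decodeStep (c, v, gs) = (c + k, v, gs) := by
  induction k with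
  | zero => rfl
  | succ k ih => simp [List.replicate_succ, ih, decodeStep]; omega

/-- Read from the right, the kind of a gate comes after its numbers, so the gate can be completed at
once. The left inverse makes the encoding injective. -/
theorem decode_flatMap (gs : List Gate) :
    (gs.flatMap Gate.encode).foldr decodeStep (0, 0, []) = (0, 0, gs) := by
  induction gs with
  | nil => rfl
  | cons g gs ih =>
    rw [List.flatMap_cons, List.foldr_append, ih]
    cases g <;> simp [Gate.encode, decode_ticks, decodeStep]

theorem encode_injective {gs gs' : List Gate}
    (h : gs.flatMap Gate.encode = gs'.flatMap Gate.encode) : gs = gs' := by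
  have := decode_flatMap gs
  rw [h, decode_flatMap gs'] at this
  simpa using this.symm

/-! ### Values of gates -/

/-- The polynomial computed by the gate number `k`. -/
noncomputable def val (G : List Gate) (k : ℕ) : MvPolynomial ℕ ℤ := (gatePolys G).getD k 0

/-- The polynomial computed by a gate in terms of a sequence of polynomials. -/
noncomputable def Gate.value (v : ℕ → MvPolynomial ℕ ℤ) : Gate → MvPolynomial ℕ ℤ
  | negOne => -1
  | var i => X i
  | add a b => v a + v b
  | mul a b => v a * v b

theorem gatePolys_snoc (G : List Gate) (g : Gate) :
    gatePolys (G ++ [g]) = gatePolys G ++ [g.poly (gatePolys G)] := by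
  simp [gatePolys]

@[simp]
theorem length_gatePolys (G : List Gate) : (gatePolys G).length = G.length := by
  induction G using List.reverseRecOn with
  | nil => rfl
  | append_singleton G g ih => simp [gatePolys_snoc, ih]

theorem val_snoc_of_lt (G : List Gate) (g : Gate) {k : ℕ} (hk : k < G.length) :
    val (G ++ [g]) k = val G k := by
  simp only [val, gatePolys_snoc, List.getD_eq_getElem?_getD]
  rw [List.getElem?_append_left (by simpa using hk)]

theorem val_append (G H : List Gate) {k : ℕ} (hk : k < G.length) :
    val (G ++ H) k = val G k := by
  induction H using List.reverseRecOn with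
  | nil => simp
  | append_singleton H g ih =>
    rw [← List.append_assoc, val_snoc_of_lt _ _ (by simp; omega), ih]

theorem val_prefix {G G' : List Gate} (h : G <+: G') {k : ℕ} (hk : k < G.length) :
    val G' k = val G k := by
  obtain ⟨H, rfl⟩ := h
  exact val_append G H hk

theorem val_snoc (G : List Gate) (g : Gate) :
    val (G ++ [g]) G.length = g.value (val G) := by
  simp only [val, gatePolys_snoc, List.getD_eq_getElem?_getD]
  rw [List.getElem?_append_right (by simp)]
  cases g <;> simp [Gate.poly, Gate.value, val]

/-- Every gate comes after its children. -/
def Acyclic (G : List Gate) : Prop :=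
  ∀ (i : ℕ) (g : Gate), G[i]? = some g → ∀ u ∈ g.children, u < i

theorem Acyclic.nil : Acyclic [] := by
  intro i g h
  simp at h

theorem acyclic_snoc {G : List Gate} {g : Gate} :
    Acyclic (G ++ [g]) ↔ Acyclic G ∧ ∀ u ∈ g.children, u < G.length := by
  constructor
  · intro h
    refine ⟨fun i g' hi => h i g' ?_, h G.length g (by simp)⟩
    rw [List.getElem?_append_left (List.getElem?_eq_some_iff.1 hi).1, hi]
  · rintro ⟨h, hg⟩ i g' hi
    rcases lt_trichotomy i G.length with hl | rfl | hl
    · rw [List.getElem?_append_left hl] at hi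
      exact h i g' hi
    · obtain rfl : g = g' := by simpa using hi
      exact hg
    · rw [List.getElem?_eq_none (by simp; omega)] at hi
      simp at hi

theorem Acyclic.snoc {G : List Gate} (h : Acyclic G) {g : Gate}
    (hg : ∀ u ∈ g.children, u < G.length) : Acyclic (G ++ [g]) :=
  acyclic_snoc.2 ⟨h, hg⟩

/-- Induction along the topological order. `P` may depend on the number of the gate, which serves
for bounds that grow from gate to gate. -/
theorem val_induction {gs : List Gate} (hgs : Acyclic gs) {P : ℕ → MvPolynomial ℕ ℤ → Prop}
    (negOne : ∀ k, P k (-1)) (var : ∀ k j, Gate.var j ∈ gs → P k (X j))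
    (add : ∀ k u v p q, u < k → v < k → P u p → P v q → P k (p + q))
    (mul : ∀ k u v p q, u < k → v < k → P u p → P v q → P k (p * q)) :
    ∀ k < gs.length, P k (val gs k) := by
  induction gs using List.reverseRecOn with
  | nil => simp
  | append_singleton gs g ih =>
    rw [acyclic_snoc] at hgs
    have ih := ih hgs.1 fun k j hj => var k j (by simp [hj])
    intro k hk
    rcases Nat.lt_or_ge k gs.length with hk' | hk'
    · rw [val_snoc_of_lt _ _ hk']
      exact ih k hk'
    · obtain rfl : k = gs.length := by simp at hk; omega
      rw [val_snoc]
      have hg := hgs.2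
      cases g with
      | negOne => exact negOne _
      | var j => exact var _ j (by simp)
      | add u v =>
        simp only [Gate.children, List.mem_cons, List.not_mem_nil, or_false, forall_eq_or_imp,
          forall_eq] at hg
        exact add _ u v _ _ hg.1 hg.2 (ih u hg.1) (ih v hg.2)
      | mul u v =>
        simp only [Gate.children, List.mem_cons, List.not_mem_nil, or_false, forall_eq_or_imp,
          forall_eq] at hg
        exact mul _ u v _ _ hg.1 hg.2 (ih u hg.1) (ih v hg.2)

/-! ### Copies of a circuit -/

/-- A gate in a copy of a circuit: children are shifted by `sh`, the variable `j` is replaced by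
the gate number `vb + j * vs`. -/
def copyGate (vb vs sh : ℕ) : Gate → Gate
  | .negOne => .negOne
  | .var j => .mul 1 (vb + j * vs)
  | .add u v => .add (sh + u) (sh + v)
  | .mul u v => .mul (sh + u) (sh + v)

/-- A variable becomes the product of gate `1`, of value `1`, and its substitute. Thus every gate is
copied to exactly one gate and all children shift by the same amount. The values agree because
substitution is a ring homomorphism. -/
theorem copy_spec {G gs : List Gate} (hG : Acyclic G) (h1 : 1 < G.length) (hv1 : val G 1 = 1)
    (hgs : Acyclic gs) (vb vs : ℕ) (φ : ℕ → MvPolynomial ℕ ℤ)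
    (hφ : ∀ j, Gate.var j ∈ gs → vb + j * vs < G.length ∧ val G (vb + j * vs) = φ j) :
    Acyclic (G ++ gs.map (copyGate vb vs G.length)) ∧
      ∀ k < gs.length, val (G ++ gs.map (copyGate vb vs G.length)) (G.length + k) =
        aeval φ (val gs k) := by
  induction gs using List.reverseRecOn with
  | nil => exact ⟨by simpa using hG, by simp⟩
  | append_singleton gs g ih =>
    rw [acyclic_snoc] at hgs
    obtain ⟨iha, ihv⟩ := ih hgs.1 fun j hj => hφ j (by simp [hj])
    set H := G ++ gs.map (copyGate vb vs G.length) with hH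
    have hlen : H.length = G.length + gs.length := by simp [hH]
    have heq : G ++ (gs ++ [g]).map (copyGate vb vs G.length) =
        H ++ [copyGate vb vs G.length g] := by simp [hH]
    rw [heq]
    have hvar : ∀ j, g = .var j → vb + j * vs < G.length ∧ val G (vb + j * vs) = φ j :=
      fun j hj => hφ j (by simp [hj])
    refine ⟨iha.snoc ?_, fun k hk => ?_⟩
    · rw [hlen]
      cases g with
      | negOne => simp [copyGate, Gate.children]
      | var j =>
        have := (hvar j rfl).1
        simp only [copyGate, Gate.children, List.mem_cons, List.not_mem_nil, or_false]
        omega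
      | add u v =>
        have := hgs.2
        simp only [Gate.children, List.mem_cons, List.not_mem_nil, or_false, forall_eq_or_imp,
          forall_eq, copyGate] at this ⊢
        omega
      | mul u v =>
        have := hgs.2
        simp only [Gate.children, List.mem_cons, List.not_mem_nil, or_false, forall_eq_or_imp,
          forall_eq, copyGate] at this ⊢
        omega
    · rcases Nat.lt_or_ge k gs.length with hk' | hk'
      · rw [val_snoc_of_lt _ _ (by omega), val_snoc_of_lt _ _ hk', ihv k hk']
      · obtain rfl : k = gs.length := by simp at hk; omega
        rw [← hlen, val_snoc, val_snoc]
        have hpre : ∀ i < G.length, val H i = val G i := fun i hi => val_append _ _ hi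
        cases g with
        | negOne => simp [copyGate, Gate.value]
        | var j =>
          simp only [copyGate, Gate.value, aeval_X]
          rw [hpre _ h1, hpre _ (hvar j rfl).1, hv1, (hvar j rfl).2, one_mul]
        | add u v =>
          have := hgs.2
          simp only [Gate.children, List.mem_cons, List.not_mem_nil, or_false, forall_eq_or_imp,
            forall_eq] at this
          simp only [copyGate, Gate.value, map_add]
          rw [ihv _ this.1, ihv _ this.2]
        | mul u v =>
          have := hgs.2
          simp only [Gate.children, List.mem_cons, List.not_mem_nil, or_false, forall_eq_or_imp,
            forall_eq] at this
          simp only [copyGate, Gate.value, map_mul]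
          rw [ihv _ this.1, ihv _ this.2]

/-! ### Making the output gate the only sink -/

/-- Append `t` gates with the value `0` (if the value of the gate `2` is `0`) that use the gates
`0, …, t - 1`. The second component is the number of the last of these gates. -/
def absorb (G : List Gate) : ℕ → List Gate × ℕ
  | 0 => (G, 2)
  | t + 1 => ((absorb G t).1 ++ [.mul (absorb G t).2 t], (absorb G t).1.length)

/-- Make a circuit with the output gate `acc` out of a list of gates. -/
def finish (G : List Gate) (acc : ℕ) : List Gate :=
  (absorb G G.length).1 ++ [.add acc (absorb G G.length).2]

theorem absorb_length (G : List Gate) (t : ℕ) : (absorb G t).1.length = G.length + t := by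
  induction t with
  | zero => rfl
  | succ t ih =>
    simp only [absorb, List.length_append, ih, List.length_cons, List.length_nil]
    omega

theorem prefix_absorb (G : List Gate) (t : ℕ) : G <+: (absorb G t).1 := by
  induction t with
  | zero => exact List.prefix_rfl
  | succ t ih => exact ih.trans (List.prefix_append _ _)

/-- Each new gate multiplies the preceding one, starting from the zero gate `2`, by one old gate. So
all new values are `0`, the old gates are used as second factors, and each new gate is used by its
successor. -/
theorem absorb_spec {G : List Gate} (hG : Acyclic G) (h3 : 2 < G.length) (h2 : val G 2 = 0)
    (t : ℕ) (ht : t ≤ G.length) :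
    Acyclic (absorb G t).1 ∧ (absorb G t).2 < (absorb G t).1.length ∧
      val (absorb G t).1 (absorb G t).2 = 0 ∧
      (∀ i < t, ∃ g ∈ (absorb G t).1, i ∈ g.children) ∧
      (0 < t → (absorb G t).2 = G.length + t - 1) ∧
      ∀ i, G.length ≤ i → i + 1 < G.length + t → ∃ g ∈ (absorb G t).1, i ∈ g.children := by
  induction t with
  | zero => exact ⟨hG, h3, h2, by simp, by simp, by simp; omega⟩
  | succ t ih =>
    obtain ⟨ha, hl, hv, hu, hlast, hu'⟩ := ih (by omega)
    have hlen := absorb_length G t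
    simp only [absorb]
    refine ⟨ha.snoc ?_, by simp, ?_, fun i hi => ?_, fun _ => by omega, fun i hi hi' => ?_⟩
    · simp only [Gate.children, List.mem_cons, List.not_mem_nil, or_false]
      omega
    · rw [val_snoc]
      simp [Gate.value, hv]
    · rcases Nat.lt_succ_iff_lt_or_eq.1 hi with hi | rfl
      · obtain ⟨g, hg, h⟩ := hu i hi
        exact ⟨g, by simp [hg], h⟩
      · exact ⟨.mul (absorb G i).2 i, by simp, by simp [Gate.children]⟩
    · rcases Nat.lt_or_ge (i + 1) (G.length + t) with h | h
      · obtain ⟨g, hg, h⟩ := hu' i hi h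
        exact ⟨g, by simp [hg], h⟩
      · refine ⟨.mul (absorb G t).2 t, by simp, ?_⟩
        rw [hlast (by omega)]
        simp [Gate.children]
        omega

/-- The circuit with the output gate `acc` made out of a list of gates. -/
theorem exists_circuit_finish {G : List Gate} (hG : Acyclic G) (h3 : 2 < G.length)
    (h2 : val G 2 = 0) (acc : ℕ) (hacc : acc < G.length) :
    ∃ C : Circuit, C.gates = finish G acc ∧ C.poly = val G acc := by
  obtain ⟨ha, hl, hv, hu, hlast, hu'⟩ := absorb_spec hG h3 h2 G.length le_rfl
  have hlen := absorb_length G G.length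
  have hlast := hlast (by omega)
  refine ⟨⟨finish G acc, by simp [finish], ?_, ?_⟩, rfl, ?_⟩
  · refine ha.snoc ?_
    simp only [Gate.children, List.mem_cons, List.not_mem_nil, or_false]
    omega
  · intro i hi
    simp only [finish, List.length_append, hlen, List.length_cons, List.length_nil] at hi
    rcases Nat.lt_or_ge i G.length with h | h
    · obtain ⟨g, hg, h⟩ := hu i h
      exact ⟨g, by simp [finish, hg], h⟩
    · rcases Nat.lt_or_ge (i + 1) (G.length + G.length) with h' | h'
      · obtain ⟨g, hg, h⟩ := hu' i h h'
        exact ⟨g, by simp [finish, hg], h⟩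
      · refine ⟨.add acc (absorb G G.length).2, by simp [finish], ?_⟩
        rw [hlast]
        simp [Gate.children]
        omega
  · change val (finish G acc) ((finish G acc).length - 1) = _
    have e : (finish G acc).length - 1 = (absorb G G.length).1.length := by simp [finish]
    -- The output gate adds the zero at the end of the chain to `acc`.
    rw [e, finish, val_snoc, Gate.value, hv, add_zero, val_prefix (prefix_absorb G _) hacc]

end Arith

/-! ### Kronecker substitution and finite differences -/

namespace Arith

open MvPolynomial

/-! ### Nonzero values at large powers of two -/

/-- A multiplication at most doubles the bound valid for all earlier gates. -/
theorem degreeOf_val_le {gs : List Gate} (hgs : Acyclic gs) (i : ℕ) :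
    ∀ k < gs.length, (val gs k).degreeOf i ≤ 2 ^ k := by
  refine val_induction hgs (P := fun k p => p.degreeOf i ≤ 2 ^ k) ?_ ?_ ?_ ?_
  · intro k
    simp [degreeOf_neg]
  · intro k j _
    rw [degreeOf_X]
    split
    · exact Nat.one_le_two_pow
    · exact Nat.zero_le _
  · intro k u v p q hu hv hp hq
    refine (degreeOf_add_le i p q).trans (max_le (hp.trans ?_) (hq.trans ?_))
    · exact Nat.pow_le_pow_right (by norm_num) hu.le
    · exact Nat.pow_le_pow_right (by norm_num) hv.le
  · intro k u v p q hu hv hp hq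
    refine (degreeOf_mul_le i p q).trans ?_
    obtain ⟨k, rfl⟩ : ∃ l, k = l + 1 := ⟨k - 1, by omega⟩
    have h1 : 2 ^ u ≤ 2 ^ k := Nat.pow_le_pow_right (by norm_num) (by omega)
    have h2 : 2 ^ v ≤ 2 ^ k := Nat.pow_le_pow_right (by norm_num) (by omega)
    rw [pow_succ]
    omega

theorem degreeOf_val_eq_zero {gs : List Gate} (hgs : Acyclic gs) (i : ℕ)
    (hi : Gate.var i ∉ gs) : ∀ k < gs.length, (val gs k).degreeOf i = 0 := by
  refine val_induction hgs (P := fun k p => p.degreeOf i = 0) ?_ ?_ ?_ ?_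
  · intro k
    simp [degreeOf_neg]
  · intro k j hj
    rw [degreeOf_X, if_neg]
    rintro rfl
    exact hi hj
  · intro k u v p q _ _ hp hq
    have := degreeOf_add_le i p q
    omega
  · intro k u v p q _ _ hp hq
    have := degreeOf_mul_le i p q
    omega

/-- The absolute values of the coefficients of `p` are bounded by the coefficients of a polynomial
with coefficient sum at most `B`. -/
def CoeffBounded (B : ℤ) (p : MvPolynomial ℕ ℤ) : Prop :=
  ∃ P : MvPolynomial ℕ ℤ, (∀ m, |p.coeff m| ≤ P.coeff m) ∧ eval (fun _ => 1) P ≤ B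

/-- The majorant has nonnegative coefficients, so each of them is at most their sum, which is its
value at `1`. -/
theorem CoeffBounded.abs_coeff_le {B : ℤ} {p : MvPolynomial ℕ ℤ} (h : CoeffBounded B p)
    (m : ℕ →₀ ℕ) : |p.coeff m| ≤ B := by
  obtain ⟨P, hP, hB⟩ := h
  refine (hP m).trans (le_trans ?_ hB)
  have hnn : ∀ m, 0 ≤ P.coeff m := fun m => (abs_nonneg _).trans (hP m)
  rw [eval_eq]
  simp only [one_pow, Finset.prod_const_one, mul_one]
  by_cases hm : m ∈ P.support
  · exact Finset.single_le_sum (fun m _ => hnn m) hm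
  · rw [notMem_support_iff.1 hm]
    exact Finset.sum_nonneg fun m _ => hnn m

theorem CoeffBounded.mono {B B' : ℤ} {p : MvPolynomial ℕ ℤ} (h : CoeffBounded B p)
    (hB : B ≤ B') : CoeffBounded B' p := by
  obtain ⟨P, hP, hP'⟩ := h
  exact ⟨P, hP, hP'.trans hB⟩

theorem CoeffBounded.add {B B' : ℤ} {p q : MvPolynomial ℕ ℤ} (hp : CoeffBounded B p)
    (hq : CoeffBounded B' q) : CoeffBounded (B + B') (p + q) := by
  obtain ⟨P, hP, hP'⟩ := hp
  obtain ⟨Q, hQ, hQ'⟩ := hq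
  refine ⟨P + Q, fun m => ?_, ?_⟩
  · rw [coeff_add, coeff_add]
    exact (abs_add_le _ _).trans (add_le_add (hP m) (hQ m))
  · rw [map_add]
    exact add_le_add hP' hQ'

/-- Here majorants pay off: coefficient sums are multiplicative, evaluation at `1` being a ring
homomorphism, whereas maximal coefficients are not. -/
theorem CoeffBounded.mul {B B' : ℤ} {p q : MvPolynomial ℕ ℤ} (hp : CoeffBounded B p)
    (hq : CoeffBounded B' q) (hB : 0 ≤ B) : CoeffBounded (B * B') (p * q) := by
  obtain ⟨P, hP, hP'⟩ := hp
  obtain ⟨Q, hQ, hQ'⟩ := hq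
  refine ⟨P * Q, fun m => ?_, ?_⟩
  · rw [coeff_mul, coeff_mul]
    refine (Finset.abs_sum_le_sum_abs _ _).trans (Finset.sum_le_sum fun a _ => ?_)
    rw [abs_mul]
    exact mul_le_mul (hP _) (hQ _) (abs_nonneg _) ((abs_nonneg _).trans (hP _))
  · rw [map_mul]
    refine mul_le_mul hP' hQ' ?_ hB
    rw [eval_eq]
    refine Finset.sum_nonneg fun m _ => ?_
    simp only [one_pow, Finset.prod_const_one, mul_one]
    exact (abs_nonneg _).trans (hQ m)

theorem coeffBounded_val {gs : List Gate} (hgs : Acyclic gs) :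
    ∀ k < gs.length, CoeffBounded (2 ^ 2 ^ k) (val gs k) := by
  have hpow : ∀ a b : ℕ, a ≤ b → (2 : ℤ) ^ 2 ^ a ≤ 2 ^ 2 ^ b := fun a b h =>
    pow_le_pow_right₀ (by norm_num) (Nat.pow_le_pow_right (by norm_num) h)
  refine val_induction hgs (P := fun k p => CoeffBounded (2 ^ 2 ^ k) p) ?_ ?_ ?_ ?_
  · intro k
    refine ⟨1, fun m => ?_, ?_⟩
    · rw [coeff_neg, abs_neg, coeff_one]
      split <;> simp
    · rw [map_one]
      exact one_le_pow₀ (by norm_num)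
  · intro k j _
    refine ⟨X j, fun m => ?_, ?_⟩
    · rw [coeff_X]
      split <;> simp
    · rw [eval_X]
      exact one_le_pow₀ (by norm_num)
  · intro k u v p q hu hv hp hq
    refine (hp.add hq).mono ?_
    obtain ⟨k, rfl⟩ : ∃ l, k = l + 1 := ⟨k - 1, by omega⟩
    have h1 := hpow u k (by omega)
    have h2 := hpow v k (by omega)
    -- For `a = 2 ^ 2 ^ k ≥ 2` one has `a + a ≤ a * a`, so a sum obeys the bound for products.
    have h3 : (2 : ℤ) ≤ 2 ^ 2 ^ k := by
      have := hpow 0 k (by omega)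
      simpa using this
    rw [pow_succ 2 k, pow_mul]
    nlinarith
  · intro k u v p q hu hv hp hq
    refine (hp.mul hq (by positivity)).mono ?_
    obtain ⟨k, rfl⟩ : ∃ l, k = l + 1 := ⟨k - 1, by omega⟩
    rw [pow_succ 2 k, pow_mul, sq]
    exact mul_le_mul (hpow u k (by omega)) (hpow v k (by omega)) (by positivity) (by positivity)

/-- The number with the digits `m 0, m 1, …` in base `b`. -/
def weight (b : ℕ) (m : ℕ →₀ ℕ) : ℕ := m.sum fun j e => e * b ^ j

theorem ofDigits_range (b : ℕ) (m : ℕ → ℕ) (N : ℕ) :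
    Nat.ofDigits b ((List.range N).map m) = ∑ j ∈ Finset.range N, m j * b ^ j := by
  induction N with
  | zero => rfl
  | succ N ih =>
    rw [List.range_succ, List.map_append, Nat.ofDigits_append, ih, Finset.sum_range_succ]
    simp [mul_comm]

theorem weight_injective {b : ℕ} (hb : 1 < b) {m m' : ℕ →₀ ℕ} (hm : ∀ j, m j < b)
    (hm' : ∀ j, m' j < b) (h : weight b m = weight b m') : m = m' := by
  -- Both exponent vectors are cut to a common length, so that uniqueness of digit expansions of
  -- equal length applies.
  obtain ⟨N, hN⟩ : ∃ N, ∀ j ∈ m.support ∪ m'.support, j < N := by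
    obtain ⟨N, hN⟩ := (m.support ∪ m'.support).bddAbove
    exact ⟨N + 1, fun j hj => Nat.lt_succ_of_le (hN hj)⟩
  have hw : ∀ q : ℕ →₀ ℕ, q.support ⊆ m.support ∪ m'.support →
      weight b q = Nat.ofDigits b ((List.range N).map q) := by
    intro q hq
    rw [ofDigits_range, weight, Finsupp.sum_of_support_subset]
    · intro j hj
      exact Finset.mem_range.2 (hN j (hq hj))
    · simp
  rw [hw m Finset.subset_union_left, hw m' Finset.subset_union_right] at h
  have := Nat.ofDigits_inj_of_len_eq hb (by simp) (by simpa using fun j _ => hm j)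
    (by simpa using fun j _ => hm' j) h
  ext j
  by_cases hj : j < N
  · exact List.map_inj_left.1 this j (List.mem_range.2 hj)
  · have h1 : j ∉ m.support := fun h => hj (hN j (Finset.mem_union_left _ h))
    have h2 : j ∉ m'.support := fun h => hj (hN j (Finset.mem_union_right _ h))
    rw [Finsupp.notMem_support_iff.1 h1, Finsupp.notMem_support_iff.1 h2]

/-- Let `m₀` be the monomial of least weight. All other terms are divisible by `2 ^ (2 ^ t * (weight
m₀ + 1))`. If the sum were `0`, so would be the term of `m₀`, and `2 ^ 2 ^ t` would divide a nonzero
coefficient smaller than itself. -/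
theorem eval_ne_zero (t : ℕ) (ht : 0 < t) {p : MvPolynomial ℕ ℤ} (hp : p ≠ 0)
    (hdeg : ∀ i, p.degreeOf i < 2 ^ t) (hcoeff : ∀ m, |p.coeff m| < 2 ^ 2 ^ t) :
    eval (fun j => (2 : ℤ) ^ 2 ^ ((j + 1) * t)) p ≠ 0 := by
  have hdigit : ∀ m ∈ p.support, ∀ j, m j < 2 ^ t := fun m hm j =>
    (monomial_le_degreeOf j hm).trans_lt (hdeg j)
  have heval : eval (fun j => (2 : ℤ) ^ 2 ^ ((j + 1) * t)) p =
      ∑ m ∈ p.support, p.coeff m * 2 ^ (2 ^ t * weight (2 ^ t) m) := by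
    rw [eval_eq]
    refine Finset.sum_congr rfl fun m _ => ?_
    congr 1
    rw [weight, Finsupp.sum, Finset.mul_sum, ← Finset.prod_pow_eq_pow_sum]
    refine Finset.prod_congr rfl fun j _ => ?_
    rw [← pow_mul, ← pow_mul]
    congr 1
    ring
  obtain ⟨m₀, hm₀, hmin⟩ := p.support.exists_min_image (weight (2 ^ t)) (support_nonempty.2 hp)
  intro h
  rw [heval, ← Finset.add_sum_erase _ _ hm₀] at h
  have hdvd : (2 : ℤ) ^ (2 ^ t * (weight (2 ^ t) m₀ + 1)) ∣
      ∑ m ∈ p.support.erase m₀, p.coeff m * 2 ^ (2 ^ t * weight (2 ^ t) m) := by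
    refine Finset.dvd_sum fun m hm => Dvd.dvd.mul_left (pow_dvd_pow _ ?_) _
    have hne := (Finset.mem_erase.1 hm).1
    have hm := (Finset.mem_erase.1 hm).2
    refine Nat.mul_le_mul_left _ (lt_of_le_of_ne (hmin m hm) fun he => hne ?_)
    exact (weight_injective (Nat.one_lt_two_pow ht.ne') (hdigit _ hm₀) (hdigit _ hm) he).symm
  have h2 : (2 : ℤ) ^ (2 ^ t * (weight (2 ^ t) m₀ + 1)) ∣
      p.coeff m₀ * 2 ^ (2 ^ t * weight (2 ^ t) m₀) := by
    rw [eq_neg_of_add_eq_zero_left h]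
    exact hdvd.neg_right
  rw [mul_add, mul_one, pow_add, mul_comm] at h2
  have h3 := Int.dvd_of_mul_dvd_mul_right (by positivity) h2
  exact (mem_support_iff.1 hm₀) (Int.eq_zero_of_abs_lt_dvd h3 (hcoeff m₀))

/-! ### Finite differences -/

/-- The alternating sum of the `k`-th powers of `0, …, d` with binomial coefficients. -/
def altSum (d k : ℕ) : ℤ := ∑ i ∈ Finset.range (d + 1), (-1) ^ i * (d.choose i : ℤ) * (i : ℤ) ^ k

/-- Up to sign this is the `d`-th forward difference of `x ^ k` at `0`, which vanishes for `k < d`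
and equals `d!` for `k = d`. -/
theorem altSum_eq (d k : ℕ) :
    altSum d k = (-1) ^ d * ((fwdDiff (1 : ℤ))^[d] (fun x : ℤ => x ^ k)) 0 := by
  rw [fwdDiff_iter_eq_sum_shift, Finset.mul_sum, altSum]
  refine Finset.sum_congr rfl fun i hi => ?_
  have hi : i ≤ d := by simpa [Nat.lt_succ_iff] using hi
  simp only [zero_add, nsmul_eq_mul, mul_one, smul_eq_mul]
  have : (-1 : ℤ) ^ d * (-1) ^ (d - i) = (-1) ^ i := by
    obtain ⟨l, rfl⟩ := Nat.exists_eq_add_of_le hi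
    rw [Nat.add_sub_cancel_left, pow_add, mul_assoc, ← mul_pow]
    simp
  rw [← this]
  ring

theorem altSum_of_lt {d k : ℕ} (h : k < d) : altSum d k = 0 := by
  rw [altSum_eq, fwdDiff_iter_pow_eq_zero_of_lt h]
  simp

theorem altSum_self_ne_zero (d : ℕ) : altSum d d ≠ 0 := by
  rw [altSum_eq, fwdDiff_iter_eq_factorial]
  simp [Nat.factorial_ne_zero]

/-- The sum equals `2 ^ k - 2`. -/
theorem altSum_two_ne_zero {k : ℕ} (hk : 2 ≤ k) : altSum 2 k ≠ 0 := by
  obtain ⟨l, rfl⟩ := Nat.exists_eq_add_of_le hk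
  have : (1 : ℤ) ≤ 2 ^ l := one_le_pow₀ (by norm_num)
  simp only [altSum, Finset.sum_range_succ, Finset.sum_range_zero]
  simp [pow_add]
  omega

/-- The alternating sum of the polynomials obtained from `p` by scaling the variables. -/
noncomputable def scaledSum (d : ℕ) (c : ℕ → ℕ → ℤ) (p : MvPolynomial ℕ ℤ) : MvPolynomial ℕ ℤ :=
  ∑ i ∈ Finset.range (d + 1),
    C ((-1) ^ i * (d.choose i : ℤ)) * aeval (fun j => X j * C (c i j)) p

/-- Monomials are eigenvectors of scaling, so the alternating sum acts on each coefficient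
separately. -/
theorem coeff_aeval_scale (c : ℕ → ℤ) (p : MvPolynomial ℕ ℤ) (m : ℕ →₀ ℕ) :
    coeff m (aeval (fun j => X j * C (c j)) p) = coeff m p * m.prod fun j e => c j ^ e := by
  induction p using MvPolynomial.induction_on' with
  | monomial u a =>
    have : aeval (fun j => X j * C (c j)) (monomial u a) =
        monomial u (a * u.prod fun j e => c j ^ e) := by
      rw [aeval_monomial]
      simp only [mul_pow, Finsupp.prod_mul]
      rw [monomial_eq (a := a * _), C_mul, Finsupp.prod, Finsupp.prod, Finsupp.prod, map_prod,
        algebraMap_eq]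
      simp only [map_pow]
      ring
    rw [this, coeff_monomial, coeff_monomial]
    split
    · rename_i h
      rw [h]
    · simp
  | add p q hp hq => rw [map_add, coeff_add, hp, hq, coeff_add, add_mul]

theorem coeff_scaledSum (d : ℕ) (c : ℕ → ℕ → ℤ) (p : MvPolynomial ℕ ℤ) (m : ℕ →₀ ℕ) :
    coeff m (scaledSum d c p) = coeff m p * ∑ i ∈ Finset.range (d + 1),
      (-1) ^ i * (d.choose i : ℤ) * m.prod fun j e => c i j ^ e := by
  rw [scaledSum, coeff_sum, Finset.mul_sum]
  refine Finset.sum_congr rfl fun i _ => ?_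
  rw [coeff_C_mul, coeff_aeval_scale]
  ring

/-- The coefficient of `m` gets the factor `altSum 2 (m i)`, which is zero exactly for `m i ≤ 1`. -/
theorem scaledSum_single_eq_zero_iff (i : ℕ) (p : MvPolynomial ℕ ℤ) :
    scaledSum 2 (fun k j => if j = i then (k : ℤ) else 1) p = 0 ↔ p.degreeOf i ≤ 1 := by
  have hc : ∀ m, coeff m (scaledSum 2 (fun k j => if j = i then (k : ℤ) else 1) p) =
      coeff m p * altSum 2 (m i) := by
    intro m
    rw [coeff_scaledSum, altSum]
    congr 1
    refine Finset.sum_congr rfl fun k _ => ?_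
    congr 1
    simp only [Finsupp.prod, ite_pow, one_pow, Finset.prod_ite_eq']
    split
    · rfl
    · rename_i h
      rw [Finsupp.notMem_support_iff.1 h, pow_zero]
  rw [degreeOf_le_iff]
  constructor
  · intro h m hm
    by_contra hlt
    have := hc m
    rw [h, coeff_zero] at this
    rcases mul_eq_zero.1 this.symm with h1 | h1
    · exact (mem_support_iff.1 hm) h1
    · exact altSum_two_ne_zero (by omega) h1
  · intro h
    ext m
    rw [hc, coeff_zero]
    by_cases hm : m ∈ p.support
    · rw [altSum_of_lt (by have := h m hm; omega), mul_zero]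
    · rw [notMem_support_iff.1 hm, zero_mul]

/-- Position by position `m j ≤ (e j).size`, since a nonzero exponent has at least one digit.
Equality of the sums forces equality everywhere, so that each `e j` has at most one digit and is
itself `0` or `1`. -/
theorem degree_le_sum_size (e : List ℕ) (m : ℕ →₀ ℕ) (h1 : ∀ j, m j ≤ 1)
    (hs : ∀ j ∈ m.support, e.getD j 0 ≠ 0) :
    m.degree ≤ (e.map Nat.size).sum ∧
      (m.degree = (e.map Nat.size).sum → m = monomialOf e) := by
  have hle : ∀ j, m j ≤ (e.getD j 0).size := by
    intro j
    by_cases hj : j ∈ m.support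
    · exact (h1 j).trans (Nat.size_pos.2 (Nat.pos_of_ne_zero (hs j hj)))
    · rw [Finsupp.notMem_support_iff.1 hj]
      exact Nat.zero_le _
  have hsum : (e.map Nat.size).sum = ∑ j ∈ Finset.range e.length, (e.getD j 0).size := by
    rw [Finset.sum_range, ← List.sum_ofFn]
    congr 1
    apply List.ext_getElem <;> simp
  have hdeg : m.degree = ∑ j ∈ Finset.range e.length, m j := by
    rw [Finsupp.degree_apply]
    refine Finset.sum_subset (fun j hj => ?_) fun j _ hj => Finsupp.notMem_support_iff.1 hj
    by_contra hc
    refine hs j hj ?_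
    rw [List.getD_eq_getElem?_getD, List.getElem?_eq_none (by simpa using hc)]
    rfl
  rw [hdeg, hsum]
  refine ⟨Finset.sum_le_sum fun j _ => hle j, fun heq => ?_⟩
  have heq' := (Finset.sum_eq_sum_iff_of_le fun j _ => hle j).1 heq
  ext j
  have hmon : monomialOf e j = e.getD j 0 := by simp [monomialOf]
  rw [hmon]
  by_cases hj : j < e.length
  · have h2 := heq' j (Finset.mem_range.2 hj)
    have h3 := h1 j
    rw [h2] at h3
    have h4 : e.getD j 0 < 2 ^ 1 := Nat.size_le.1 h3
    rw [h2]
    generalize e.getD j 0 = a at *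
    interval_cases a <;> simp
  · have h0 : e.getD j 0 = 0 := by
      rw [List.getD_eq_getElem?_getD, List.getElem?_eq_none (by simpa using hj)]
      rfl
    rw [h0]
    by_contra hne
    exact hs j (Finsupp.mem_support_iff.2 hne) h0

/-- Monomials inside the support of `e` get the factor `altSum d m.degree`, the others are killed.
Multilinearity bounds the degree by `d`; smaller degrees give `0`, and the degree `d` leaves only
`monomialOf e`. Using the digit count for `d` also covers exponents above `1`: then everything
vanishes, as does the coefficient. -/
theorem scaledSum_support_eq_zero_iff (e : List ℕ) {p : MvPolynomial ℕ ℤ}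
    (hp : IsMultilinear p) :
    scaledSum (e.map Nat.size).sum (fun k j => if e.getD j 0 ≠ 0 then (k : ℤ) else 0) p = 0 ↔
      p.coeff (monomialOf e) = 0 := by
  set d := (e.map Nat.size).sum with hd
  have hc : ∀ m, (∀ j ∈ m.support, e.getD j 0 ≠ 0) →
      coeff m (scaledSum d (fun k j => if e.getD j 0 ≠ 0 then (k : ℤ) else 0) p) =
      coeff m p * altSum d m.degree := by
    intro m hm
    rw [coeff_scaledSum, altSum]
    congr 1
    refine Finset.sum_congr rfl fun k _ => ?_
    congr 1
    rw [Finsupp.prod, Finsupp.degree_apply, ← Finset.prod_pow_eq_pow_sum]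
    exact Finset.prod_congr rfl fun j hj => by rw [if_pos (hm j hj)]
  -- Such a monomial contains a variable that is replaced by `0`.
  have hc' : ∀ m, ¬ (∀ j ∈ m.support, e.getD j 0 ≠ 0) →
      coeff m (scaledSum d (fun k j => if e.getD j 0 ≠ 0 then (k : ℤ) else 0) p) = 0 := by
    intro m hm
    push Not at hm
    obtain ⟨j, hj, hj0⟩ := hm
    rw [coeff_scaledSum, Finset.sum_eq_zero, mul_zero]
    intro k _
    rw [Finsupp.prod, Finset.prod_eq_zero hj, mul_zero]
    rw [if_neg (by simpa using hj0), zero_pow (Finsupp.mem_support_iff.1 hj)]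
  have h1 : ∀ m ∈ p.support, ∀ j, m j ≤ 1 := fun m hm j =>
    (monomial_le_degreeOf j hm).trans (hp j)
  constructor
  · intro h
    by_contra hne
    have hm := mem_support_iff.2 hne
    have hs : ∀ j ∈ (monomialOf e).support, e.getD j 0 ≠ 0 := by
      intro j hj
      simpa [monomialOf] using hj
    -- A nonzero coefficient forces all exponents to be at most `1`, and such an exponent equals its
    -- number of digits.
    have hdeg : (monomialOf e).degree = d := by
      have hsz : ∀ a ∈ e, a ≤ 1 := by
        intro a ha
        obtain ⟨j, hj, rfl⟩ := List.mem_iff_getElem.1 ha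
        have := h1 _ hm j
        simpa [monomialOf, hj] using this
      have h2 : e.map Nat.size = e := by
        conv_rhs => rw [← List.map_id e]
        refine List.map_congr_left fun a ha => ?_
        have := hsz a ha
        interval_cases a <;> simp
      rw [hd, h2, Finsupp.degree_apply]
      have h3 : (monomialOf e).support ⊆ Finset.range e.length := by
        intro j hj
        by_contra hc
        refine hs j hj ?_
        rw [List.getD_eq_getElem?_getD, List.getElem?_eq_none (by simpa using hc)]
        rfl
      rw [Finset.sum_subset h3 fun j _ hj => Finsupp.notMem_support_iff.1 hj, Finset.sum_range,
        ← List.sum_ofFn]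
      congr 1
      apply List.ext_getElem <;> simp [monomialOf]
    have := hc _ hs
    rw [h, coeff_zero, hdeg] at this
    rcases mul_eq_zero.1 this.symm with h4 | h4
    · exact hne h4
    · exact altSum_self_ne_zero d h4
  · intro h
    ext m
    rw [coeff_zero]
    by_cases hs : ∀ j ∈ m.support, e.getD j 0 ≠ 0
    · rw [hc m hs]
      by_cases hm : m ∈ p.support
      · obtain ⟨h2, h3⟩ := degree_le_sum_size e m (h1 m hm) hs
        rcases h2.lt_or_eq with h4 | h4
        · rw [altSum_of_lt h4, mul_zero]
        · rw [h3 h4, h, zero_mul]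
      · rw [notMem_support_iff.1 hm, zero_mul]
    · exact hc' m hs

/-- At every integer point a sum of squares vanishes only if all summands do, and a polynomial over
`ℤ` is determined by its values. -/
theorem sum_sq_eq_zero_iff (n : ℕ) (T : ℕ → MvPolynomial ℕ ℤ) :
    ∑ i ∈ Finset.range n, T i * T i = 0 ↔ ∀ i < n, T i = 0 := by
  constructor
  · intro h i hi
    refine MvPolynomial.funext fun a => ?_
    have := congrArg (eval a) h
    simp only [map_sum, map_mul, map_zero] at this ⊢
    rw [Finset.sum_eq_zero_iff_of_nonneg fun i _ => mul_self_nonneg _] at this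
    exact mul_self_eq_zero.1 (this i (Finset.mem_range.2 hi))
  · intro h
    exact Finset.sum_eq_zero fun i hi => by rw [h i (Finset.mem_range.1 hi), mul_zero]

end Arith

/-! ### The circuits of the two reductions -/

namespace Arith

open MvPolynomial

/-! ### The circuit for the reduction of identity testing to coefficient testing -/

/-- Append the square of the gate `K`. -/
def sqStep (s : List Gate × ℕ) : List Gate × ℕ := (s.1 ++ [.mul s.2 s.2], s.1.length)

/-- A list of gates computing `2 ^ 2 ^ k` for `k ≤ m`, the last one being the second component. -/
def powers (m : ℕ) : List Gate × ℕ := sqStep^[m] ([.negOne, .mul 0 0, .add 0 1, .add 1 1], 3)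

/-- The gates that evaluate a circuit at the numbers `2 ^ 2 ^ ((j + 1) * t)`. -/
def evalGates (m t : ℕ) (gs : List Gate) : List Gate :=
  (powers m).1 ++ gs.map (copyGate (3 + t) t (powers m).1.length)

theorem powers_spec (m : ℕ) :
    Acyclic (powers m).1 ∧ (powers m).1.length = 4 + m ∧ (powers m).2 = 3 + m ∧
      val (powers m).1 1 = 1 ∧ val (powers m).1 2 = 0 ∧
      ∀ k ≤ m, val (powers m).1 (3 + k) = C (2 ^ 2 ^ k) := by
  induction m with
  | zero =>
    have e : (powers 0).1 = [] ++ [.negOne] ++ [.mul 0 0] ++ [.add 0 1] ++ [.add 1 1] := rfl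
    have h0 := val_snoc [] .negOne
    have h1 := val_snoc ([] ++ [.negOne]) (.mul 0 0)
    have h2 := val_snoc ([] ++ [.negOne] ++ [.mul 0 0]) (.add 0 1)
    have h3 := val_snoc ([] ++ [.negOne] ++ [.mul 0 0] ++ [.add 0 1]) (.add 1 1)
    simp only [List.nil_append, List.length_append, List.length_cons, List.length_nil, Nat.reduceAdd,
      Gate.value] at h0 h1 h2 h3
    have h1' : val ([.negOne] ++ [.mul 0 0]) 1 = 1 := by rw [h1, h0]; ring
    have h2' : val ([.negOne] ++ [.mul 0 0] ++ [.add 0 1]) 2 = 0 := by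
      rw [h2, h1', val_append _ _ (by simp), h0]
      ring
    refine ⟨?_, rfl, rfl, ?_, ?_, ?_⟩
    · rw [e]
      refine (((Acyclic.nil.snoc ?_).snoc ?_).snoc ?_).snoc ?_ <;> simp [Gate.children]
    · rw [e, List.nil_append, val_append _ _ (by simp), val_append _ _ (by simp), h1']
    · rw [e, List.nil_append, val_append _ _ (by simp), h2']
    · intro k hk
      obtain rfl : k = 0 := by omega
      rw [e, List.nil_append, h3, val_append _ _ (by simp), h1']
      simp only [pow_zero, pow_one]
      rw [show (2 : ℤ) = 1 + 1 by norm_num, C_add, C_1]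
  | succ m ih =>
    obtain ⟨ha, hl, hK, h1, h2, hv⟩ := ih
    have e : powers (m + 1) = sqStep (powers m) := Function.iterate_succ_apply' _ _ _
    rw [e, sqStep]
    refine ⟨ha.snoc ?_, by simp [hl]; omega, by omega, ?_, ?_, fun k hk => ?_⟩
    · simp [Gate.children]
      omega
    · rw [val_append _ _ (by omega), h1]
    · rw [val_append _ _ (by omega), h2]
    · rcases Nat.lt_or_ge k (m + 1) with h | h
      · rw [val_append _ _ (by omega), hv k (by omega)]
      · obtain rfl : k = m + 1 := by omega
        have e2 : 3 + (m + 1) = (powers m).1.length := by omega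
        rw [e2, val_snoc, Gate.value, hK, hv m le_rfl, ← C_mul, ← sq, ← pow_mul, ← pow_succ]

theorem aeval_C_eq (a : ℕ → ℤ) (p : MvPolynomial ℕ ℤ) :
    aeval (fun j => (C (a j) : MvPolynomial ℕ ℤ)) p = C (eval a p) := by
  induction p using MvPolynomial.induction_on with
  | C b => simp
  | add p q hp hq => rw [map_add, hp, hq, map_add, C_add]
  | mul_X p j hp => rw [map_mul, hp, aeval_X, map_mul, eval_X, C_mul]

/-- The circuit that decides by a coefficient whether `C₀` computes the zero polynomial. -/
theorem exists_circuit_evalGates (C₀ : Circuit) (n : ℕ) (hn : C₀.gates.length ≤ n)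
    (hvar : ∀ j, Gate.var j ∈ C₀.gates → j < n) :
    ∃ D : Circuit, D.gates = finish (evalGates ((n + 1) * (n + 1)) (n + 1) C₀.gates)
        ((evalGates ((n + 1) * (n + 1)) (n + 1) C₀.gates).length - 1) ∧
      ∃ a : ℤ, D.poly = C a ∧ (a = 0 ↔ C₀.poly = 0) := by
  obtain ⟨ha, hl, hK, h1, h2, hv⟩ := powers_spec ((n + 1) * (n + 1))
  have hpos := List.length_pos_iff.2 C₀.nonempty
  obtain ⟨hac, hvc⟩ := copy_spec ha (by omega) h1 C₀.acyclic (3 + (n + 1)) (n + 1)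
    (fun j => C (2 ^ 2 ^ ((j + 1) * (n + 1)))) (by
      intro j hj
      have hjn := hvar j hj
      -- The gate numbers substituted for the variables form an arithmetic progression, as
      -- `copyGate` requires; `j < n` keeps them within the computed powers.
      have e : 3 + (n + 1) + j * (n + 1) = 3 + (j + 1) * (n + 1) := by ring
      have hle : (j + 1) * (n + 1) ≤ (n + 1) * (n + 1) := Nat.mul_le_mul_right _ (by omega)
      rw [e]
      exact ⟨by omega, hv _ hle⟩)
  have hlen : (evalGates ((n + 1) * (n + 1)) (n + 1) C₀.gates).length =
      4 + (n + 1) * (n + 1) + C₀.gates.length := by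
    simp [evalGates, hl]
  obtain ⟨D, hD, hDp⟩ := exists_circuit_finish (G := evalGates ((n + 1) * (n + 1)) (n + 1) C₀.gates)
    hac (by omega) (by rw [evalGates, val_append _ _ (by omega), h2])
    ((evalGates ((n + 1) * (n + 1)) (n + 1) C₀.gates).length - 1) (by omega)
  refine ⟨D, hD, eval (fun j => 2 ^ 2 ^ ((j + 1) * (n + 1))) C₀.poly, ?_, ?_⟩
  · have hk := hvc (C₀.gates.length - 1) (by omega)
    have e : (evalGates ((n + 1) * (n + 1)) (n + 1) C₀.gates).length - 1 =
        (powers ((n + 1) * (n + 1))).1.length + (C₀.gates.length - 1) := by omega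
    rw [hDp, e, evalGates, hk, aeval_C_eq]
    rfl
  · constructor
    · intro h
      by_contra hne
      -- The output gate has a number below `n + 1`, so both bounds are strict for `t = n + 1`.
      refine eval_ne_zero (n + 1) (by omega) hne (fun i => ?_) (fun m => ?_) h
      · refine (degreeOf_val_le C₀.acyclic i (C₀.gates.length - 1) (by omega)).trans_lt ?_
        exact Nat.pow_lt_pow_right (by norm_num) (by omega)
      · refine ((coeffBounded_val C₀.acyclic (C₀.gates.length - 1) (by omega)).abs_coeff_le
          m).trans_lt ?_
        exact pow_lt_pow_right₀ (by norm_num) (Nat.pow_lt_pow_right (by norm_num) (by omega))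
    · intro h
      rw [h, map_zero]

/-! ### The circuit for the reduction of coefficient testing to identity testing -/

/-- A list of gates that begins with gates for `-1`, `1`, `0` and the first `n` variables. -/
structure IsBase (n : ℕ) (G : List Gate) : Prop where
  acyclic : Acyclic G
  length_le : 3 + n ≤ G.length
  val_zero : val G 0 = -1
  val_one : val G 1 = 1
  val_two : val G 2 = 0
  val_var : ∀ j < n, val G (3 + j) = X j

theorem IsBase.append {n : ℕ} {G H : List Gate} (h : IsBase n G) (ha : Acyclic (G ++ H)) :
    IsBase n (G ++ H) where
  acyclic := ha
  length_le := by simpa using h.length_le.trans (Nat.le_add_right _ _)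
  val_zero := by rw [val_append _ _ (by have := h.length_le; omega), h.val_zero]
  val_one := by rw [val_append _ _ (by have := h.length_le; omega), h.val_one]
  val_two := by rw [val_append _ _ (by have := h.length_le; omega), h.val_two]
  val_var := fun j hj => by rw [val_append _ _ (by have := h.length_le; omega), h.val_var j hj]

theorem IsBase.snoc {n : ℕ} {G : List Gate} (h : IsBase n G) {g : Gate}
    (hg : ∀ u ∈ g.children, u < G.length) : IsBase n (G ++ [g]) :=
  h.append (h.acyclic.snoc hg)

/-- The gates for the constants and the variables. -/
def baseGates (n : ℕ) : List Gate :=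
  [.negOne, .mul 0 0, .add 0 1] ++ (List.range n).map .var

theorem isBase_baseGates (n : ℕ) : IsBase n (baseGates n) := by
  induction n with
  | zero =>
    have e : baseGates 0 = [.negOne] ++ [.mul 0 0] ++ [.add 0 1] := rfl
    have h0 := val_snoc [] .negOne
    have h1 := val_snoc [.negOne] (.mul 0 0)
    have h2 := val_snoc ([.negOne] ++ [.mul 0 0]) (.add 0 1)
    simp only [List.nil_append, List.length_append, List.length_cons, List.length_nil, Nat.reduceAdd,
      Gate.value] at h0 h1 h2
    have h1' : val ([.negOne] ++ [.mul 0 0]) 1 = 1 := by rw [h1, h0]; ring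
    rw [e]
    refine ⟨?_, by simp, ?_, ?_, ?_, by simp⟩
    · refine ((Acyclic.nil.snoc (g := .negOne) ?_).snoc ?_).snoc ?_ <;> simp [Gate.children]
    · rw [val_append _ _ (by simp), val_append _ _ (by simp), h0]
    · rw [val_append _ _ (by simp), h1']
    · rw [h2, h1', val_append _ _ (by simp), h0]
      ring
  | succ n ih =>
    have e : baseGates (n + 1) = baseGates n ++ [.var n] := by
      simp [baseGates, List.range_succ]
    have hl : (baseGates n).length = 3 + n := by simp [baseGates]; omega
    rw [e]
    have h := ih.snoc (g := .var n) (by simp [Gate.children])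
    refine ⟨h.acyclic, by simp [hl]; omega, h.val_zero, h.val_one, h.val_two, fun j hj => ?_⟩
    rcases Nat.lt_or_ge j n with hj' | hj'
    · exact h.val_var j hj'
    · obtain rfl : j = n := by omega
      rw [← hl, val_snoc, Gate.value]

/-- Append the gate `K - 1`. -/
def predStep (s : List Gate × ℕ) : List Gate × ℕ := (s.1 ++ [.add s.2 0], s.1.length)

theorem predStep_spec {n : ℕ} {G : List Gate} (h : IsBase n G) (d : ℕ) :
    IsBase n (predStep^[d] (G, 2)).1 ∧ G <+: (predStep^[d] (G, 2)).1 ∧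
      (predStep^[d] (G, 2)).1.length = G.length + d ∧
      (predStep^[d] (G, 2)).2 < (predStep^[d] (G, 2)).1.length ∧
      val (predStep^[d] (G, 2)).1 (predStep^[d] (G, 2)).2 = C (-(d : ℤ)) := by
  induction d with
  | zero =>
    refine ⟨h, List.prefix_rfl, rfl, ?_, by simpa using h.val_two⟩
    have := h.length_le
    simp only [Function.iterate_zero, id]
    omega
  | succ d ih =>
    obtain ⟨hb, hp, hl, hK, hv⟩ := ih
    rw [Function.iterate_succ_apply', predStep]
    refine ⟨hb.snoc ?_, hp.trans (List.prefix_append _ _), by simp [hl]; omega, by simp, ?_⟩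
    · simp [Gate.children, hK]
      omega
    · rw [val_snoc, Gate.value, hv, hb.val_zero]
      push_cast
      simp only [C_neg, C_add, C_1]
      ring

/-- A list of gates with four distinguished gates. -/
structure TestState where
  gates : List Gate
  J : ℕ
  K : ℕ
  A : ℕ
  P : ℕ

/-- Append the gates for the scaled variables, with the scaling factors given by `c`. -/
def scaleGates (n : ℕ) (c : ℕ → ℕ) (G : List Gate) : List Gate :=
  G ++ (List.range n).map fun j => .mul (3 + j) (c j)

/-- Append the gates of a copy of a circuit in which the variables are replaced by the gates with
numbers from `vb` on. -/
def copyGates (vb vs : ℕ) (gs : List Gate) (G : List Gate) : List Gate :=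
  G ++ gs.map (copyGate vb vs G.length)

/-- Append the gates that update the weighted sum, the last gate being the new summand. -/
def weightGates (s : TestState) : TestState :=
  { gates := s.gates ++ [.mul s.J s.A] ++ [.mul s.P (s.gates.length - 1)] ++
      [.add s.gates.length (s.gates.length + 1)] ++ [.mul s.P s.K] ++ [.add s.K 1] ++ [.add s.J 1]
    J := s.gates.length + 5
    K := s.gates.length + 4
    A := s.gates.length + 2
    P := s.gates.length + 3 }

/-- One more evaluation of the circuit. -/
def testStep (n : ℕ) (gs : List Gate) (c : ℕ → ℕ → ℕ) (s : TestState) : TestState :=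
  weightGates { s with
    gates := copyGates s.gates.length 1 gs (scaleGates n (c s.J) s.gates) }

/-- The weighted sum after `t` evaluations. -/
noncomputable def weightedSum (d : ℕ) (O : ℕ → MvPolynomial ℕ ℤ) : ℕ → MvPolynomial ℕ ℤ
  | 0 => 0
  | t + 1 => C (t : ℤ) * weightedSum d O t + C (∏ k ∈ Finset.range t, ((k : ℤ) - d)) * O t

/-- For `t > d` both sides are `0`, which is why the truncated subtraction in `descFactorial` does
no harm. -/
theorem prod_range_sub (d t : ℕ) :
    ∏ k ∈ Finset.range t, ((k : ℤ) - d) = (-1) ^ t * (d.descFactorial t : ℤ) := by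
  induction t with
  | zero => simp
  | succ t ih =>
    rw [Finset.prod_range_succ, ih, Nat.descFactorial_succ]
    rcases le_total t d with h | h
    · push_cast [Nat.cast_sub h]
      ring
    · rcases h.eq_or_lt with rfl | h
      · simp
      · simp [Nat.descFactorial_of_lt h]

/-- The summand `O i` enters with the product `(0 - d) ⋯ (i - 1 - d)` and is afterwards multiplied
by `i + 1, …, t`, that is, by `t! / i!`. -/
theorem weightedSum_succ (d : ℕ) (O : ℕ → MvPolynomial ℕ ℤ) (t : ℕ) :
    weightedSum d O (t + 1) = ∑ i ∈ Finset.range (t + 1),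
      C ((t.descFactorial (t - i) : ℤ) * ((-1) ^ i * (d.descFactorial i : ℤ))) * O i := by
  induction t with
  | zero => simp [weightedSum]
  | succ t ih =>
    rw [weightedSum, ih, Finset.sum_range_succ _ (t + 1), Finset.mul_sum, prod_range_sub]
    congr 1
    · refine Finset.sum_congr rfl fun i hi => ?_
      have hi : i ≤ t := by simpa [Nat.lt_succ_iff] using hi
      rw [Nat.succ_sub hi, Nat.succ_descFactorial_succ, ← mul_assoc, ← C_mul]
      congr 2
      push_cast
      ring
    · simp

/-- Because `(d! / i!) * (d! / (d - i)!) = d! * choose d i`, the recursion yields the alternating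
sum without gates for binomial coefficients, at the price of the harmless factor `d!`. -/
theorem weightedSum_eq (d : ℕ) (O : ℕ → MvPolynomial ℕ ℤ) :
    weightedSum d O (d + 1) = C (d.factorial : ℤ) *
      ∑ i ∈ Finset.range (d + 1), C ((-1) ^ i * (d.choose i : ℤ)) * O i := by
  rw [weightedSum_succ, Finset.mul_sum]
  refine Finset.sum_congr rfl fun i hi => ?_
  have hi : i ≤ d := by simpa [Nat.lt_succ_iff] using hi
  rw [← mul_assoc (C _) (C _) (O i), ← C_mul]
  congr 2
  rw [Nat.descFactorial_eq_factorial_mul_choose, Nat.descFactorial_eq_factorial_mul_choose,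
    Nat.choose_symm hi, ← Nat.choose_mul_factorial_mul_factorial hi]
  push_cast
  ring

theorem isBase_scaleGates {n : ℕ} {c : ℕ → ℕ} {G : List Gate} (h : IsBase n G)
    (hc : ∀ j < n, c j < G.length) :
    IsBase n (scaleGates n c G) ∧ (scaleGates n c G).length = G.length + n ∧
      ∀ j < n, val (scaleGates n c G) (G.length + j) = X j * val G (c j) := by
  -- The number of gates added is separated from `n`, since all `n` variables must be available
  -- throughout.
  suffices hk : ∀ k ≤ n, IsBase n (G ++ (List.range k).map fun j => .mul (3 + j) (c j)) ∧
      ∀ j < k, val (G ++ (List.range k).map fun j => .mul (3 + j) (c j)) (G.length + j) =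
        X j * val G (c j) from
    ⟨(hk n le_rfl).1, by simp [scaleGates], (hk n le_rfl).2⟩
  intro k hk
  induction k with
  | zero => simpa using h
  | succ k ih =>
    obtain ⟨hb, hv⟩ := ih (by omega)
    have hlen := h.length_le
    have hck := hc k (by omega)
    set H := G ++ (List.range k).map fun j => Gate.mul (3 + j) (c j) with hH
    have hl : H.length = G.length + k := by simp [hH]
    have e : (G ++ (List.range (k + 1)).map fun j => Gate.mul (3 + j) (c j)) =
        H ++ [.mul (3 + k) (c k)] := by
      simp [hH, List.range_succ]
    rw [e]
    refine ⟨hb.snoc ?_, fun j hj => ?_⟩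
    · simp only [Gate.children, List.mem_cons, List.not_mem_nil, or_false]
      omega
    · rcases Nat.lt_or_ge j k with hj' | hj'
      · rw [val_append _ _ (by omega), hv j hj']
      · obtain rfl : j = k := by omega
        rw [← hl, val_snoc, Gate.value, hb.val_var j (by omega), hH, val_append _ _ hck]

/-- Loop invariant: `J` holds `t`, `K` holds `t - d`, `P` their running product and `A` the weighted
sum; initially these are the gates for `0`, `-d`, `1` and `0`. The hypothesis `hc` says that each
variable is scaled by the counter, by `1` or by `0`, so the factor is always an existing gate. -/
theorem testStep_spec {n : ℕ} {gs : List Gate} (hgs : Acyclic gs) (hne : gs ≠ [])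
    (hvar : ∀ j, Gate.var j ∈ gs → j < n) (c : ℕ → ℕ → ℕ) (cv : ℕ → ℕ → ℤ)
    (hc : ∀ j < n, (∀ J, c J j = J ∧ ∀ t : ℕ, cv t j = t) ∨ (∀ J, c J j = 1 ∧ ∀ t : ℕ, cv t j = 1) ∨
      (∀ J, c J j = 2 ∧ ∀ t : ℕ, cv t j = 0)) (d : ℕ) {G : List Gate} (hG : IsBase n G) {K : ℕ}
    (hK : K < G.length) (hKv : val G K = C (-(d : ℤ))) (t : ℕ) :
    ∃ s, (testStep n gs c)^[t] ⟨G, 2, K, 2, 1⟩ = s ∧ IsBase n s.gates ∧ G <+: s.gates ∧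
      s.gates.length = G.length + t * (n + gs.length + 6) ∧
      s.J < s.gates.length ∧ s.K < s.gates.length ∧ s.A < s.gates.length ∧ s.P < s.gates.length ∧
      val s.gates s.J = C (t : ℤ) ∧ val s.gates s.K = C ((t : ℤ) - d) ∧
      val s.gates s.A = weightedSum d (fun i => aeval (fun j => X j * C (cv i j))
        (val gs (gs.length - 1))) t ∧
      val s.gates s.P = C (∏ k ∈ Finset.range t, ((k : ℤ) - d)) := by
  have hpos := List.length_pos_iff.2 hne
  induction t with
  | zero =>
    have := hG.length_le
    refine ⟨_, rfl, hG, List.prefix_rfl, by simp, by simp; omega, hK, by simp; omega,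
      by simp; omega, ?_, ?_, ?_, ?_⟩
    · simpa using hG.val_two
    · simpa using hKv
    · simpa [weightedSum] using hG.val_two
    · simpa using hG.val_one
  | succ t ih =>
    obtain ⟨s, hs, hb, hp, hl, hJ, hK, hA, hP, hvJ, hvK, hvA, hvP⟩ := ih
    rw [Function.iterate_succ_apply', hs]
    refine ⟨_, rfl, ?_⟩
    have hlen := hb.length_le
    obtain ⟨hb1, hl1, hv1⟩ := isBase_scaleGates (c := c s.J) hb (by
      intro j hj
      rcases hc j hj with h | h | h
      · rw [(h _).1]; exact hJ
      · rw [(h _).1]; omega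
      · rw [(h _).1]; omega)
    obtain ⟨ha2, hv2⟩ := copy_spec hb1.acyclic (by have := hb1.length_le; omega) hb1.val_one hgs
      s.gates.length 1 (fun j => X j * C (cv t j)) (by
        intro j hj
        have hjn := hvar j hj
        refine ⟨by omega, ?_⟩
        rw [mul_one, hv1 j hjn]
        congr 1
        rcases hc j hjn with h | h | h
        · rw [(h _).1, (h 0).2, hvJ]
        · rw [(h _).1, (h 0).2, hb.val_one, C_1]
        · rw [(h _).1, (h 0).2, hb.val_two, C_0])
    have hb2 : IsBase n (copyGates s.gates.length 1 gs (scaleGates n (c s.J) s.gates)) :=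
      hb1.append ha2
    have hvO := hv2 (gs.length - 1) (by omega)
    have hp2 : s.gates <+: copyGates s.gates.length 1 gs (scaleGates n (c s.J) s.gates) :=
      (List.prefix_append _ _).trans (List.prefix_append _ _)
    have hl2 : (copyGates s.gates.length 1 gs (scaleGates n (c s.J) s.gates)).length =
        s.gates.length + n + gs.length := by
      simp [copyGates, hl1]
    rw [testStep, weightGates]
    simp only
    -- The output of the copy is the last gate before the six new ones.
    have hvO' : val (copyGates s.gates.length 1 gs (scaleGates n (c s.J) s.gates))
        (s.gates.length + n + gs.length - 1) =
        aeval (fun j => X j * C (cv t j)) (val gs (gs.length - 1)) := by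
      have e : s.gates.length + n + gs.length - 1 =
          (scaleGates n (c s.J) s.gates).length + (gs.length - 1) := by omega
      rw [e]
      exact hvO
    have hvJ2 := (val_prefix hp2 hJ).trans hvJ
    have hvK2 := (val_prefix hp2 hK).trans hvK
    have hvA2 := (val_prefix hp2 hA).trans hvA
    have hvP2 := (val_prefix hp2 hP).trans hvP
    rw [hl2]
    have hp' := hp.trans hp2
    generalize copyGates s.gates.length 1 gs (scaleGates n (c s.J) s.gates) = H at *
    have ext : ∀ (L : List Gate) (g : Gate) (k : ℕ), k < L.length →
        val (L ++ [g]) k = val L k := fun L g k hk => val_append L [g] hk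
    have hb3 := hb2.snoc (g := .mul s.J s.A) (by simp [Gate.children]; omega)
    have hb4 := hb3.snoc (g := .mul s.P (s.gates.length + n + gs.length - 1))
      (by simp [Gate.children]; omega)
    have hb5 := hb4.snoc (g := .add (s.gates.length + n + gs.length)
      (s.gates.length + n + gs.length + 1)) (by simp [Gate.children]; omega)
    have hb6 := hb5.snoc (g := .mul s.P s.K) (by simp [Gate.children]; omega)
    have hb7 := hb6.snoc (g := .add s.K 1) (by simp [Gate.children]; omega)
    have hb8 := hb7.snoc (g := .add s.J 1) (by simp [Gate.children]; omega)
    have v3 := val_snoc H (.mul s.J s.A)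
    have v4 := val_snoc (H ++ [.mul s.J s.A]) (.mul s.P (s.gates.length + n + gs.length - 1))
    have v5 := val_snoc (H ++ [.mul s.J s.A] ++ [.mul s.P (s.gates.length + n + gs.length - 1)])
      (.add (s.gates.length + n + gs.length) (s.gates.length + n + gs.length + 1))
    have v6 := val_snoc (H ++ [.mul s.J s.A] ++ [.mul s.P (s.gates.length + n + gs.length - 1)] ++
      [.add (s.gates.length + n + gs.length) (s.gates.length + n + gs.length + 1)]) (.mul s.P s.K)
    have v7 := val_snoc (H ++ [.mul s.J s.A] ++ [.mul s.P (s.gates.length + n + gs.length - 1)] ++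
      [.add (s.gates.length + n + gs.length) (s.gates.length + n + gs.length + 1)] ++
      [.mul s.P s.K]) (.add s.K 1)
    have v8 := val_snoc (H ++ [.mul s.J s.A] ++ [.mul s.P (s.gates.length + n + gs.length - 1)] ++
      [.add (s.gates.length + n + gs.length) (s.gates.length + n + gs.length + 1)] ++
      [.mul s.P s.K] ++ [.add s.K 1]) (.add s.J 1)
    have hsucc : ∀ (L : List Gate) (g : Gate), (L ++ [g]).length = L.length + 1 := by simp
    refine ⟨hb8, ?_, ?_, ?_, ?_, ?_, ?_, ?_, ?_, ?_, ?_⟩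
    · refine hp'.trans ?_
      simp only [List.append_assoc]
      exact List.prefix_append _ _
    · simp only [hsucc, hl2, hl]
      ring
    iterate 4
      · simp only [hsucc, hl2]
        omega
    · simp only [hsucc, hl2, Gate.value] at v8
      rw [v8]
      repeat rw [ext _ _ _ (by simp only [hsucc, hl2]; omega)]
      rw [hvJ2, hb2.val_one]
      push_cast
      simp
    · rw [ext _ _ _ (by simp only [hsucc, hl2]; omega)]
      simp only [hsucc, hl2, Gate.value] at v7
      rw [v7]
      repeat rw [ext _ _ _ (by simp only [hsucc, hl2]; omega)]
      rw [hvK2, hb2.val_one, ← C_1, ← C_add]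
      congr 1
      push_cast
      ring
    · iterate 3 rw [ext _ _ _ (by simp only [hsucc, hl2]; omega)]
      simp only [hsucc, hl2, Gate.value] at v3 v4 v5
      rw [v5, v4, ext _ _ (s.gates.length + n + gs.length) (by simp [hl2]), v3]
      repeat rw [ext _ _ _ (by simp only [hl2]; omega)]
      rw [hvJ2, hvA2, hvP2, hvO', weightedSum]
    · iterate 2 rw [ext _ _ _ (by simp only [hsucc, hl2]; omega)]
      simp only [hsucc, hl2, Gate.value] at v6
      rw [v6]
      repeat rw [ext _ _ _ (by simp only [hsucc, hl2]; omega)]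
      rw [hvP2, hvK2, ← C_mul, Finset.prod_range_succ]

/-- Append the gates of one test, and add the square of its result to the gate `acc`. -/
def testGates (n : ℕ) (gs : List Gate) (d : ℕ) (c : ℕ → ℕ → ℕ) (q : List Gate × ℕ) :
    List Gate × ℕ :=
  let s := (testStep n gs c)^[d + 1] ⟨(predStep^[d] (q.1, 2)).1, 2, (predStep^[d] (q.1, 2)).2, 2, 1⟩
  (s.gates ++ [.mul s.A s.A] ++ [.add q.2 s.gates.length], s.gates.length + 1)

theorem testGates_spec {n : ℕ} {gs : List Gate} (hgs : Acyclic gs) (hne : gs ≠ [])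
    (hvar : ∀ j, Gate.var j ∈ gs → j < n) (c : ℕ → ℕ → ℕ) (cv : ℕ → ℕ → ℤ)
    (hc : ∀ j < n, (∀ J, c J j = J ∧ ∀ t : ℕ, cv t j = t) ∨ (∀ J, c J j = 1 ∧ ∀ t : ℕ, cv t j = 1) ∨
      (∀ J, c J j = 2 ∧ ∀ t : ℕ, cv t j = 0)) (d : ℕ) {q : List Gate × ℕ} (hq : IsBase n q.1)
    (hacc : q.2 < q.1.length) :
    IsBase n (testGates n gs d c q).1 ∧
      (testGates n gs d c q).1.length = q.1.length + d + (d + 1) * (n + gs.length + 6) + 2 ∧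
      (testGates n gs d c q).2 < (testGates n gs d c q).1.length ∧
      val (testGates n gs d c q).1 (testGates n gs d c q).2 = val q.1 q.2 +
        (C (d.factorial : ℤ) * scaledSum d cv (val gs (gs.length - 1))) *
        (C (d.factorial : ℤ) * scaledSum d cv (val gs (gs.length - 1))) := by
  obtain ⟨hb, hp, hl, hK, hv⟩ := predStep_spec hq d
  obtain ⟨s, hs, hb', hp', hl', -, -, hA, -, -, -, hvA, -⟩ := testStep_spec hgs hne hvar c cv hc d hb
    hK hv (d + 1)
  rw [weightedSum_eq] at hvA
  have hvq := val_prefix (hp.trans hp') hacc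
  have hle := (hp.trans hp').length_le
  simp only [testGates, hs]
  refine ⟨(hb'.snoc ?_).snoc ?_, ?_, by simp, ?_⟩
  · simp [Gate.children, hA]
  · simp [Gate.children]
    omega
  · simp only [List.length_append, hl', hl, List.length_cons, List.length_nil]
  · have e : s.gates.length + 1 = (s.gates ++ [Gate.mul s.A s.A]).length := by simp
    rw [e, val_snoc, Gate.value, val_append _ _ (by omega), hvq, val_snoc, Gate.value, hvA]
    rfl

/-- The gates of the first `k` tests. -/
def allTests (n : ℕ) (gs : List Gate) (d : ℕ → ℕ) (c : ℕ → ℕ → ℕ → ℕ) : ℕ → List Gate × ℕ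
  | 0 => (baseGates n, 2)
  | k + 1 => testGates n gs (d k) (c k) (allTests n gs d c k)

theorem allTests_spec {n : ℕ} {gs : List Gate} (hgs : Acyclic gs) (hne : gs ≠ [])
    (hvar : ∀ j, Gate.var j ∈ gs → j < n) (c : ℕ → ℕ → ℕ → ℕ) (cv : ℕ → ℕ → ℕ → ℤ)
    (hc : ∀ i, ∀ j < n, (∀ J, c i J j = J ∧ ∀ t : ℕ, cv i t j = t) ∨
      (∀ J, c i J j = 1 ∧ ∀ t : ℕ, cv i t j = 1) ∨ (∀ J, c i J j = 2 ∧ ∀ t : ℕ, cv i t j = 0))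
    (d : ℕ → ℕ) (k : ℕ) :
    IsBase n (allTests n gs d c k).1 ∧
      (∀ m, (∀ i, d i ≤ m) → (allTests n gs d c k).1.length ≤
        3 + n + k * (m + (m + 1) * (n + gs.length + 6) + 2)) ∧
      (allTests n gs d c k).2 < (allTests n gs d c k).1.length ∧
      val (allTests n gs d c k).1 (allTests n gs d c k).2 = ∑ i ∈ Finset.range k,
        (C ((d i).factorial : ℤ) * scaledSum (d i) (cv i) (val gs (gs.length - 1))) *
        (C ((d i).factorial : ℤ) * scaledSum (d i) (cv i) (val gs (gs.length - 1))) := by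
  induction k with
  | zero =>
    have hb := isBase_baseGates n
    have := hb.length_le
    refine ⟨hb, fun m _ => ?_, ?_, ?_⟩
    · simp [allTests, baseGates]
      omega
    · simp only [allTests]
      omega
    · simpa [allTests] using hb.val_two
  | succ k ih =>
    obtain ⟨hb, hl, hacc, hv⟩ := ih
    obtain ⟨hb', hl', hacc', hv'⟩ := testGates_spec hgs hne hvar (c k) (cv k) (hc k) (d k) hb hacc
    refine ⟨hb', fun m hm => ?_, hacc', ?_⟩
    · rw [allTests, hl', Nat.succ_mul k]
      have h1 := hl m hm
      have h2 := hm k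
      have h3 : (d k + 1) * (n + gs.length + 6) ≤ (m + 1) * (n + gs.length + 6) :=
        Nat.mul_le_mul_right _ (by omega)
      omega
    · rw [allTests, hv', hv, Finset.sum_range_succ]

/-- The number of evaluations in the `i`-th test: the first `n` tests check multilinearity, the
last one checks a coefficient. -/
def testDegree (n : ℕ) (e : List ℕ) (i : ℕ) : ℕ :=
  if i = n then (e.map Nat.size).sum else 2

/-- The gate by which the variable `X j` is multiplied in the `i`-th test. -/
def testFactor (n : ℕ) (e : List ℕ) (i J j : ℕ) : ℕ :=
  if i = n then if e.getD j 0 ≠ 0 then J else 2 else if j = i then J else 1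

/-- The gates for all tests. -/
def reductionGates (n : ℕ) (gs : List Gate) (e : List ℕ) : List Gate × ℕ :=
  allTests n gs (testDegree n e) (testFactor n e) (n + 1)

/-- Each of the `n + 1` tests takes quadratically many gates. The power `5` matches the five nested
loops of `finishProg`. -/
theorem length_reductionGates_le {n : ℕ} {gs : List Gate} (hgs : Acyclic gs) (hne : gs ≠ [])
    (hvar : ∀ j, Gate.var j ∈ gs → j < n) (e : List ℕ) (hn : gs.length ≤ n)
    (he : (e.map Nat.size).sum ≤ n) :
    (reductionGates n gs e).1.length ≤ (n + 2) ^ 5 := by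
  have hpos := List.length_pos_iff.2 hne
  let cv (i t j : ℕ) : ℤ :=
    if i = n then if e.getD j 0 ≠ 0 then (t : ℤ) else 0 else if j = i then (t : ℤ) else 1
  obtain ⟨-, hl, -, -⟩ := allTests_spec hgs hne hvar (testFactor n e) cv (by
    intro i j _
    simp only [testFactor, cv]
    split <;> split <;> simp) (testDegree n e) (n + 1)
  -- The digit count is at most `n`, and `2 ≤ n + 1` because there is a gate.
  refine (hl (n + 1) fun i => ?_).trans ?_
  · simp only [testDegree]
    split <;> omega
  · have h1 : (n + 1 + 1) * (n + gs.length + 6) ≤ (n + 1 + 1) * (n + n + 6) :=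
      Nat.mul_le_mul_left _ (by omega)
    have h2 : (n + 1) * (n + 1 + (n + 1 + 1) * (n + gs.length + 6) + 2) ≤
        (n + 1) * (n + 1 + (n + 1 + 1) * (n + n + 6) + 2) := Nat.mul_le_mul_left _ (by omega)
    refine (Nat.add_le_add_left h2 _).trans ?_
    obtain ⟨k, rfl⟩ : ∃ k, n = k + 1 := ⟨n - 1, by omega⟩
    ring_nf
    nlinarith [Nat.zero_le (k ^ 2), Nat.zero_le (k ^ 3), Nat.zero_le (k ^ 4), Nat.zero_le (k ^ 5)]

/-- The circuit that decides by identity testing whether `C₀` computes a multilinear polynomial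
with a given coefficient `0`. -/
theorem exists_circuit_reductionGates (C₀ : Circuit) (n : ℕ)
    (hvar : ∀ j, Gate.var j ∈ C₀.gates → j < n) (e : List ℕ) :
    ∃ D : Circuit,
      D.gates = finish (reductionGates n C₀.gates e).1 (reductionGates n C₀.gates e).2 ∧
      (D.poly = 0 ↔ IsMultilinear C₀.poly ∧ C₀.poly.coeff (monomialOf e) = 0) := by
  let cv (i t j : ℕ) : ℤ :=
    if i = n then if e.getD j 0 ≠ 0 then (t : ℤ) else 0 else if j = i then (t : ℤ) else 1
  obtain ⟨hb, -, hacc, hv⟩ := allTests_spec C₀.acyclic C₀.nonempty hvar (testFactor n e) cv (by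
    intro i j _
    simp only [testFactor, cv]
    split <;> split <;> simp) (testDegree n e) (n + 1)
  obtain ⟨D, hD, hDp⟩ := exists_circuit_finish hb.acyclic (by have := hb.length_le; omega)
    hb.val_two _ hacc
  refine ⟨D, hD, ?_⟩
  have hpos := List.length_pos_iff.2 C₀.nonempty
  have h0 : ∀ i, (C ((testDegree n e i).factorial : ℤ) * scaledSum (testDegree n e i) (cv i)
      (val C₀.gates (C₀.gates.length - 1)) = 0 ↔
      scaledSum (testDegree n e i) (cv i) C₀.poly = 0) := by
    intro i
    rw [mul_eq_zero, C_eq_zero, or_iff_right (by simp [Nat.factorial_ne_zero])]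
    rfl
  rw [hDp, hv, sum_sq_eq_zero_iff]
  simp only [h0]
  have h1 : ∀ i < n, (scaledSum (testDegree n e i) (cv i) C₀.poly = 0 ↔
      C₀.poly.degreeOf i ≤ 1) := by
    intro i hi
    rw [← scaledSum_single_eq_zero_iff]
    simp only [testDegree, cv, hi.ne, if_false]
  -- Variables with an index from `n` on do not occur, so `n` tests suffice.
  have h2 : IsMultilinear C₀.poly ↔ ∀ i < n, C₀.poly.degreeOf i ≤ 1 := by
    refine ⟨fun h i _ => h i, fun h i => ?_⟩
    rcases Nat.lt_or_ge i n with hi | hi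
    · exact h i hi
    · have := degreeOf_val_eq_zero C₀.acyclic i (fun hm => absurd (hvar i hm) (by omega))
        (C₀.gates.length - 1) (by omega)
      exact this.le.trans (Nat.zero_le _)
  -- The last test is meaningful only for multilinear polynomials, which the other tests guarantee.
  have h3 : IsMultilinear C₀.poly → (scaledSum (testDegree n e n) (cv n) C₀.poly = 0 ↔
      C₀.poly.coeff (monomialOf e) = 0) := by
    intro h
    rw [← scaledSum_support_eq_zero_iff e h]
    simp only [testDegree, cv, if_true]
  constructor
  · intro h
    have hm : IsMultilinear C₀.poly := h2.2 fun i hi => (h1 i hi).1 (h i (by omega))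
    exact ⟨hm, (h3 hm).1 (h n (by omega))⟩
  · rintro ⟨hm, hz⟩ i hi
    rcases Nat.lt_or_ge i n with hi' | hi'
    · exact (h1 i hi').2 (hm i)
    · obtain rfl : i = n := by omega
      exact (h3 hm).2 hz

end Arith

/-! ### Recognizing instances in logarithmic space -/

namespace Arith

open Logspace

/-! ### Programs for circuits -/

/-- The letter that represents `1` in tally numbers. -/
def Sym.isTick : Sym → Bool
  | tick => true
  | _ => false

/-- The letters that begin a gate. -/
def Sym.isKind : Sym → Bool
  | negOne | var | add | mul => true
  | _ => false

/-- The letters that are followed by the number of a child. -/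
def Sym.isOpen : Sym → Bool
  | add | mul | sep => true
  | _ => false

/-- The letters that are binary digits. -/
def Sym.isBit : Sym → Bool
  | bit _ => true
  | _ => false

/-- The letter that begins an exponent. -/
def Sym.isPow : Sym → Bool
  | pow => true
  | _ => false

theorem finite_sym : Finite Sym := by
  let e : Sym → Fin 9
    | .negOne => 0
    | .var => 1
    | .add => 2
    | .mul => 3
    | .tick => 4
    | .sep => 5
    | .pow => 6
    | .bit false => 7
    | .bit true => 8
  refine Finite.of_injective e ?_
  intro a b h
  rcases a with _ | _ | _ | _ | _ | _ | _ | (_ | _) <;>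
    rcases b with _ | _ | _ | _ | _ | _ | _ | (_ | _) <;> first | rfl | (simp [e] at h)

/-- The place in an instance that a reader from left to right has arrived at. -/
inductive Ctx
  | start
  | neg
  | inVar
  | child1
  | child2
  | monOk
  | monBad
  | err
  deriving DecidableEq

theorem finite_ctx : Finite Ctx :=
  Finite.of_surjective (fun i : Fin 8 => Ctx.ofNat i) fun c =>
    ⟨⟨c.ctorIdx, by cases c <;> decide⟩, by cases c <;> rfl⟩

/-- The control store of our programs. -/
structure Ctl where
  cur : Option Sym
  ctx : Ctx
  flag : Bool
  inC : Bool

theorem finite_ctl : Finite Ctl := by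
  have := finite_ctx
  have := finite_sym
  refine Finite.of_injective (β := Option Sym × Ctx × Bool × Bool)
    (fun f => (f.cur, f.ctx, f.flag, f.inC)) ?_
  rintro ⟨_, _, _, _⟩ ⟨_, _, _, _⟩ h
  simpa using h

/-- The registers of our programs. -/
inductive Reg
  | p | idx | cnt | k | k1
  | pos | last | c0 | c1 | c2
  | vb | vs | sh
  | acc | T | z | a1 | a2 | a3 | a4 | a5
  | i | j | j1 | nn | tau | d | vj | cc
  | J | K | A | P | O | t1
  deriving DecidableEq

theorem finite_reg : Finite Reg :=
  Finite.of_surjective (fun i : Fin 37 => Reg.ofNat i) fun r =>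
    ⟨⟨r.ctorIdx, by cases r <;> decide⟩, by cases r <;> rfl⟩

/-- Our programs. -/
abbrev CProg := Prog Sym Sym Ctl Reg

/-- The stores of our programs. -/
abbrev CStore := Store Sym Ctl Reg

/-- The empty program. -/
def skip : CProg := .upd id

/-- Programs in sequence. -/
def block : List CProg → CProg
  | [] => skip
  | P :: Ps => .seq P (block Ps)

/-- Branch on `r < r'`. -/
def ifLt (r r' : Reg) (P Q : CProg) : CProg := .ifCmp (· == .lt) r r' P Q

/-- Branch on `r = r'`. -/
def ifEq (r r' : Reg) (P Q : CProg) : CProg := .ifCmp (· == .eq) r r' P Q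

/-- Execute the body for every letter of the input. -/
def letters (body : CProg) : CProg :=
  .forN 0 .p (.seq (.read .p fun f a => { f with cur := a }) body)

variable (x : List Sym)

@[simp]
theorem eval_skip (s : CStore) : Prog.eval x skip s = s := rfl

@[simp]
theorem eval_block_nil (s : CStore) : Prog.eval x (block []) s = s := rfl

@[simp]
theorem eval_block_cons (P : CProg) (Ps : List CProg) (s : CStore) :
    Prog.eval x (block (P :: Ps)) s = Prog.eval x (block Ps) (Prog.eval x P s) := rfl

@[simp]
theorem eval_ifLt (r r' : Reg) (P Q : CProg) (s : CStore) :
    Prog.eval x (ifLt r r' P Q) s =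
      if s.reg r < s.reg r' then Prog.eval x P s else Prog.eval x Q s := by
  simp only [ifLt, Prog.eval]
  by_cases h : s.reg r < s.reg r'
  · simp [h, compare_lt_iff_lt.2 h]
  · have : compare (s.reg r) (s.reg r') ≠ .lt := fun h' => h (compare_lt_iff_lt.1 h')
    simp [h, this]

@[simp]
theorem eval_ifEq (r r' : Reg) (P Q : CProg) (s : CStore) :
    Prog.eval x (ifEq r r' P Q) s =
      if s.reg r = s.reg r' then Prog.eval x P s else Prog.eval x Q s := by
  simp only [ifEq, Prog.eval]
  by_cases h : s.reg r = s.reg r'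
  · simp [h]
  · have : compare (s.reg r) (s.reg r') ≠ .eq := fun h' => h (compare_eq_iff_eq.1 h')
    simp [h, this]

theorem eval_forN_inv (b : Fin 3) (r : Reg) (P : CProg) (Inv : ℕ → CStore → Prop) (s : CStore)
    (h0 : Inv 0 { s with reg := Function.update s.reg r 0 })
    (hstep : ∀ k < x.length + b, ∀ s, Inv k s → Inv (k + 1) ((Prog.eval x P s).inc r)) :
    Inv (x.length + b) (Prog.eval x (.forN b r P) s) := by
  rw [Prog.eval]
  generalize x.length + (b : ℕ) = m at *
  induction m with
  | zero => exact h0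
  | succ m ih =>
    rw [Function.iterate_succ_apply']
    exact hstep m (by omega) _ (ih fun k hk => hstep k (by omega))

/-- For nested loops that serve only to repeat a step polynomially often: `Q` is indexed by the
total number of steps made. -/
theorem eval_forN_add (b : Fin 3) (r : Reg) (P : CProg) (Q : ℕ → CStore → Prop) (m : ℕ)
    (hr : ∀ t s v, Q t s → Q t { s with reg := Function.update s.reg r v })
    (hP : ∀ t s, Q t s → Q (t + m) (Prog.eval x P s)) (t : ℕ) (s : CStore) (h : Q t s) :
    Q (t + (x.length + b) * m) (Prog.eval x (.forN b r P) s) := by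
  refine eval_forN_inv x b r P (fun k s => Q (t + k * m) s) s (by simpa using hr _ _ _ h) ?_
  intro k _ s hs
  rw [Nat.succ_mul, ← add_assoc]
  exact hr _ _ _ (hP _ _ hs)

/-- A pass over the input becomes a `foldl`. The loop itself changes the current letter and the
position, so `Rel` must be insensitive to both. -/
theorem eval_letters {T : Type} (body : CProg) (hb : body.writes .p = false) (step : T → Sym → T)
    (Rel : T → CStore → Prop)
    (hcur : ∀ t s c, Rel t s → Rel t { s with ctl := { s.ctl with cur := c } })
    (hreg : ∀ t s v, Rel t s → Rel t { s with reg := Function.update s.reg .p v })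
    (hstep : ∀ t a s, Rel t s → s.ctl.cur = some a → Rel (step t a) (Prog.eval x body s))
    (t : T) (s : CStore) (h : Rel t s) :
    Rel (x.foldl step t) (Prog.eval x (letters body) s) := by
  have key := eval_forN_inv x 0 .p (.seq (.read .p fun f a => { f with cur := a }) body)
    (fun k s => Rel ((x.take k).foldl step t) s ∧ s.reg .p = k) s
    ⟨by simpa using hreg _ _ _ h, by simp⟩ (by
      rintro k hk s ⟨hs, hp⟩
      have hk : k < x.length := by simpa using hk
      simp only [Prog.eval, hp, List.getElem?_eq_getElem hk]
      have h1 := hstep _ x[k] _ (hcur _ s (some x[k]) hs) rfl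
      have h2 := Prog.eval_reg_of_not_writes x .p body hb
        { s with ctl := { s.ctl with cur := some x[k] } }
      refine ⟨?_, ?_⟩
      · rw [List.take_succ_eq_append_getElem hk, List.foldl_append]
        exact hreg _ _ _ h1
      · simp only [Store.inc, Function.update_self, h2, hp])
  have h3 := key.1
  simp only [Fin.val_zero, add_zero, List.take_length] at h3
  exact h3

/-! ### Checking the syntax -/

/-- The syntax of instances. -/
def ctxStep : Ctx → Sym → Ctx
  | .start, .negOne | .neg, .negOne | .inVar, .negOne | .child2, .negOne => .neg
  | .start, .var | .neg, .var | .inVar, .var | .child2, .var => .inVar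
  | .start, .add | .neg, .add | .inVar, .add | .child2, .add => .child1
  | .start, .mul | .neg, .mul | .inVar, .mul | .child2, .mul => .child1
  | .inVar, .tick => .inVar
  | .child1, .tick => .child1
  | .child2, .tick => .child2
  | .child1, .sep => .child2
  | .neg, .pow | .inVar, .pow | .child2, .pow | .monOk, .pow => .monOk
  | .monOk, .bit b | .monBad, .bit b => if b then .monOk else .monBad
  | _, _ => .err

/-- Is the reader inside the number of a child? -/
def Ctx.isChild : Ctx → Bool
  | child1 | child2 => true
  | _ => false

/-- The places after which a new gate may begin. -/
def Ctx.atGate : Ctx → Bool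
  | start | neg | inVar | child2 => true
  | _ => false

/-- The places after which a circuit may end. -/
def Ctx.isCircuit : Ctx → Bool
  | neg | inVar | child2 => true
  | _ => false

/-- The places after which an instance may end. -/
def Ctx.isInstance : Ctx → Bool
  | neg | inVar | child2 | monOk => true
  | _ => false

/-- Check the syntax and that children come before their parents; besides the place we store the
number of gates and one more than the number of ticks read since the last other letter. -/
def checkStep (t : Ctx × ℕ × ℕ) (a : Sym) : Ctx × ℕ × ℕ :=
  let ctx := ctxStep t.1 a
  let idx := if a.isKind then t.2.1 + 1 else t.2.1
  let cnt := if a.isTick then t.2.2 + 1 else 1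
  -- Inside a child's number, `cnt` is this number plus one and `idx` already counts the current
  -- gate, so the test says that the child comes earlier.
  (if ctx.isChild ∧ ¬ cnt < idx then .err else ctx, idx, cnt)

/-- With the least significant bit first, the absence of superfluous zeros means that the last digit
is not `0`. -/
theorem exists_bits (l : List Bool) (h : l.getLast? ≠ some false) : ∃ a : ℕ, a.bits = l := by
  induction l with
  | nil => exact ⟨0, by simp⟩
  | cons b l ih =>
    rcases l with _ | ⟨b', l⟩
    · have : b = true := by simpa using h
      exact ⟨1, by simp [this]⟩
    · obtain ⟨a, ha⟩ := ih (by simpa using h)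
      refine ⟨Nat.bit b a, ?_⟩
      rw [Nat.bits_append_bit, ha]
      rintro rfl
      simp at ha

theorem getLast?_bits (a : ℕ) : a.bits.getLast? ≠ some false := by
  induction a using Nat.binaryRec' with
  | zero => simp
  | bit b a h ih =>
    rw [Nat.bits_append_bit a b h]
    by_cases ha : a = 0
    · subst ha
      simp [h rfl]
    · have : a.bits ≠ [] := by
        intro h0
        have := Nat.size_eq_bits_len a
        rw [h0] at this
        simp at this
        exact ha (Nat.size_eq_zero.1 this.symm)
      obtain ⟨b', l, hl⟩ := List.exists_cons_of_ne_nil this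
      rw [hl] at ih ⊢
      simpa using ih

/-- What we know about a word after which the syntax check is in a given state. -/
def Parsed (w : List Sym) : Ctx × ℕ × ℕ → Prop
  | (.start, idx, _) => w = [] ∧ idx = 0
  | (.neg, idx, _) => ∃ gs, Acyclic gs ∧ gs ≠ [] ∧ w = gs.flatMap Gate.encode ∧ idx = gs.length
  | (.inVar, idx, _) => ∃ gs j, Acyclic gs ∧
      w = gs.flatMap Gate.encode ++ .var :: List.replicate j .tick ∧ idx = gs.length + 1
  | (.child1, idx, cnt) => ∃ gs u, ∃ a ∈ [Sym.add, Sym.mul], Acyclic gs ∧ u < gs.length ∧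
      w = gs.flatMap Gate.encode ++ a :: List.replicate u .tick ∧ idx = gs.length + 1 ∧ cnt = u + 1
  | (.child2, idx, cnt) => ∃ gs u v, ∃ a ∈ [Sym.add, Sym.mul], Acyclic gs ∧ u < gs.length ∧
      v < gs.length ∧ w = gs.flatMap Gate.encode ++
        a :: (List.replicate u .tick ++ .sep :: List.replicate v .tick) ∧
      idx = gs.length + 1 ∧ cnt = v + 1
  | (.monOk, idx, _) => ∃ (gs : List Gate) (e : List ℕ) (l : List Bool), Acyclic gs ∧ gs ≠ [] ∧ w = gs.flatMap Gate.encode ++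
      (encodeMonomial e ++ .pow :: l.map .bit) ∧ l.getLast? ≠ some false ∧ idx = gs.length
  | (.monBad, idx, _) => ∃ (gs : List Gate) (e : List ℕ) (l : List Bool), Acyclic gs ∧ gs ≠ [] ∧ w = gs.flatMap Gate.encode ++
      (encodeMonomial e ++ .pow :: l.map .bit) ∧ idx = gs.length
  | (.err, _, _) => True

/-- Where a gate may begin, the gate being read may be regarded as complete, tally numbers having no
end mark. -/
theorem Parsed.gate {w : List Sym} {ctx : Ctx} {idx cnt : ℕ} (h : Parsed w (ctx, idx, cnt))
    (hc : ctx.atGate = true) :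
    ∃ gs, Acyclic gs ∧ w = gs.flatMap Gate.encode ∧ idx = gs.length ∧ (ctx ≠ .start → gs ≠ []) := by
  cases ctx <;> simp [Ctx.atGate] at hc
  · obtain ⟨rfl, rfl⟩ := h
    exact ⟨[], Acyclic.nil, rfl, rfl, by simp⟩
  · obtain ⟨gs, ha, hne, hw, hi⟩ := h
    exact ⟨gs, ha, hw, hi, fun _ => hne⟩
  · obtain ⟨gs, j, ha, hw, hi⟩ := h
    refine ⟨gs ++ [.var j], ha.snoc (by simp [Gate.children]), ?_, by simp [hi], by simp⟩
    simp [hw, Gate.encode]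
  · obtain ⟨gs, u, v, a, hmem, ha, hu, hv, hw, hi, -⟩ := h
    simp only [List.mem_cons, List.not_mem_nil, or_false] at hmem
    rcases hmem with rfl | rfl
    · refine ⟨gs ++ [.add u v], ha.snoc (by simp [Gate.children, hu, hv]), ?_, by simp [hi],
        by simp⟩
      simp [hw, Gate.encode]
    · refine ⟨gs ++ [.mul u v], ha.snoc (by simp [Gate.children, hu, hv]), ?_, by simp [hi],
        by simp⟩
      simp [hw, Gate.encode]

/-- Letters that begin a gate, or the monomial after a circuit, close the current gate and are
treated uniformly through `Parsed.gate`. The other letters extend the number being read or the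
monomial, or lead to `err`, about which nothing is claimed. -/
theorem Parsed.step {w : List Sym} {t : Ctx × ℕ × ℕ} (h : Parsed w t) (a : Sym) :
    Parsed (w ++ [a]) (checkStep t a) := by
  obtain ⟨ctx, idx, cnt⟩ := t
  have hgate := h.gate
  have key : ∀ ctx', ctxStep ctx a = ctx' → Parsed (w ++ [a]) (checkStep (ctx, idx, cnt) a) := by
    intro ctx' hctx
    simp only [checkStep, hctx]
    by_cases hchk : ctx'.isChild = true ∧ ¬ (if a.isTick = true then cnt + 1 else 1) <
        if a.isKind = true then idx + 1 else idx
    · rw [if_pos hchk]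
      trivial
    rw [if_neg hchk]
    by_cases hk : a.isKind = true ∧ ctx.atGate = true
    · obtain ⟨gs, ha, hw, hi, -⟩ := hgate hk.2
      obtain ⟨hka, hka'⟩ := hk
      cases a <;> simp [Sym.isKind] at hka
      · have : ctx' = .neg := by rw [← hctx]; cases ctx <;> simp_all [Ctx.atGate, ctxStep]
        subst this
        refine ⟨gs ++ [.negOne], ha.snoc (by simp [Gate.children]), by simp, ?_, ?_⟩
        · simp [hw, Gate.encode]
        · simp [hi, Sym.isKind]
      · have : ctx' = .inVar := by rw [← hctx]; cases ctx <;> simp_all [Ctx.atGate, ctxStep]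
        subst this
        refine ⟨gs, 0, ha, ?_, ?_⟩
        · simp [hw]
        · simp [hi, Sym.isKind]
      · have : ctx' = .child1 := by rw [← hctx]; cases ctx <;> simp_all [Ctx.atGate, ctxStep]
        subst this
        simp [Ctx.isChild, Sym.isKind, Sym.isTick] at hchk
        refine ⟨gs, 0, .add, by simp, ha, by omega, ?_, ?_, ?_⟩
        · simp [hw]
        · simp [hi, Sym.isKind]
        · simp [Sym.isTick]
      · have : ctx' = .child1 := by rw [← hctx]; cases ctx <;> simp_all [Ctx.atGate, ctxStep]
        subst this
        simp [Ctx.isChild, Sym.isKind, Sym.isTick] at hchk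
        refine ⟨gs, 0, .mul, by simp, ha, by omega, ?_, ?_, ?_⟩
        · simp [hw]
        · simp [hi, Sym.isKind]
        · simp [Sym.isTick]
    by_cases hpow : a.isPow = true ∧ ctx.isCircuit = true
    · obtain ⟨hp, hcirc⟩ := hpow
      obtain ⟨gs, ha, hw, hi, hne⟩ := hgate (by cases ctx <;> simp_all [Ctx.atGate, Ctx.isCircuit])
      cases a <;> simp [Sym.isPow] at hp
      have : ctx' = .monOk := by rw [← hctx]; cases ctx <;> simp_all [Ctx.isCircuit, ctxStep]
      subst this
      refine ⟨gs, [], [], ha, hne (by rintro rfl; simp [Ctx.isCircuit] at hcirc), ?_, by simp, ?_⟩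
      · simp [hw, encodeMonomial]
      · simp [hi, Sym.isKind]
    cases ctx
    · cases a <;> simp_all [ctxStep, Ctx.atGate, Sym.isKind] <;> subst hctx <;> trivial
    · cases a <;> simp_all [ctxStep, Ctx.atGate, Sym.isKind, Sym.isPow, Ctx.isCircuit] <;>
        subst hctx <;> trivial
    · cases a
      case tick =>
        obtain rfl : ctx' = .inVar := by rw [← hctx]; rfl
        obtain ⟨gs, j, ha, hw, hi⟩ := h
        exact ⟨gs, j + 1, ha, by simp [hw, List.replicate_succ'], by simpa [Sym.isKind] using hi⟩
      all_goals
        simp_all [ctxStep, Ctx.atGate, Sym.isKind, Sym.isPow, Ctx.isCircuit] <;>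
          subst hctx <;> trivial
    · cases a
      case tick =>
        obtain rfl : ctx' = .child1 := by rw [← hctx]; rfl
        obtain ⟨gs, u, a, hmem, ha, hu, hw, hi, hc⟩ := h
        simp [Ctx.isChild, Sym.isKind, Sym.isTick] at hchk
        exact ⟨gs, u + 1, a, hmem, ha, by omega, by simp [hw, List.replicate_succ'],
          by simpa [Sym.isKind] using hi, by simpa [Sym.isTick] using hc⟩
      case sep =>
        obtain rfl : ctx' = .child2 := by rw [← hctx]; rfl
        obtain ⟨gs, u, a, hmem, ha, hu, hw, hi, hc⟩ := h
        simp [Ctx.isChild, Sym.isKind, Sym.isTick] at hchk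
        exact ⟨gs, u, 0, a, hmem, ha, hu, by omega, by simp [hw],
          by simpa [Sym.isKind] using hi, by simp [Sym.isTick]⟩
      all_goals
        obtain rfl : ctx' = .err := by rw [← hctx]; rfl
        trivial
    · cases a
      case tick =>
        obtain rfl : ctx' = .child2 := by rw [← hctx]; rfl
        obtain ⟨gs, u, v, a, hmem, ha, hu, hv, hw, hi, hc⟩ := h
        simp [Ctx.isChild, Sym.isKind, Sym.isTick] at hchk
        exact ⟨gs, u, v + 1, a, hmem, ha, hu, by omega, by simp [hw, List.replicate_succ'],
          by simpa [Sym.isKind] using hi, by simpa [Sym.isTick] using hc⟩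
      all_goals
        simp_all [ctxStep, Ctx.atGate, Sym.isKind, Sym.isPow, Ctx.isCircuit] <;>
          subst hctx <;> trivial
    · cases a
      case pow =>
        obtain rfl : ctx' = .monOk := by rw [← hctx]; rfl
        obtain ⟨gs, e, l, ha, hne, hw, hl, hi⟩ := h
        obtain ⟨b, hb⟩ := exists_bits l hl
        refine ⟨gs, e ++ [b], [], ha, hne, ?_, by simp, by simpa [Sym.isKind] using hi⟩
        simp [hw, encodeMonomial, hb]
      case bit b =>
        obtain ⟨gs, e, l, ha, hne, hw, hl, hi⟩ := h
        have hw' : w ++ [Sym.bit b] = gs.flatMap Gate.encode ++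
            (encodeMonomial e ++ .pow :: (l ++ [b]).map .bit) := by simp [hw]
        cases b
        · obtain rfl : ctx' = .monBad := by rw [← hctx]; rfl
          exact ⟨gs, e, l ++ [false], ha, hne, hw', by simpa [Sym.isKind] using hi⟩
        · obtain rfl : ctx' = .monOk := by rw [← hctx]; rfl
          exact ⟨gs, e, l ++ [true], ha, hne, hw', by simp, by simpa [Sym.isKind] using hi⟩
      all_goals
        obtain rfl : ctx' = .err := by rw [← hctx]; rfl
        trivial
    · cases a
      case bit b =>
        obtain ⟨gs, e, l, ha, hne, hw, hi⟩ := h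
        have hw' : w ++ [Sym.bit b] = gs.flatMap Gate.encode ++
            (encodeMonomial e ++ .pow :: (l ++ [b]).map .bit) := by simp [hw]
        cases b
        · obtain rfl : ctx' = .monBad := by rw [← hctx]; rfl
          exact ⟨gs, e, l ++ [false], ha, hne, hw', by simpa [Sym.isKind] using hi⟩
        · obtain rfl : ctx' = .monOk := by rw [← hctx]; rfl
          exact ⟨gs, e, l ++ [true], ha, hne, hw', by simp, by simpa [Sym.isKind] using hi⟩
      all_goals
        obtain rfl : ctx' = .err := by rw [← hctx]; rfl
        trivial
    · obtain rfl : ctx' = .err := by rw [← hctx]; cases a <;> rfl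
      trivial
  exact key _ rfl

theorem parsed_foldl (w : List Sym) : Parsed w (w.foldl checkStep (.start, 0, 0)) := by
  induction w using List.reverseRecOn with
  | nil => exact ⟨rfl, rfl⟩
  | append_singleton w a ih =>
    rw [List.foldl_append]
    exact ih.step a

theorem exists_of_isInstance {w : List Sym}
    (h : (w.foldl checkStep (.start, 0, 0)).1.isInstance = true) :
    ∃ gs e, Acyclic gs ∧ gs ≠ [] ∧ w = gs.flatMap Gate.encode ++ encodeMonomial e ∧
      ((w.foldl checkStep (.start, 0, 0)).1.isCircuit = true → e = []) := by
  have hp := parsed_foldl w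
  generalize w.foldl checkStep (.start, 0, 0) = t at *
  obtain ⟨ctx, idx, cnt⟩ := t
  by_cases hc : ctx.isCircuit = true
  · obtain ⟨gs, ha, hw, -, hne⟩ := hp.gate (by cases ctx <;> simp_all [Ctx.atGate, Ctx.isCircuit])
    refine ⟨gs, [], ha, hne ?_, by simp [hw, encodeMonomial], fun _ => rfl⟩
    rintro rfl
    simp [Ctx.isCircuit] at hc
  · obtain rfl : ctx = .monOk := by cases ctx <;> simp_all [Ctx.isInstance, Ctx.isCircuit]
    obtain ⟨gs, e, l, ha, hne, hw, hl, -⟩ := hp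
    obtain ⟨b, hb⟩ := exists_bits l hl
    exact ⟨gs, e ++ [b], ha, hne, by simp [hw, encodeMonomial, hb], by simp [Ctx.isCircuit]⟩

theorem foldl_checkStep_tick (ctx : Ctx) (idx cnt k : ℕ)
    (h : ctx = .inVar ∨ (ctx.isChild = true ∧ cnt + k < idx)) :
    (List.replicate k Sym.tick).foldl checkStep (ctx, idx, cnt) = (ctx, idx, cnt + k) := by
  induction k generalizing cnt with
  | zero => rfl
  | succ k ih =>
    rw [List.replicate_succ, List.foldl_cons]
    have : checkStep (ctx, idx, cnt) .tick = (ctx, idx, cnt + 1) := by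
      rcases h with rfl | ⟨h, h'⟩
      · simp [checkStep, ctxStep, Ctx.isChild, Sym.isKind, Sym.isTick]
      · cases ctx <;> simp [Ctx.isChild] at h
        · simp [checkStep, ctxStep, Ctx.isChild, Sym.isKind, Sym.isTick]
          omega
        · simp [checkStep, ctxStep, Ctx.isChild, Sym.isKind, Sym.isTick]
          omega
    rw [this, ih (cnt + 1) (h.imp id fun h => ⟨h.1, by omega⟩)]
    congr 2
    omega

theorem foldl_checkStep_encode (g : Gate) (ctx : Ctx) (idx cnt : ℕ) (hc : ctx.atGate = true)
    (hg : ∀ u ∈ g.children, u < idx) :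
    ∃ ctx' cnt', g.encode.foldl checkStep (ctx, idx, cnt) = (ctx', idx + 1, cnt') ∧
      ctx'.isCircuit = true := by
  cases g with
  | negOne =>
    refine ⟨.neg, 1, ?_, rfl⟩
    cases ctx <;> simp [Ctx.atGate] at hc <;> rfl
  | var j =>
    refine ⟨.inVar, 1 + j, ?_, rfl⟩
    have : checkStep (ctx, idx, cnt) .var = (.inVar, idx + 1, 1) := by
      cases ctx <;> simp [Ctx.atGate] at hc <;> rfl
    rw [Gate.encode, List.foldl_cons, this, foldl_checkStep_tick _ _ _ _ (.inl rfl)]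
  | add u v =>
    simp only [Gate.children, List.mem_cons, List.not_mem_nil, or_false, forall_eq_or_imp,
      forall_eq] at hg
    refine ⟨.child2, 1 + v, ?_, rfl⟩
    have h1 : checkStep (ctx, idx, cnt) .add = (.child1, idx + 1, 1) := by
      cases ctx <;> simp [Ctx.atGate] at hc <;>
        simp [checkStep, ctxStep, Ctx.isChild, Sym.isKind, Sym.isTick] <;> omega
    have h2 : checkStep (.child1, idx + 1, 1 + u) .sep = (.child2, idx + 1, 1) := by
      simp [checkStep, ctxStep, Ctx.isChild, Sym.isKind, Sym.isTick]
      omega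
    rw [Gate.encode, List.foldl_cons, h1, List.foldl_append,
      foldl_checkStep_tick _ _ _ _ (.inr ⟨rfl, by omega⟩), List.foldl_cons, h2,
      foldl_checkStep_tick _ _ _ _ (.inr ⟨rfl, by omega⟩)]
  | mul u v =>
    simp only [Gate.children, List.mem_cons, List.not_mem_nil, or_false, forall_eq_or_imp,
      forall_eq] at hg
    refine ⟨.child2, 1 + v, ?_, rfl⟩
    have h1 : checkStep (ctx, idx, cnt) .mul = (.child1, idx + 1, 1) := by
      cases ctx <;> simp [Ctx.atGate] at hc <;>
        simp [checkStep, ctxStep, Ctx.isChild, Sym.isKind, Sym.isTick] <;> omega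
    have h2 : checkStep (.child1, idx + 1, 1 + u) .sep = (.child2, idx + 1, 1) := by
      simp [checkStep, ctxStep, Ctx.isChild, Sym.isKind, Sym.isTick]
      omega
    rw [Gate.encode, List.foldl_cons, h1, List.foldl_append,
      foldl_checkStep_tick _ _ _ _ (.inr ⟨rfl, by omega⟩), List.foldl_cons, h2,
      foldl_checkStep_tick _ _ _ _ (.inr ⟨rfl, by omega⟩)]

/-- The converse of soundness: acyclicity is what keeps the check from failing. -/
theorem foldl_checkStep_gates {gs : List Gate} (hgs : Acyclic gs) :
    ∃ ctx cnt, (gs.flatMap Gate.encode).foldl checkStep (.start, 0, 0) = (ctx, gs.length, cnt) ∧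
      ctx.atGate = true ∧ (gs ≠ [] → ctx.isCircuit = true) := by
  induction gs using List.reverseRecOn with
  | nil => exact ⟨.start, 0, rfl, rfl, by simp⟩
  | append_singleton gs g ih =>
    rw [acyclic_snoc] at hgs
    obtain ⟨ctx, cnt, he, hc, -⟩ := ih hgs.1
    obtain ⟨ctx', cnt', he', hc'⟩ := foldl_checkStep_encode g ctx gs.length cnt hc hgs.2
    refine ⟨ctx', cnt', ?_, ?_, fun _ => hc'⟩
    · rw [List.flatMap_append, List.foldl_append, he]
      simpa using he'
    · cases ctx' <;> simp_all [Ctx.isCircuit, Ctx.atGate]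

theorem foldl_checkStep_bits (l : List Bool) (hl : l.getLast? ≠ some false) (ctx : Ctx)
    (idx cnt : ℕ) (hc : ctx = .monOk ∨ (ctx = .monBad ∧ l ≠ [])) :
    ∃ cnt', (l.map Sym.bit).foldl checkStep (ctx, idx, cnt) = (.monOk, idx, cnt') := by
  induction l generalizing ctx cnt with
  | nil =>
    obtain rfl : ctx = .monOk := by simpa using hc
    exact ⟨cnt, rfl⟩
  | cons b l ih =>
    have : checkStep (ctx, idx, cnt) (.bit b) = (if b then .monOk else .monBad, idx, 1) := by
      rcases hc with rfl | ⟨rfl, -⟩ <;> cases b <;> rfl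
    rw [List.map_cons, List.foldl_cons, this]
    rcases l with _ | ⟨b', l⟩
    · obtain rfl : b = true := by simpa using hl
      exact ⟨1, rfl⟩
    · refine ih (by simpa using hl) _ _ ?_
      cases b <;> simp

theorem foldl_checkStep_monomial (e : List ℕ) (ctx : Ctx) (idx cnt : ℕ)
    (hc : ctx.isInstance = true) :
    ∃ ctx' cnt', (encodeMonomial e).foldl checkStep (ctx, idx, cnt) = (ctx', idx, cnt') ∧
      ctx'.isInstance = true ∧ (e = [] → ctx' = ctx) := by
  induction e generalizing ctx cnt with
  | nil => exact ⟨ctx, cnt, rfl, hc, fun _ => rfl⟩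
  | cons a e ih =>
    have h1 : checkStep (ctx, idx, cnt) .pow = (.monOk, idx, 1) := by
      cases ctx <;> simp [Ctx.isInstance] at hc <;> rfl
    obtain ⟨cnt', h2⟩ := foldl_checkStep_bits a.bits (getLast?_bits a) .monOk idx 1 (.inl rfl)
    obtain ⟨ctx'', cnt'', h3, h4, -⟩ := ih .monOk cnt' rfl
    refine ⟨ctx'', cnt'', ?_, h4, by simp⟩
    rw [encodeMonomial, List.flatMap_cons, List.foldl_append, List.foldl_cons, h1, h2]
    exact h3

/-- The program for one step of the syntax check. -/
def checkBody : CProg :=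
  block [.upd fun f => { f with ctx := f.cur.elim f.ctx (ctxStep f.ctx) },
    .ite (fun f => f.cur.any Sym.isKind) (.inc .idx) skip,
    .ite (fun f => f.cur.any Sym.isTick) skip (.clear .cnt),
    .inc .cnt,
    .ite (fun f => f.ctx.isChild) (ifLt .cnt .idx skip (.upd fun f => { f with ctx := .err })) skip]

/-- The store agrees with a state of the syntax check. -/
def CheckRel (o : List Sym) (t : Ctx × ℕ × ℕ) (s : CStore) : Prop :=
  s.out = o ∧ s.ctl.ctx = t.1 ∧ s.reg .idx = t.2.1 ∧ s.reg .cnt = t.2.2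

theorem eval_checkBody (o : List Sym) (t : Ctx × ℕ × ℕ) (a : Sym) (s : CStore)
    (h : CheckRel o t s) (ha : s.ctl.cur = some a) :
    CheckRel o (checkStep t a) (Prog.eval x checkBody s) := by
  obtain ⟨h1, h2, h3, h4⟩ := h
  by_cases hk : a.isKind = true <;> by_cases ht : a.isTick = true <;>
    by_cases hc : (ctxStep t.1 a).isChild = true <;>
    simp [checkBody, CheckRel, Prog.eval, ha, h1, h2, h3, h4, hk, ht, hc, Store.inc, checkStep] <;>
    split <;> simp_all <;> omega

theorem eval_check (s : CStore) (o : List Sym) (t : Ctx × ℕ × ℕ) (h : CheckRel o t s) :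
    CheckRel o (x.foldl checkStep t) (Prog.eval x (letters checkBody) s) := by
  refine eval_letters x checkBody rfl checkStep (CheckRel o) (fun _ _ _ h => h) ?_
    (fun t a s h ha => eval_checkBody x o t a s h ha) t s h
  intro t s v h
  simpa [CheckRel] using h

/-! ### Checking that there is only one sink -/

/-- Look for the child `k`; we store whether we are inside the number of a child, the number of
ticks read since the last other letter, and whether we have found the child. -/
def sinkStep (k : ℕ) (t : Bool × ℕ × Bool) (a : Sym) : Bool × ℕ × Bool :=
  if a.isTick then (t.1, t.2.1 + 1, t.2.2) else (a.isOpen, 0, t.2.2 || (t.1 && t.2.1 == k))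

/-- Has the child `k` been found, if nothing more is to be read? -/
def sinkFound (k : ℕ) (t : Bool × ℕ × Bool) : Bool := t.2.2 || (t.1 && t.2.1 == k)

theorem foldl_sinkStep_tick (k j : ℕ) (b : Bool) (c : ℕ) (f : Bool) :
    (List.replicate j Sym.tick).foldl (sinkStep k) (b, c, f) = (b, c + j, f) := by
  induction j generalizing c with
  | zero => rfl
  | succ j ih =>
    rw [List.replicate_succ, List.foldl_cons]
    simp only [sinkStep, Sym.isTick, if_true]
    rw [ih]
    congr 2
    omega

/-- A child's number is known only when the next letter other than a tick arrives; `sinkFound`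
therefore also counts a pending match. -/
theorem sinkFound_encode (k : ℕ) (g : Gate) (t : Bool × ℕ × Bool) :
    sinkFound k (g.encode.foldl (sinkStep k) t) = (sinkFound k t || decide (k ∈ g.children)) := by
  obtain ⟨b, c, f⟩ := t
  cases g <;>
    simp [Gate.encode, sinkStep, Sym.isTick, Sym.isOpen, foldl_sinkStep_tick, sinkFound,
      Gate.children, Bool.or_assoc, eq_comm, Bool.beq_eq_decide_eq]

theorem sinkFound_gates (k : ℕ) (gs : List Gate) (t : Bool × ℕ × Bool) :
    sinkFound k ((gs.flatMap Gate.encode).foldl (sinkStep k) t) = true ↔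
      sinkFound k t = true ∨ ∃ g ∈ gs, k ∈ g.children := by
  induction gs generalizing t with
  | nil => simp
  | cons g gs ih =>
    rw [List.flatMap_cons, List.foldl_append, ih, sinkFound_encode]
    simp [or_assoc]

/-- Applied to the monomial behind the circuit: its letters only settle a pending match. -/
theorem sinkFound_of_not_open (k : ℕ) (l : List Sym)
    (hl : ∀ a ∈ l, a.isTick = false ∧ a.isOpen = false) (t : Bool × ℕ × Bool) :
    sinkFound k (l.foldl (sinkStep k) t) = sinkFound k t := by
  induction l generalizing t with
  | nil => rfl
  | cons a l ih =>
    have ha := hl a (by simp)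
    rw [List.foldl_cons, ih fun b hb => hl b (by simp [hb])]
    simp [sinkStep, sinkFound, ha.1, ha.2]

theorem mem_encodeMonomial {e : List ℕ} {a : Sym} (h : a ∈ encodeMonomial e) :
    a = .pow ∨ ∃ b, a = .bit b := by
  simp only [encodeMonomial, List.mem_flatMap, List.mem_cons, List.mem_map] at h
  obtain ⟨_, _, h | ⟨b, _, rfl⟩⟩ := h
  · exact .inl h
  · exact .inr ⟨b, rfl⟩

/-- The program for one letter. -/
def sinkBody : CProg :=
  .ite (fun f => f.cur.any Sym.isTick) (.inc .cnt)
    (block [.ite (fun f => f.inC) (ifEq .cnt .k (.upd fun f => { f with flag := true }) skip) skip,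
      .upd fun f => { f with inC := f.cur.any Sym.isOpen }, .clear .cnt])

/-- The program for the end of the input. -/
def sinkEnd : CProg :=
  .ite (fun f => f.inC) (ifEq .cnt .k (.upd fun f => { f with flag := true }) skip) skip

/-- Is the gate `k` used? -/
def sinkProg : CProg :=
  block [.upd fun f => { f with flag := false, inC := false }, .clear .cnt, letters sinkBody,
    sinkEnd]

/-- The store agrees with the state of the search for a child. -/
def SinkRel (o : List Sym) (c : Ctx) (k : ℕ) (t : Bool × ℕ × Bool) (s : CStore) : Prop :=
  s.out = o ∧ s.ctl.ctx = c ∧ s.reg .k = k ∧ s.ctl.inC = t.1 ∧ s.reg .cnt = t.2.1 ∧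
    s.ctl.flag = t.2.2

theorem eval_sinkProg (s : CStore) :
    (Prog.eval x sinkProg s).out = s.out ∧ (Prog.eval x sinkProg s).ctl.ctx = s.ctl.ctx ∧
      (Prog.eval x sinkProg s).ctl.flag =
        sinkFound (s.reg .k) (x.foldl (sinkStep (s.reg .k)) (false, 0, false)) := by
  have key := eval_letters x sinkBody rfl (sinkStep (s.reg .k))
    (SinkRel s.out s.ctl.ctx (s.reg .k)) (fun _ _ _ h => h)
    (fun t s v h => by simpa [SinkRel] using h)
    (by
      rintro ⟨b, c, f⟩ a s' ⟨h1, h2, h3, h4, h5, h6⟩ ha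
      simp only at h4 h5 h6
      rcases ht : a.isTick
      · cases b
        · simp [sinkBody, Prog.eval, ha, ht, h4, SinkRel, sinkStep, h1, h2, h3, h6]
        · by_cases hck : c = s.reg .k <;>
            simp [sinkBody, Prog.eval, ha, ht, h4, SinkRel, sinkStep, h1, h2, h3, h6, h5, hck]
      · simp [sinkBody, Prog.eval, ha, ht, h4, SinkRel, sinkStep, h1, h2, h3, h6, h5, Store.inc])
    (false, 0, false)
    { s with ctl := { s.ctl with flag := false, inC := false },
             reg := Function.update s.reg .cnt 0 } (by simp [SinkRel])
  have hend : ∀ (t : Bool × ℕ × Bool) (s' : CStore),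
      SinkRel s.out s.ctl.ctx (s.reg .k) t s' →
      (Prog.eval x sinkEnd s').out = s.out ∧ (Prog.eval x sinkEnd s').ctl.ctx = s.ctl.ctx ∧
        (Prog.eval x sinkEnd s').ctl.flag = sinkFound (s.reg .k) t := by
    rintro ⟨b, c, f⟩ s' ⟨h1, h2, h3, h4, h5, h6⟩
    simp only at h4 h5 h6
    cases b
    · simp [sinkEnd, Prog.eval, h4, h1, h2, h6, sinkFound]
    · by_cases hck : c = s.reg .k <;>
        simp [sinkEnd, h4, h1, h2, h3, h5, h6, sinkFound, hck, Prog.eval]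
  exact hend _ _ key

/-- The body of the loop that checks that there is only one sink. -/
def oneSinkBody : CProg :=
  block [.copy .k1 .k, .inc .k1, ifLt .k1 .idx
    (block [sinkProg, .ite (fun f => f.flag) skip (.upd fun f => { f with ctx := .err })]) skip]

theorem eval_oneSinkBody (s : CStore) :
    (Prog.eval x oneSinkBody s).out = s.out ∧
      ((s.reg .k + 1 < s.reg .idx →
          sinkFound (s.reg .k) (x.foldl (sinkStep (s.reg .k)) (false, 0, false)) = true) →
        (Prog.eval x oneSinkBody s).ctl.ctx = s.ctl.ctx) ∧
      (¬ (s.reg .k + 1 < s.reg .idx →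
          sinkFound (s.reg .k) (x.foldl (sinkStep (s.reg .k)) (false, 0, false)) = true) →
        (Prog.eval x oneSinkBody s).ctl.ctx = .err) := by
  set s₁ : CStore := ⟨s.ctl, Function.update s.reg .k1 (s.reg .k + 1), s.out⟩ with hs₁
  have he : Prog.eval x oneSinkBody s =
      if s.reg .k + 1 < s.reg .idx then
        if (Prog.eval x sinkProg s₁).ctl.flag = true then Prog.eval x sinkProg s₁
        else { Prog.eval x sinkProg s₁ with
          ctl := { (Prog.eval x sinkProg s₁).ctl with ctx := .err } }
      else s₁ := by
    simp [oneSinkBody, Prog.eval, Store.inc, hs₁]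
  obtain ⟨e1, e2, e3⟩ := eval_sinkProg x s₁
  have hk : s₁.reg .k = s.reg .k := by simp [hs₁]
  rw [hk] at e3
  rw [he, ← e3]
  by_cases hlt : s.reg .k + 1 < s.reg .idx
  · by_cases hf : (Prog.eval x sinkProg s₁).ctl.flag = true
    · rw [if_pos hlt, if_pos hf]
      exact ⟨e1, fun _ => e2, fun h => absurd (fun _ => hf) h⟩
    · rw [if_pos hlt, if_neg hf]
      exact ⟨e1, fun h => absurd (h hlt) hf, fun _ => rfl⟩
  · rw [if_neg hlt]
    exact ⟨rfl, fun _ => rfl, fun h => absurd (fun h' => absurd h' hlt) h⟩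

/-- The program that checks that there is only one sink. -/
def oneSinkProg : CProg := .forN 0 .k oneSinkBody

theorem eval_oneSinkProg (s : CStore) :
    (Prog.eval x oneSinkProg s).out = s.out ∧
      ((∀ k < x.length, k + 1 < s.reg .idx →
          sinkFound k (x.foldl (sinkStep k) (false, 0, false)) = true) →
        (Prog.eval x oneSinkProg s).ctl.ctx = s.ctl.ctx) ∧
      (¬ (∀ k < x.length, k + 1 < s.reg .idx →
          sinkFound k (x.foldl (sinkStep k) (false, 0, false)) = true) →
        (Prog.eval x oneSinkProg s).ctl.ctx = .err) := by
  obtain ⟨good, hgood⟩ : ∃ good : ℕ → Prop, good = fun k => k + 1 < s.reg .idx →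
      sinkFound k (x.foldl (sinkStep k) (false, 0, false)) = true := ⟨_, rfl⟩
  have key := eval_forN_inv x 0 .k oneSinkBody
    (fun m s' => s'.out = s.out ∧ s'.reg .k = m ∧ s'.reg .idx = s.reg .idx ∧
      ((∀ k < m, good k) → s'.ctl.ctx = s.ctl.ctx) ∧ (¬ (∀ k < m, good k) → s'.ctl.ctx = .err)) s
    (by simp) (by
      rintro m _ s' ⟨h1, h2, h3, h4, h5⟩
      obtain ⟨e1, e2, e3⟩ := eval_oneSinkBody x s'
      have ek := Prog.eval_reg_of_not_writes x .k oneSinkBody rfl s'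
      have ei := Prog.eval_reg_of_not_writes x .idx oneSinkBody rfl s'
      rw [h2, h3] at e2 e3
      have hm : (m + 1 < s.reg .idx →
        sinkFound m (x.foldl (sinkStep m) (false, 0, false)) = true) ↔ good m := by rw [hgood]
      rw [hm] at e2 e3
      refine ⟨e1.trans h1, by simp [Store.inc, ek, h2], by simp [Store.inc, ei, h3],
        fun h => (e2 (h m (by omega))).trans (h4 fun k hk => h k (by omega)), fun h => ?_⟩
      by_cases hg : good m
      · refine (e2 hg).trans (h5 fun h' => h fun k hk => ?_)
        rcases Nat.lt_succ_iff_lt_or_eq.1 hk with hk | rfl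
        · exact h' k hk
        · exact hg
      · exact e3 hg)
  rw [hgood] at key
  exact ⟨key.1, key.2.2.2.1, key.2.2.2.2⟩

/-- The program that checks whether the input is the encoding of a circuit, possibly followed by
a monomial. -/
def checkProg : CProg := .seq (letters checkBody) oneSinkProg

/-- The initial control store. -/
def Ctl.init : Ctl := ⟨none, .start, false, false⟩

theorem encode_ne_nil (g : Gate) : 1 ≤ g.encode.length := by
  cases g <;> simp [Gate.encode]

theorem length_le_length_encode (gs : List Gate) :
    gs.length ≤ (gs.flatMap Gate.encode).length := by
  induction gs with
  | nil => simp
  | cons g gs ih =>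
    have := encode_ne_nil g
    simp only [List.flatMap_cons, List.length_append, List.length_cons]
    omega

/-- The one-pass check settles syntax and acyclicity. That each gate but the last is used takes one
further pass per gate. -/
theorem eval_checkProg :
    (Prog.eval x checkProg (Store.init Ctl.init)).out = [] ∧
      ((Prog.eval x checkProg (Store.init Ctl.init)).ctl.ctx.isInstance = true ↔
        ∃ (C : Circuit) (e : List ℕ), x = C.encode ++ encodeMonomial e) ∧
      ((Prog.eval x checkProg (Store.init Ctl.init)).ctl.ctx.isCircuit = true ↔
        ∃ C : Circuit, x = C.encode) := by
  have h0 : CheckRel [] (.start, 0, 0) (Store.init Ctl.init : CStore) := ⟨rfl, rfl, rfl, rfl⟩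
  obtain ⟨h1, h2, h3, -⟩ := eval_check x _ _ _ h0
  obtain ⟨e1, e2, e3⟩ := eval_oneSinkProg x (Prog.eval x (letters checkBody) (Store.init Ctl.init))
  have hs : Prog.eval x checkProg (Store.init Ctl.init) =
    Prog.eval x oneSinkProg (Prog.eval x (letters checkBody) (Store.init Ctl.init)) := rfl
  rw [hs]
  generalize Prog.eval x (letters checkBody) (Store.init Ctl.init) = s at *
  have himp : ∀ c : Ctx, c.isCircuit = true → c.isInstance = true := by
    intro c hc
    cases c <;> simp_all [Ctx.isCircuit, Ctx.isInstance]
  have hsound : (Prog.eval x oneSinkProg s).ctl.ctx.isInstance = true →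
      ∃ (C : Circuit) (e : List ℕ), x = C.encode ++ encodeMonomial e ∧
        ((Prog.eval x oneSinkProg s).ctl.ctx.isCircuit = true → e = []) := by
    intro h
    by_cases hall : ∀ k < x.length, k + 1 < s.reg .idx →
        sinkFound k (x.foldl (sinkStep k) (false, 0, false)) = true
    · rw [e2 hall, h2] at h ⊢
      obtain ⟨gs, e, ha, hne, hw, he⟩ := exists_of_isInstance h
      refine ⟨⟨gs, hne, ha, fun i hi => ?_⟩, e, hw, he⟩
      have hidx : s.reg .idx = gs.length := by
        obtain ⟨ctx, cnt, hf, -, hc⟩ := foldl_checkStep_gates ha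
        obtain ⟨ctx', cnt', hf', -⟩ := foldl_checkStep_monomial e ctx gs.length cnt
          (himp _ (hc hne))
        rw [h3, hw, List.foldl_append, hf, hf']
      -- Every gate takes at least one letter, so the loop over `k < x.length` reaches all gates.
      have hlen := length_le_length_encode gs
      have hf := hall i (by rw [hw, List.length_append]; omega) (by omega)
      rw [hw, List.foldl_append, sinkFound_of_not_open, sinkFound_gates] at hf
      · rcases hf with hf | hf
        · simp [sinkFound] at hf
        · exact hf
      · intro a ha
        rcases mem_encodeMonomial ha with rfl | ⟨b, rfl⟩ <;> exact ⟨rfl, rfl⟩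
    · rw [e3 hall] at h
      simp [Ctx.isInstance] at h
  have hcomplete : ∀ (C : Circuit) (e : List ℕ), x = C.encode ++ encodeMonomial e →
      (Prog.eval x oneSinkProg s).ctl.ctx.isInstance = true ∧
        (e = [] → (Prog.eval x oneSinkProg s).ctl.ctx.isCircuit = true) := by
    intro C e hx
    obtain ⟨ctx, cnt, hf, -, hc⟩ := foldl_checkStep_gates C.acyclic
    have hc := hc C.nonempty
    obtain ⟨ctx', cnt', hf', hc', he'⟩ := foldl_checkStep_monomial e ctx C.gates.length cnt
      (himp _ hc)
    have hfold : x.foldl checkStep (.start, 0, 0) = (ctx', C.gates.length, cnt') := by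
      rw [hx, List.foldl_append, Circuit.encode, hf, hf']
    rw [hfold] at h2 h3
    have hall : ∀ k < x.length, k + 1 < s.reg .idx →
        sinkFound k (x.foldl (sinkStep k) (false, 0, false)) = true := by
      intro k _ hk
      rw [h3] at hk
      rw [hx, List.foldl_append, sinkFound_of_not_open, Circuit.encode, sinkFound_gates]
      · exact .inr (C.oneSink k hk)
      · intro a ha
        rcases mem_encodeMonomial ha with rfl | ⟨b, rfl⟩ <;> exact ⟨rfl, rfl⟩
    rw [e2 hall, h2]
    exact ⟨hc', fun h => by rw [he' h]; exact hc⟩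
  refine ⟨by rw [e1, h1], ⟨fun h => ?_, fun ⟨C, e, hx⟩ => (hcomplete C e hx).1⟩,
    ⟨fun h => ?_, fun ⟨C, hx⟩ => ?_⟩⟩
  · obtain ⟨C, e, hx, -⟩ := hsound h
    exact ⟨C, e, hx⟩
  · obtain ⟨C, e, hx, he⟩ := hsound (himp _ h)
    refine ⟨C, ?_⟩
    rw [hx, he h]
    simp [encodeMonomial]
  · exact (hcomplete C [] (by rw [hx]; simp [encodeMonomial])).2 rfl

end Arith

/-! ### Writing gates and copies of the input circuit -/

namespace Arith

open Logspace

variable (x : List Sym)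

/-! ### Programs that emit gates -/

/-- The output consists of the given gates. -/
def Out (G : List Gate) (s : CStore) : Prop :=
  s.out = G.flatMap Gate.encode ∧ s.reg .pos = G.length ∧ s.reg .last = G.length - 1

/-- The store after one more gate has been written. -/
def emitGate (g : Gate) (s : CStore) : CStore :=
  ⟨s.ctl, Function.update (Function.update s.reg .last (s.reg .pos)) .pos (s.reg .pos + 1),
    s.out ++ g.encode⟩

theorem Out.emitGate {G : List Gate} {s : CStore} (h : Out G s) (g : Gate) :
    Out (G ++ [g]) (emitGate g s) := by
  simp [Out, Arith.emitGate, h.1, h.2.1]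

theorem Out.congr {G : List Gate} {s s' : CStore} (h : Out G s) (ho : s'.out = s.out)
    (hp : s'.reg .pos = s.reg .pos) (hl : s'.reg .last = s.reg .last) : Out G s' := by
  rwa [Out, ho, hp, hl]

@[simp]
theorem emitGate_pos (g : Gate) (s : CStore) : (emitGate g s).reg .pos = s.reg .pos + 1 := by
  simp [emitGate]

@[simp]
theorem emitGate_last (g : Gate) (s : CStore) : (emitGate g s).reg .last = s.reg .pos := by
  simp [emitGate]

theorem emitGate_reg (g : Gate) (s : CStore) {r : Reg} (hp : r ≠ .pos) (hl : r ≠ .last) :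
    (emitGate g s).reg r = s.reg r := by
  simp [emitGate, hp, hl]

/-- Count a gate. -/
def bump : CProg := block [.copy .last .pos, .inc .pos]

/-- Write an input gate with the constant `-1`. -/
def gateNegOne : CProg := block [.emit .negOne, bump]

/-- Write an input gate with the variable whose index is in the register. -/
def gateVar (r : Reg) : CProg := block [.emit .var, .emitN r .tick, bump]

/-- Write an addition gate with the children in the registers. -/
def gateAdd (r r' : Reg) : CProg :=
  block [.emit .add, .emitN r .tick, .emit .sep, .emitN r' .tick, bump]

/-- Write a multiplication gate with the children in the registers. -/
def gateMul (r r' : Reg) : CProg :=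
  block [.emit .mul, .emitN r .tick, .emit .sep, .emitN r' .tick, bump]

@[simp]
theorem eval_gateNegOne (s : CStore) : Prog.eval x gateNegOne s = emitGate .negOne s := by
  simp [gateNegOne, bump, Prog.eval, emitGate, Gate.encode, Store.inc]

@[simp]
theorem eval_gateVar (r : Reg) (s : CStore) :
    Prog.eval x (gateVar r) s = emitGate (.var (s.reg r)) s := by
  simp [gateVar, bump, Prog.eval, emitGate, Gate.encode, Store.inc]

@[simp]
theorem eval_gateAdd (r r' : Reg) (s : CStore) :
    Prog.eval x (gateAdd r r') s = emitGate (.add (s.reg r) (s.reg r')) s := by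
  simp [gateAdd, bump, Prog.eval, emitGate, Gate.encode, Store.inc]

@[simp]
theorem eval_gateMul (r r' : Reg) (s : CStore) :
    Prog.eval x (gateMul r r') s = emitGate (.mul (s.reg r) (s.reg r')) s := by
  simp [gateMul, bump, Prog.eval, emitGate, Gate.encode, Store.inc]

/-- The registers that hold constants. -/
def Consts (s : CStore) : Prop := s.reg .c0 = 0 ∧ s.reg .c1 = 1 ∧ s.reg .c2 = 2

/-- Initialize the constants. -/
def initProg : CProg :=
  block [.clear .c0, .clear .c1, .inc .c1, .clear .c2, .inc .c2, .inc .c2, .clear .pos,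
    gateNegOne, gateMul .c0 .c0, gateAdd .c0 .c1]

theorem eval_initProg (s : CStore) (h : s.out = []) :
    Out [.negOne, .mul 0 0, .add 0 1] (Prog.eval x initProg s) ∧
      Consts (Prog.eval x initProg s) := by
  simp [initProg, Prog.eval, Store.inc, Out, Consts, emitGate, h, Gate.encode]

/-! ### Copying the circuit -/

/-- The body of the loop that copies a circuit. -/
def copyBody : CProg :=
  .ite (fun f => f.cur.any Sym.isKind)
    (block [.ite (fun f => f.cur.any fun a => a matches .negOne) (.emit .negOne)
      (.ite (fun f => f.cur.any fun a => a matches .var)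
        (block [.emit .mul, .emit .tick, .emit .sep, .emitN .vb .tick])
        (block [.ite (fun f => f.cur.any fun a => a matches .add) (.emit .add) (.emit .mul),
          .emitN .sh .tick])),
      .upd fun f => { f with flag := f.cur.any fun a => a matches .var }, bump])
    (.ite (fun f => f.cur.any Sym.isTick)
      (.ite (fun f => f.flag) (.emitN .vs .tick) (.emit .tick))
      (.ite (fun f => f.cur.any fun a => a matches .sep)
        (block [.emit .sep, .emitN .sh .tick]) skip))

/-- Write a copy of the circuit on the input tape. -/
def copyProg : CProg := letters copyBody

/-- What is written for one letter; besides the output we store the number of gates and whether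
we are inside the index of a variable. -/
def copyStep (vb vs sh : ℕ) (t : List Sym × ℕ × Bool) : Sym → List Sym × ℕ × Bool
  | .negOne => (t.1 ++ [.negOne], t.2.1 + 1, false)
  | .var => (t.1 ++ .mul :: .tick :: .sep :: List.replicate vb .tick, t.2.1 + 1, true)
  | .add => (t.1 ++ .add :: List.replicate sh .tick, t.2.1 + 1, false)
  | .mul => (t.1 ++ .mul :: List.replicate sh .tick, t.2.1 + 1, false)
  | .tick => (t.1 ++ List.replicate (if t.2.2 then vs else 1) .tick, t.2)
  | .sep => (t.1 ++ .sep :: List.replicate sh .tick, t.2)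
  | _ => t

theorem foldl_copyStep_tick (vb vs sh j : ℕ) (o : List Sym) (c : ℕ) (b : Bool) :
    (List.replicate j Sym.tick).foldl (copyStep vb vs sh) (o, c, b) =
      (o ++ List.replicate (j * if b then vs else 1) .tick, c, b) := by
  induction j generalizing o with
  | zero => simp
  | succ j ih =>
    rw [List.replicate_succ, List.foldl_cons, copyStep, ih, List.append_assoc,
      List.replicate_append_replicate]
    congr 3
    ring

/-- Unary numbers allow the copy to be made letter by letter: a shift is a block of ticks in front,
and `j * vs` arises by writing `vs` ticks for each tick of `j`. -/
theorem foldl_copyStep_encode (vb vs sh : ℕ) (g : Gate) (o : List Sym) (c : ℕ) (b : Bool) :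
    ∃ b', g.encode.foldl (copyStep vb vs sh) (o, c, b) =
      (o ++ (copyGate vb vs sh g).encode, c + 1, b') := by
  cases g with
  | negOne => exact ⟨false, rfl⟩
  | var j =>
    refine ⟨true, ?_⟩
    simp [Gate.encode, copyGate, copyStep, foldl_copyStep_tick]
  | add u v =>
    refine ⟨false, ?_⟩
    simp [Gate.encode, copyGate, copyStep, foldl_copyStep_tick]
  | mul u v =>
    refine ⟨false, ?_⟩
    simp [Gate.encode, copyGate, copyStep, foldl_copyStep_tick]

theorem foldl_copyStep_gates (vb vs sh : ℕ) (gs : List Gate) (o : List Sym) (c : ℕ) (b : Bool) :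
    ∃ b', (gs.flatMap Gate.encode).foldl (copyStep vb vs sh) (o, c, b) =
      (o ++ (gs.map (copyGate vb vs sh)).flatMap Gate.encode, c + gs.length, b') := by
  induction gs generalizing o c b with
  | nil => exact ⟨b, by simp⟩
  | cons g gs ih =>
    obtain ⟨b', h⟩ := foldl_copyStep_encode vb vs sh g o c b
    obtain ⟨b'', h'⟩ := ih (o ++ (copyGate vb vs sh g).encode) (c + 1) b'
    refine ⟨b'', ?_⟩
    rw [List.flatMap_cons, List.foldl_append, h, h']
    simp
    omega

theorem foldl_eq_self {T : Type} (step : T → Sym → T) (l : List Sym)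
    (h : ∀ a ∈ l, ∀ t, step t a = t) (t : T) : l.foldl step t = t := by
  induction l generalizing t with
  | nil => rfl
  | cons a l ih =>
    rw [List.foldl_cons, h a (by simp), ih fun b hb => h b (by simp [hb])]

/-- The store agrees with a state of the copying process. -/
def CopyRel (vb vs sh : ℕ) (t : List Sym × ℕ × Bool) (s : CStore) : Prop :=
  s.out = t.1 ∧ s.reg .pos = t.2.1 ∧ s.reg .last = t.2.1 - 1 ∧ s.ctl.flag = t.2.2 ∧
    s.reg .vb = vb ∧ s.reg .vs = vs ∧ s.reg .sh = sh

theorem eval_copyProg {gs : List Gate} {e : List ℕ}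
    (hx : x = gs.flatMap Gate.encode ++ encodeMonomial e) {G : List Gate} {s : CStore}
    (h : Out G s) :
    Out (G ++ gs.map (copyGate (s.reg .vb) (s.reg .vs) (s.reg .sh))) (Prog.eval x copyProg s) := by
  have key := eval_letters x copyBody rfl (copyStep (s.reg .vb) (s.reg .vs) (s.reg .sh))
    (CopyRel (s.reg .vb) (s.reg .vs) (s.reg .sh)) (fun _ _ _ h => h)
    (fun t s v h => by simpa [CopyRel] using h)
    (by
      rintro ⟨o, c, b⟩ a s' ⟨h1, h2, h3, h4, h5, h6, h7⟩ ha
      simp only at h1 h2 h3 h4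
      cases a
      case tick =>
        cases b <;> simp [copyBody, Prog.eval, ha, Sym.isKind, Sym.isTick, CopyRel, copyStep, h1, h2,
          h3, h4, h5, h6, h7]
      all_goals
        simp [copyBody, Prog.eval, ha, Sym.isKind, Sym.isTick, CopyRel, copyStep, h1, h2, h3, h4, h5,
          h6, h7, bump, Store.inc])
    (G.flatMap Gate.encode, G.length, s.ctl.flag) s ⟨h.1, h.2.1, h.2.2, rfl, rfl, rfl, rfl⟩
  obtain ⟨b', hf⟩ := foldl_copyStep_gates (s.reg .vb) (s.reg .vs) (s.reg .sh) gs
    (G.flatMap Gate.encode) G.length s.ctl.flag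
  have hfold : x.foldl (copyStep (s.reg .vb) (s.reg .vs) (s.reg .sh))
      (G.flatMap Gate.encode, G.length, s.ctl.flag) = (G.flatMap Gate.encode ++
        (gs.map (copyGate (s.reg .vb) (s.reg .vs) (s.reg .sh))).flatMap Gate.encode,
        G.length + gs.length, b') := by
    conv_lhs => rw [hx]
    rw [List.foldl_append, hf, foldl_eq_self]
    intro a ha t
    rcases mem_encodeMonomial ha with rfl | ⟨b, rfl⟩ <;> rfl
  rw [hfold] at key
  obtain ⟨h1, h2, h3, -⟩ := key
  exact ⟨by rw [copyProg, h1, List.flatMap_append], by simpa [copyProg] using h2,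
    by simpa [copyProg] using h3⟩

/-! ### Making the output gate the only sink -/

/-- One step. -/
def absorbBody : CProg :=
  block [ifLt .k .T (block [gateMul .z .k, .copy .z .last]) skip, .inc .k]

/-- Make the gate in the register `acc` the only sink. -/
def finishProg : CProg :=
  block [.copy .T .pos, .copy .z .c2, .clear .k,
    .forN 2 .a1 (.forN 2 .a2 (.forN 2 .a3 (.forN 2 .a4 (.forN 2 .a5 absorbBody)))),
    gateAdd .acc .z]

/-- The store after `t` steps. -/
def AbsorbRel (G : List Gate) (acc : ℕ) (t : ℕ) (s : CStore) : Prop :=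
  Out (absorb G (min t G.length)).1 s ∧ s.reg .T = G.length ∧
    s.reg .z = (absorb G (min t G.length)).2 ∧ s.reg .k = t ∧ s.reg .acc = acc

/-- After `G.length` steps the body only counts, so surplus rounds do no harm; this is the minimum
in `AbsorbRel`. -/
theorem eval_absorbBody (G : List Gate) (acc : ℕ) (t : ℕ) (s : CStore) (h : AbsorbRel G acc t s) :
    AbsorbRel G acc (t + 1) (Prog.eval x absorbBody s) := by
  obtain ⟨h1, h2, h3, h4, h5⟩ := h
  by_cases hlt : t < G.length
  · have e : Prog.eval x absorbBody s = (⟨s.ctl, Function.update (Function.update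
        (emitGate (.mul (s.reg .z) t) s).reg .z (s.reg .pos)) .k (t + 1),
        (emitGate (.mul (s.reg .z) t) s).out⟩ : CStore) := by
      simp [absorbBody, h2, h4, hlt, Prog.eval, Store.inc, emitGate]
    rw [e]
    have m1 : min (t + 1) G.length = t + 1 := by omega
    have m2 : min t G.length = t := by omega
    rw [m2] at h1 h3
    have h6 := h1.emitGate (.mul (s.reg .z) t)
    rw [AbsorbRel, m1, absorb, ← h3]
    refine ⟨h6.congr rfl (by simp) (by simp), ?_, ?_, by simp, ?_⟩
    · simp [emitGate, h2]
    · simp [h1.2.1]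
    · simp [emitGate, h5]
  · have e : Prog.eval x absorbBody s = s.inc .k := by
      simp [absorbBody, h2, h4, hlt, Prog.eval]
    have m1 : min (t + 1) G.length = min t G.length := by omega
    rw [e, AbsorbRel, m1]
    exact ⟨h1.congr rfl (by simp [Store.inc]) (by simp [Store.inc]), by simp [Store.inc, h2],
      by simp [Store.inc, h3], by simp [Store.inc, h4], by simp [Store.inc, h5]⟩

/-- A loop makes only linearly many rounds, but one step per gate of `G` is needed; five nested
loops make `(x.length + 2) ^ 5` rounds. -/
theorem eval_finishProg {G : List Gate} {s : CStore} (h : Out G s) (hc : Consts s)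
    (hG : G.length ≤ (x.length + 2) ^ 5) :
    (Prog.eval x finishProg s).out = (finish G (s.reg .acc)).flatMap Gate.encode := by
  set acc := s.reg .acc with hacc
  have key : ∀ (r : Reg), r = .a1 ∨ r = .a2 ∨ r = .a3 ∨ r = .a4 ∨ r = .a5 → ∀ (m : ℕ) (P : CProg),
      (∀ t s, AbsorbRel G acc t s → AbsorbRel G acc (t + m) (Prog.eval x P s)) →
      ∀ t s, AbsorbRel G acc t s →
        AbsorbRel G acc (t + (x.length + 2) * m) (Prog.eval x (.forN 2 r P) s) := by
    intro r hr m P hP t s h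
    refine eval_forN_add x 2 r P (AbsorbRel G acc) m ?_ hP t s h
    rintro t s v ⟨h1, h2, h3, h4, h5⟩
    rcases hr with rfl | rfl | rfl | rfl | rfl <;>
      exact ⟨h1.congr rfl (by simp) (by simp), by simp [h2], by simp [h3], by simp [h4],
        by simp [h5]⟩
  have h5 := key .a1 (by simp) _ _ <| key .a2 (by simp) _ _ <| key .a3 (by simp) _ _ <|
    key .a4 (by simp) _ _ <| key .a5 (by simp) _ _ (eval_absorbBody x G acc)
  have h6 := h5 0 ⟨s.ctl, Function.update (Function.update (Function.update s.reg .T (s.reg .pos))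
    .z (s.reg .c2)) .k 0, s.out⟩
    ⟨h.congr rfl (by simp) (by simp), by simp [h.2.1], by simp [hc.2.2, absorb], by simp,
      by simp [hacc]⟩
  have hm : min (0 + (x.length + 2) * ((x.length + 2) * ((x.length + 2) * ((x.length + 2) *
      ((x.length + 2) * 1))))) G.length = G.length := by
    refine min_eq_right (hG.trans_eq ?_)
    ring
  rw [AbsorbRel, hm] at h6
  obtain ⟨g1, -, g3, -, g5⟩ := h6
  have := g1.emitGate (.add acc (absorb G G.length).2)
  rw [← g3, ← g5] at this
  simp only [finishProg, eval_block_cons, eval_block_nil, eval_gateAdd]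
  rw [finish, ← g3, ← g5]
  exact this.1

end Arith

/-! ### Writing the evaluation circuit -/

namespace Arith

open Logspace

variable (x : List Sym)

theorem Consts.congr {s s' : CStore} (h : Consts s) (h0 : s'.reg .c0 = s.reg .c0)
    (h1 : s'.reg .c1 = s.reg .c1) (h2 : s'.reg .c2 = s.reg .c2) : Consts s' := by
  rwa [Consts, h0, h1, h2]

theorem eval_consts {P : CProg} (h0 : P.writes .c0 = false) (h1 : P.writes .c1 = false)
    (h2 : P.writes .c2 = false) {s : CStore} (h : Consts s) : Consts (Prog.eval x P s) :=
  h.congr (Prog.eval_reg_of_not_writes x _ P h0 s) (Prog.eval_reg_of_not_writes x _ P h1 s)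
    (Prog.eval_reg_of_not_writes x _ P h2 s)

/-! ### The program for the evaluation of a circuit -/

/-- Write the square of the gate `K`. -/
def sqProg : CProg := block [gateMul .K .K, .copy .K .last]

/-- Write a sequence of repeated squares. -/
def powersProg : CProg :=
  block [gateAdd .c1 .c1, .copy .K .last, .forN 1 .a1 (.forN 1 .a2 sqProg)]

/-- The program that writes the circuit that evaluates the circuit on the input tape. -/
def evalProg : CProg :=
  block [initProg, powersProg, .len .vs, .inc .vs, .copy .vb .vs, .inc .vb, .inc .vb, .inc .vb,
    .copy .sh .pos, copyProg, .copy .acc .last, finishProg]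

theorem eval_powersProg (s : CStore) (h : Out [.negOne, .mul 0 0, .add 0 1] s) (hc : Consts s) :
    Out (powers ((x.length + 1) * (x.length + 1))).1 (Prog.eval x powersProg s) := by
  let Q (t : ℕ) (s : CStore) : Prop := Out (powers t).1 s ∧ s.reg .K = (powers t).2
  have hsq : ∀ t s, Q t s → Q (t + 1) (Prog.eval x sqProg s) := by
    rintro t s ⟨h1, h2⟩
    have h3 := h1.emitGate (.mul (s.reg .K) (s.reg .K))
    have e : powers (t + 1) = sqStep (powers t) := by
      rw [powers, Function.iterate_succ_apply', powers]
    simp only [Q, e, sqStep, ← h2, sqProg, eval_block_cons, eval_block_nil, eval_gateMul, Prog.eval]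
    exact ⟨h3.congr rfl (by simp) (by simp), by simp [h1.2.1]⟩
  have hQ : ∀ t s v, ∀ r, r = .a1 ∨ r = .a2 → Q t s →
      Q t { s with reg := Function.update s.reg r v } := by
    rintro t s v r hr ⟨h1, h2⟩
    rcases hr with rfl | rfl <;> exact ⟨h1.congr rfl (by simp) (by simp), by simp [h2]⟩
  -- Two nested loops of `x.length + 1` rounds make all `(x.length + 1) ^ 2` squarings.
  have h2 := eval_forN_add x 1 .a2 sqProg Q 1 (fun t s v => hQ t s v _ (.inr rfl)) hsq
  have h1 := eval_forN_add x 1 .a1 _ Q _ (fun t s v => hQ t s v _ (.inl rfl)) h2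
  have h3 := h.emitGate (.add 1 1)
  have h4 := h1 0 (Prog.eval x (block [gateAdd .c1 .c1, .copy .K .last]) s) (by
    simp only [eval_block_cons, eval_block_nil, eval_gateAdd, Prog.eval, hc.2.1]
    exact ⟨h3.congr rfl (by simp) (by simp), by simp [h.2.1, powers]⟩)
  have e : 0 + (x.length + ((1 : Fin 3) : ℕ)) * ((x.length + ((1 : Fin 3) : ℕ)) * 1) =
      (x.length + 1) * (x.length + 1) := by simp
  rw [e] at h4
  exact h4.1

theorem eval_evalProg {gs : List Gate} (hx : x = gs.flatMap Gate.encode) (s : CStore)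
    (hs : s.out = []) :
    (Prog.eval x evalProg s).out = (finish
      (evalGates ((x.length + 1) * (x.length + 1)) (x.length + 1) gs)
      ((evalGates ((x.length + 1) * (x.length + 1)) (x.length + 1) gs).length - 1)).flatMap
      Gate.encode := by
  obtain ⟨h1, h2⟩ := eval_initProg x s hs
  have h3 := eval_powersProg x _ h1 h2
  have h4 : Consts (Prog.eval x powersProg (Prog.eval x initProg s)) :=
    eval_consts x rfl rfl rfl h2
  set s₁ := Prog.eval x powersProg (Prog.eval x initProg s)
  set P : CProg := block [.len .vs, .inc .vs, .copy .vb .vs, .inc .vb, .inc .vb, .inc .vb,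
    .copy .sh .pos] with hP
  set s₂ := Prog.eval x P s₁ with hs₂
  have h5 : Out (powers ((x.length + 1) * (x.length + 1))).1 s₂ := h3.congr
    (by simp [hs₂, hP, Prog.eval, Store.inc]) (Prog.eval_reg_of_not_writes x _ P rfl s₁)
    (Prog.eval_reg_of_not_writes x _ P rfl s₁)
  have h6 : Consts s₂ := eval_consts x rfl rfl rfl h4
  have hvs : s₂.reg .vs = x.length + 1 := by simp [hs₂, hP, Prog.eval, Store.inc]
  have hvb : s₂.reg .vb = 3 + (x.length + 1) := by
    simp [hs₂, hP, Prog.eval, Store.inc]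
    omega
  have hsh : s₂.reg .sh = (powers ((x.length + 1) * (x.length + 1))).1.length := by
    rw [← h3.2.1]
    simp [hs₂, hP, Prog.eval, Store.inc]
  have h7 := eval_copyProg x (gs := gs) (e := []) (by simpa [encodeMonomial] using hx) h5
  rw [hvs, hvb, hsh] at h7
  have h8 : Consts (Prog.eval x copyProg s₂) := eval_consts x rfl rfl rfl h6
  set s₃ := Prog.eval x copyProg s₂
  set G := evalGates ((x.length + 1) * (x.length + 1)) (x.length + 1) gs with hG
  have h9 := eval_finishProg x (G := G) (s := ⟨s₃.ctl, Function.update s₃.reg .acc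
    (s₃.reg .last), s₃.out⟩) (h7.congr rfl (by simp) (by simp)) (h8.congr (by simp) (by simp)
    (by simp)) (by
      have hl := (powers_spec ((x.length + 1) * (x.length + 1))).2.1
      have hgs := length_le_length_encode gs
      rw [← hx] at hgs
      simp only [hG, evalGates, List.length_append, List.length_map, hl]
      generalize x.length = n at *
      nlinarith [Nat.zero_le (n ^ 2), Nat.zero_le (n ^ 3), Nat.zero_le (n ^ 4),
        Nat.zero_le (n ^ 5)])
  have hlast : s₃.reg .last = G.length - 1 := h7.2.2
  simp only [Function.update_self, hlast] at h9
  rw [← h9, ← hlast]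
  rfl

end Arith

/-! ### Writing a single evaluation of a test -/

namespace Arith

open Logspace

variable (x : List Sym)

/-! ### The program for testing a coefficient -/

/-- Count the binary digits in the input. -/
def countProg : CProg :=
  block [.clear .d, letters (.ite (fun f => f.cur.any Sym.isBit) (.inc .d) skip)]

theorem not_pow_bit_of_mem {gs : List Gate} {a : Sym} (h : a ∈ gs.flatMap Gate.encode) :
    a.isPow = false ∧ a.isBit = false := by
  obtain ⟨g, -, h⟩ := List.mem_flatMap.1 h
  cases g <;> simp only [Gate.encode, List.mem_cons, List.mem_append, List.mem_replicate,
    List.not_mem_nil, or_false] at h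
  · subst h; exact ⟨rfl, rfl⟩
  · rcases h with rfl | ⟨-, rfl⟩ <;> exact ⟨rfl, rfl⟩
  · rcases h with rfl | ⟨-, rfl⟩ | rfl | ⟨-, rfl⟩ <;> exact ⟨rfl, rfl⟩
  · rcases h with rfl | ⟨-, rfl⟩ | rfl | ⟨-, rfl⟩ <;> exact ⟨rfl, rfl⟩

theorem foldl_count_monomial (e : List ℕ) (c : ℕ) :
    (encodeMonomial e).foldl (fun c a => if a.isBit then c + 1 else c) c =
      c + (e.map Nat.size).sum := by
  induction e generalizing c with
  | nil => rfl
  | cons a e ih =>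
    have h : ∀ (l : List Bool) (c : ℕ),
        (l.map Sym.bit).foldl (fun c a => if a.isBit then c + 1 else c) c = c + l.length := by
      intro l
      induction l with
      | nil => simp
      | cons b l ih =>
        intro c
        rw [List.map_cons, List.foldl_cons, ih]
        simp [Sym.isBit]
        omega
    rw [encodeMonomial, List.flatMap_cons, List.foldl_append, List.foldl_cons, h]
    change (encodeMonomial e).foldl _ _ = _
    rw [ih, Nat.size_eq_bits_len]
    simp [Sym.isBit]
    omega

theorem eval_countProg {gs : List Gate} {e : List ℕ}
    (hx : x = gs.flatMap Gate.encode ++ encodeMonomial e) (s : CStore) :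
    (Prog.eval x countProg s).out = s.out ∧
      (Prog.eval x countProg s).reg .d = (e.map Nat.size).sum := by
  have key := eval_letters x (.ite (fun f => f.cur.any Sym.isBit) (.inc .d) skip) rfl
    (fun c a => if a.isBit then c + 1 else c) (fun c s' => s'.out = s.out ∧ s'.reg .d = c)
    (fun _ _ _ h => h) (fun t s v h => by simpa using h)
    (by
      rintro c a s' ⟨h1, h2⟩ ha
      cases hb : a.isBit <;> simp [Prog.eval, ha, hb, h1, h2, Store.inc])
    0 ⟨s.ctl, Function.update s.reg .d 0, s.out⟩ (by simp)
  have hfold : x.foldl (fun c a => if a.isBit then c + 1 else c) 0 = (e.map Nat.size).sum := by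
    conv_lhs => rw [hx]
    rw [List.foldl_append, foldl_eq_self _ (gs.flatMap Gate.encode), foldl_count_monomial, zero_add]
    intro a ha t
    simp [(not_pow_bit_of_mem ha).2]
  rw [hfold] at key
  exact key

/-- The program for one letter in the search for the exponent of the variable `X j`. -/
def suppBody : CProg :=
  .ite (fun f => f.cur.any Sym.isPow) (.inc .cnt)
    (.ite (fun f => f.cur.any Sym.isBit)
      (ifEq .cnt .j1 (.upd fun f => { f with flag := true }) skip) skip)

/-- Is the exponent of the variable `X j` positive? -/
def suppProg : CProg :=
  block [.copy .j1 .j, .inc .j1, .clear .cnt, .upd fun f => { f with flag := false },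
    letters suppBody]

/-- The search for the exponent of the variable `X j`. -/
def suppStep (j : ℕ) (t : ℕ × Bool) (a : Sym) : ℕ × Bool :=
  if a.isPow then (t.1 + 1, t.2) else (t.1, t.2 || (a.isBit && decide (t.1 = j + 1)))

theorem foldl_suppStep_bits (j : ℕ) (l : List Bool) (c : ℕ) (b : Bool) :
    (l.map Sym.bit).foldl (suppStep j) (c, b) = (c, b || decide (l ≠ [] ∧ c = j + 1)) := by
  induction l generalizing b with
  | nil => simp
  | cons b' l ih =>
    rw [List.map_cons, List.foldl_cons, suppStep]
    simp only [Sym.isPow, Sym.isBit, Bool.false_eq_true, if_false, Bool.true_and]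
    rw [ih]
    by_cases h : c = j + 1 <;> simp [h]

/-- The exponent of `X j` follows the `pow` number `j + 1`, and it is nonzero exactly if a digit
follows, since `0` has no digits. -/
theorem foldl_suppStep_monomial (j : ℕ) (e : List ℕ) (c : ℕ) (b : Bool) :
    ((encodeMonomial e).foldl (suppStep j) (c, b)).2 =
      (b || decide (c ≤ j ∧ e.getD (j - c) 0 ≠ 0)) := by
  induction e generalizing c b with
  | nil => simp [encodeMonomial]
  | cons a e ih =>
    have hbits : a.bits ≠ [] ↔ a ≠ 0 := by
      rw [ne_eq, ← List.length_eq_zero_iff, Nat.size_eq_bits_len, Nat.size_eq_zero]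
    rw [encodeMonomial, List.flatMap_cons, List.foldl_append, List.foldl_cons, suppStep]
    simp only [Sym.isPow, if_true]
    rw [foldl_suppStep_bits]
    change ((encodeMonomial e).foldl (suppStep j) _).2 = _
    rw [ih, Bool.or_assoc]
    congr 1
    rw [Bool.eq_iff_iff]
    simp only [Bool.or_eq_true, decide_eq_true_eq, hbits]
    rcases lt_trichotomy c j with h | rfl | h
    · obtain ⟨k, rfl⟩ : ∃ k, j = c + 1 + k := ⟨j - (c + 1), by omega⟩
      have e1 : c + 1 + k - c = k + 1 := by omega
      have e2 : c + 1 + k - (c + 1) = k := by omega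
      rw [e1, e2, List.getD_cons_succ]
      constructor
      · rintro (⟨-, h'⟩ | ⟨-, h'⟩)
        · omega
        · exact ⟨by omega, h'⟩
      · rintro ⟨-, h'⟩
        exact .inr ⟨by omega, h'⟩
    · simp
    · constructor
      · rintro (⟨-, h'⟩ | ⟨h', -⟩) <;> omega
      · rintro ⟨h', -⟩
        omega

theorem eval_suppProg {gs : List Gate} {e : List ℕ}
    (hx : x = gs.flatMap Gate.encode ++ encodeMonomial e) (s : CStore) :
    (Prog.eval x suppProg s).out = s.out ∧
      ((Prog.eval x suppProg s).ctl.flag = true ↔ e.getD (s.reg .j) 0 ≠ 0) := by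
  have key := eval_letters x suppBody rfl (suppStep (s.reg .j))
    (fun t s' => s'.out = s.out ∧ s'.reg .j1 = s.reg .j + 1 ∧ s'.reg .cnt = t.1 ∧
      s'.ctl.flag = t.2) (fun _ _ _ h => h) (fun t s v h => by simpa using h)
    (by
      rintro ⟨c, b⟩ a s' ⟨h1, h2, h3, h4⟩ ha
      simp only at h3 h4
      cases hp : a.isPow <;> cases hb : a.isBit <;> by_cases hc : c = s.reg .j + 1 <;>
        simp [suppBody, suppStep, Prog.eval, ha, hp, hb, h1, h2, h3, h4, hc, Store.inc])
    (0, false) ⟨{ s.ctl with flag := false }, Function.update (Function.update s.reg .j1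
      (s.reg .j + 1)) .cnt 0, s.out⟩ (by simp)
  have hfold : (x.foldl (suppStep (s.reg .j)) (0, false)).2 =
      decide (e.getD (s.reg .j) 0 ≠ 0) := by
    conv_lhs => rw [hx]
    rw [List.foldl_append, foldl_eq_self _ (gs.flatMap Gate.encode), foldl_suppStep_monomial]
    · simp
    · intro a ha t
      simp [suppStep, (not_pow_bit_of_mem ha).1, (not_pow_bit_of_mem ha).2]
  rw [hfold] at key
  have e1 : Prog.eval x suppProg s = Prog.eval x (letters suppBody)
      ⟨{ s.ctl with flag := false }, Function.update (Function.update s.reg .j1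
      (s.reg .j + 1)) .cnt 0, s.out⟩ := by
    simp [suppProg, Prog.eval, Store.inc]
  rw [e1]
  exact ⟨key.1, by rw [key.2.2.2, decide_eq_true_iff]⟩

/-- Choose the gate by which the variable `X j` is multiplied. -/
def factorProg : CProg :=
  ifEq .i .nn (block [suppProg, .ite (fun f => f.flag) (.copy .cc .J) (.copy .cc .c2)])
    (ifEq .j .i (.copy .cc .J) (.copy .cc .c1))

theorem eval_factorProg {gs : List Gate} {e : List ℕ}
    (hx : x = gs.flatMap Gate.encode ++ encodeMonomial e) (s : CStore) (hc : Consts s)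
    (hn : s.reg .nn = x.length) :
    (Prog.eval x factorProg s).out = s.out ∧ (Prog.eval x factorProg s).reg .cc =
      testFactor x.length e (s.reg .i) (s.reg .J) (s.reg .j) := by
  simp only [factorProg, eval_ifEq, hn, testFactor]
  by_cases hi : s.reg .i = x.length
  · rw [if_pos hi, if_pos hi]
    obtain ⟨h1, h2⟩ := eval_suppProg x hx s
    have h3 : (Prog.eval x suppProg s).reg .J = s.reg .J :=
      Prog.eval_reg_of_not_writes x _ _ rfl s
    have h4 : (Prog.eval x suppProg s).reg .c2 = 2 :=
      (Prog.eval_reg_of_not_writes x _ _ rfl s).trans hc.2.2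
    simp only [eval_block_cons, eval_block_nil, Prog.eval]
    by_cases hf : (Prog.eval x suppProg s).ctl.flag = true
    · rw [if_pos hf, if_pos (h2.1 hf)]
      exact ⟨h1, by simp [h3]⟩
    · rw [if_neg hf, if_neg (mt h2.2 hf)]
      exact ⟨h1, by simp [h4]⟩
  · rw [if_neg hi, if_neg hi]
    by_cases hj : s.reg .j = s.reg .i
    · rw [if_pos hj, if_pos hj]
      simp [Prog.eval]
    · rw [if_neg hj, if_neg hj]
      simp [Prog.eval, hc.2.1]

/-- Write the gate for one scaled variable. -/
def scaleBody : CProg := block [factorProg, gateMul .vj .cc, .inc .vj]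

/-- Write the gates for the scaled variables. -/
def scaleProg : CProg := block [.copy .vj .c2, .inc .vj, .forN 0 .j scaleBody]

theorem eval_scaleProg {gs : List Gate} {e : List ℕ}
    (hx : x = gs.flatMap Gate.encode ++ encodeMonomial e) (s : CStore) (hc : Consts s)
    (hn : s.reg .nn = x.length) {G : List Gate} (hG : Out G s) :
    Out (scaleGates x.length (testFactor x.length e (s.reg .i) (s.reg .J)) G)
      (Prog.eval x scaleProg s) := by
  have key := eval_forN_inv x 0 .j scaleBody
    (fun k s' => Out (scaleGates k (testFactor x.length e (s.reg .i) (s.reg .J)) G) s' ∧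
      Consts s' ∧ s'.reg .nn = x.length ∧ s'.reg .i = s.reg .i ∧ s'.reg .J = s.reg .J ∧
      s'.reg .vj = 3 + k ∧ s'.reg .j = k)
    ⟨s.ctl, Function.update s.reg .vj 3, s.out⟩
    ⟨by simpa [scaleGates, Out] using hG,
      hc.congr (by simp) (by simp) (by simp), by simp [hn], by simp, by simp, by simp, by simp⟩
    (by
      rintro k - s' ⟨h1, h2, h3, h4, h5, h6, h7⟩
      obtain ⟨g1, g2⟩ := eval_factorProg x hx s' h2 h3
      rw [h4, h5, h7] at g2
      have hw : ∀ r, factorProg.writes r = false →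
          (Prog.eval x factorProg s').reg r = s'.reg r :=
        fun r hr => Prog.eval_reg_of_not_writes x r factorProg hr s'
      have h8 : Out (scaleGates k (testFactor x.length e (s.reg .i) (s.reg .J)) G)
          (Prog.eval x factorProg s') := h1.congr g1 (hw _ rfl) (hw _ rfl)
      have h9 := h8.emitGate (.mul (3 + k) (testFactor x.length e (s.reg .i) (s.reg .J) k))
      have e1 : scaleGates (k + 1) (testFactor x.length e (s.reg .i) (s.reg .J)) G =
          scaleGates k (testFactor x.length e (s.reg .i) (s.reg .J)) G ++
            [.mul (3 + k) (testFactor x.length e (s.reg .i) (s.reg .J) k)] := by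
        simp [scaleGates, List.range_succ]
      have hc' : Consts (Prog.eval x factorProg s') := eval_consts x rfl rfl rfl h2
      have w1 := hw .vj rfl
      have w2 := hw .nn rfl
      have w3 := hw .i rfl
      have w4 := hw .J rfl
      have w5 := hw .j rfl
      rw [e1]
      simp only [scaleBody, eval_block_cons, eval_block_nil, eval_gateMul, Prog.eval, g2, w1, h6]
      generalize Prog.eval x factorProg s' = s₂ at *
      refine ⟨h9.congr rfl (by simp [Store.inc]) (by simp [Store.inc]), hc'.congr ?_ ?_ ?_,
        ?_, ?_, ?_, ?_, ?_⟩ <;> simp [Store.inc, emitGate, *]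
      omega)
  have e1 : Prog.eval x scaleProg s = Prog.eval x (.forN 0 .j scaleBody)
      ⟨s.ctl, Function.update s.reg .vj 3, s.out⟩ := by
    simp only [scaleProg, eval_block_cons, eval_block_nil]
    simp [Prog.eval, Store.inc, hc.2.2]
  rw [e1]
  exact key.1

/-- The store agrees with the state of a test. -/
def TestRel (i d : ℕ) (t : TestState) (s : CStore) : Prop :=
  Out t.gates s ∧ s.reg .J = t.J ∧ s.reg .K = t.K ∧ s.reg .A = t.A ∧ s.reg .P = t.P ∧
    Consts s ∧ s.reg .nn = x.length ∧ s.reg .i = i ∧ s.reg .d = d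

/-- Write the gates that update the weighted sum. -/
def weightProg : CProg :=
  block [.copy .O .last, gateMul .J .A, .copy .t1 .last, gateMul .P .O, gateAdd .t1 .last,
    .copy .A .last, gateMul .P .K, .copy .P .last, gateAdd .K .c1, .copy .K .last,
    gateAdd .J .c1, .copy .J .last]

theorem eval_weightProg (i d : ℕ) (t : TestState) (s : CStore) (h : TestRel x i d t s) :
    TestRel x i d (weightGates t) (Prog.eval x weightProg s) := by
  obtain ⟨⟨h1, h2, h3⟩, h4, h5, h6, h7, ⟨h8, h9, h10⟩, h11, h12, h13⟩ := h
  simp [TestRel, Out, Consts, weightGates, weightProg, Prog.eval, emitGate, *]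

/-- One more evaluation of the circuit. -/
def testBody : CProg :=
  block [.copy .vb .pos, scaleProg, .copy .sh .pos, .copy .vs .c1, copyProg, weightProg]

theorem eval_testBody {gs : List Gate} {e : List ℕ}
    (hx : x = gs.flatMap Gate.encode ++ encodeMonomial e) (i d : ℕ) (t : TestState) (s : CStore)
    (h : TestRel x i d t s) :
    TestRel x i d (testStep x.length gs (testFactor x.length e i) t)
      (Prog.eval x testBody s) := by
  obtain ⟨h1, h2, h3, h4, h5, h6, h7, h8, h9⟩ := h
  set s₁ : CStore := ⟨s.ctl, Function.update s.reg .vb (s.reg .pos), s.out⟩ with hs₁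
  have g1 := eval_scaleProg x hx s₁ (h6.congr (by simp [hs₁]) (by simp [hs₁]) (by simp [hs₁]))
    (by simp [hs₁, h7]) (h1.congr (by simp [hs₁]) (by simp [hs₁]) (by simp [hs₁]))
  have e1 : s₁.reg .i = i := by simp [hs₁, h8]
  have e2 : s₁.reg .J = t.J := by simp [hs₁, h2]
  rw [e1, e2] at g1
  have hw1 : ∀ r, (block [scaleProg] : CProg).writes r = false → r ≠ .vb →
      (Prog.eval x scaleProg s₁).reg r = s.reg r := fun r hr hv =>
    (Prog.eval_reg_of_not_writes x r (block [scaleProg]) hr s₁).trans (by simp [hs₁, hv])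
  have hvb : (Prog.eval x scaleProg s₁).reg .vb = t.gates.length := by
    rw [Prog.eval_reg_of_not_writes x .vb scaleProg rfl]
    simp [hs₁, h1.2.1]
  set s₂ := Prog.eval x scaleProg s₁ with hs₂
  set H := scaleGates x.length (testFactor x.length e i t.J) t.gates with hH
  set s₃ : CStore := ⟨s₂.ctl, Function.update (Function.update s₂.reg .sh (s₂.reg .pos)) .vs
    (s₂.reg .c1), s₂.out⟩ with hs₃
  have hs₃e : Prog.eval x (block [.copy .sh .pos, .copy .vs .c1]) s₂ = s₃ := by
    simp [Prog.eval, hs₃]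
  have g2 := eval_copyProg x hx (G := H) (s := s₃)
    (g1.congr (by simp [hs₃]) (by simp [hs₃]) (by simp [hs₃]))
  have e3 : s₃.reg .vb = t.gates.length := by simp [hs₃, hvb]
  have e4 : s₃.reg .vs = 1 := by simp [hs₃, hw1 .c1 rfl, h6.2.1]
  have e5 : s₃.reg .sh = H.length := by simp [hs₃, g1.2.1]
  rw [e3, e4, e5] at g2
  have hw2 : ∀ r, (block [scaleProg, copyProg] : CProg).writes r = false → r ≠ .vb → r ≠ .sh →
      r ≠ .vs → (Prog.eval x copyProg s₃).reg r = s.reg r := by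
    intro r hr hv hsh hvs
    simp only [block, Prog.writes, Bool.or_eq_false_iff] at hr
    rw [Prog.eval_reg_of_not_writes x r copyProg hr.2.1]
    simp only [hs₃, ne_eq, hsh, hvs, not_false_eq_true, Function.update_of_ne]
    rw [hs₂, Prog.eval_reg_of_not_writes x r scaleProg hr.1]
    simp [hs₁, hv]
  have e6 : Prog.eval x testBody s = Prog.eval x weightProg (Prog.eval x copyProg s₃) := by
    rw [← hs₃e, hs₂, hs₁]
    rfl
  rw [e6, testStep]
  refine eval_weightProg x i d _ _ ⟨g2, ?_, ?_, ?_, ?_, ⟨?_, ?_, ?_⟩, ?_, ?_, ?_⟩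
  · rw [hw2 _ rfl (by decide) (by decide) (by decide), h2]
  · rw [hw2 _ rfl (by decide) (by decide) (by decide), h3]
  · rw [hw2 _ rfl (by decide) (by decide) (by decide), h4]
  · rw [hw2 _ rfl (by decide) (by decide) (by decide), h5]
  · rw [hw2 _ rfl (by decide) (by decide) (by decide), h6.1]
  · rw [hw2 _ rfl (by decide) (by decide) (by decide), h6.2.1]
  · rw [hw2 _ rfl (by decide) (by decide) (by decide), h6.2.2]
  · rw [hw2 _ rfl (by decide) (by decide) (by decide), h7]
  · rw [hw2 _ rfl (by decide) (by decide) (by decide), h8]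
  · rw [hw2 _ rfl (by decide) (by decide) (by decide), h9]

end Arith

/-! ### Writing all tests, and correctness of both reductions -/

namespace Arith

open Logspace

variable (x : List Sym)

/-- Write the gates for the number `-d`. -/
def predProg : CProg :=
  block [.copy .K .c2,
    .forN 2 .tau (ifLt .tau .d (block [gateAdd .K .c0, .copy .K .last]) skip)]

/-- The degree is not a loop bound of the language, so a guard idles the rounds beyond it. -/
theorem eval_predProg (s : CStore) {G : List Gate} (h : Out G s) (hc : Consts s)
    (hd : s.reg .d ≤ x.length + 2) :
    Out (predStep^[s.reg .d] (G, 2)).1 (Prog.eval x predProg s) ∧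
      (Prog.eval x predProg s).reg .K = (predStep^[s.reg .d] (G, 2)).2 := by
  have key := eval_forN_inv x 2 .tau
    (ifLt .tau .d (block [gateAdd .K .c0, .copy .K .last]) skip)
    (fun k s' => Out (predStep^[min k (s.reg .d)] (G, 2)).1 s' ∧
      s'.reg .K = (predStep^[min k (s.reg .d)] (G, 2)).2 ∧ s'.reg .c0 = 0 ∧
      s'.reg .d = s.reg .d ∧ s'.reg .tau = k)
    ⟨s.ctl, Function.update s.reg .K 2, s.out⟩
    ⟨by simpa [Out] using h, by simp, by simp [hc.1], by simp, by simp⟩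
    (by
      rintro k - s' ⟨h1, h2, h3, h4, h5⟩
      by_cases hlt : k < s.reg .d
      · have m1 : min (k + 1) (s.reg .d) = k + 1 := by omega
        have m2 : min k (s.reg .d) = k := by omega
        rw [m2] at h1 h2
        have h6 := h1.emitGate (.add (s'.reg .K) 0)
        rw [m1, Function.iterate_succ_apply', predStep, ← h2]
        simp only [eval_ifLt, h5, h4, hlt, if_true, eval_block_cons, eval_block_nil, eval_gateAdd,
          h3, Prog.eval]
        refine ⟨h6.congr rfl (by simp [Store.inc]) (by simp [Store.inc]), ?_, ?_, ?_, ?_⟩ <;>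
          simp [Store.inc, emitGate, h1.2.1, h3, h4, h5]
      · have m1 : min (k + 1) (s.reg .d) = min k (s.reg .d) := by omega
        rw [m1]
        simp only [eval_ifLt, h5, h4, hlt, if_false, eval_skip]
        exact ⟨h1.congr rfl (by simp [Store.inc]) (by simp [Store.inc]), by simp [Store.inc, h2],
          by simp [Store.inc, h3], by simp [Store.inc, h4], by simp [Store.inc, h5]⟩)
  have hm : min (x.length + ((2 : Fin 3) : ℕ)) (s.reg .d) = s.reg .d := min_eq_right hd
  rw [hm] at key
  have e1 : Prog.eval x predProg s = Prog.eval x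
      (.forN 2 .tau (ifLt .tau .d (block [gateAdd .K .c0, .copy .K .last]) skip))
      ⟨s.ctl, Function.update s.reg .K 2, s.out⟩ := by
    simp only [predProg, eval_block_cons, eval_block_nil]
    simp only [Prog.eval, hc.2.2]
  rw [e1]
  exact ⟨key.1, key.2.1⟩

/-- The evaluations of one test. -/
def testLoop : CProg := .forN 2 .tau (ifLt .d .tau skip testBody)

theorem eval_testLoop {gs : List Gate} {e : List ℕ}
    (hx : x = gs.flatMap Gate.encode ++ encodeMonomial e) (i d : ℕ) (t : TestState) (s : CStore)
    (h : TestRel x i d t s) (hd : d + 1 ≤ x.length + 2) :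
    TestRel x i d ((testStep x.length gs (testFactor x.length e i))^[d + 1] t)
      (Prog.eval x testLoop s) := by
  have hreg : ∀ t s v, TestRel x i d t s →
      TestRel x i d t ⟨s.ctl, Function.update s.reg .tau v, s.out⟩ := by
    rintro t s v ⟨h1, h2, h3, h4, h5, h6, h7, h8, h9⟩
    exact ⟨by simpa [Out] using h1, by simp [h2], by simp [h3], by simp [h4], by simp [h5],
      by simpa [Consts] using h6, by simp [h7], by simp [h8], by simp [h9]⟩
  have key := eval_forN_inv x 2 .tau (ifLt .d .tau skip testBody)
    (fun k s' => TestRel x i d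
      ((testStep x.length gs (testFactor x.length e i))^[min k (d + 1)] t) s' ∧ s'.reg .tau = k) s
    ⟨hreg _ _ _ h, by simp⟩ (by
      rintro k - s' ⟨h1, h2⟩
      have h3 : s'.reg .d = d := h1.2.2.2.2.2.2.2.2
      simp only [eval_ifLt, h2, h3]
      by_cases hlt : d < k
      · have m1 : min (k + 1) (d + 1) = min k (d + 1) := by omega
        rw [if_pos hlt, m1]
        exact ⟨hreg _ _ _ h1, by simp [Store.inc, h2]⟩
      · have m1 : min (k + 1) (d + 1) = k + 1 := by omega
        have m2 : min k (d + 1) = k := by omega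
        rw [m2] at h1
        rw [if_neg hlt, m1, Function.iterate_succ_apply']
        refine ⟨hreg _ _ _ (eval_testBody x hx i d _ s' h1), ?_⟩
        simp [Store.inc, Prog.eval_reg_of_not_writes x .tau testBody rfl, h2])
  have hm : min (x.length + ((2 : Fin 3) : ℕ)) (d + 1) = d + 1 := min_eq_right hd
  rw [hm] at key
  exact key.1

/-- Store the number of variables, and the degree of the polynomial that is tested. -/
def degreeProg : CProg := block [.len .nn, ifEq .i .nn countProg (.copy .d .c2)]

theorem eval_degreeProg {gs : List Gate} {e : List ℕ}
    (hx : x = gs.flatMap Gate.encode ++ encodeMonomial e) (s : CStore) (hc : Consts s) :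
    (Prog.eval x degreeProg s).out = s.out ∧
      (Prog.eval x degreeProg s).reg .nn = x.length ∧
      (Prog.eval x degreeProg s).reg .d = testDegree x.length e (s.reg .i) := by
  simp only [degreeProg, eval_block_cons, eval_block_nil, eval_ifEq, testDegree]
  set s₁ := Prog.eval x (.len .nn) s with hs₁
  have h1 : s₁.reg .i = s.reg .i := by simp [hs₁, Prog.eval]
  have h2 : s₁.reg .nn = x.length := by simp [hs₁, Prog.eval]
  rw [h1, h2]
  by_cases hi : s.reg .i = x.length
  · rw [if_pos hi, if_pos hi]
    obtain ⟨g1, g2⟩ := eval_countProg x hx s₁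
    exact ⟨g1, (Prog.eval_reg_of_not_writes x .nn countProg rfl s₁).trans h2, g2⟩
  · rw [if_neg hi, if_neg hi]
    simp [Prog.eval, hs₁, hc.2.2]

/-- One test. -/
def testProg : CProg :=
  block [degreeProg, predProg, .copy .J .c2, .copy .A .c2, .copy .P .c1, testLoop,
    gateMul .A .A, gateAdd .acc .last, .copy .acc .last]

theorem eval_testProg {gs : List Gate} {e : List ℕ}
    (hx : x = gs.flatMap Gate.encode ++ encodeMonomial e) (s : CStore) (hc : Consts s)
    (hd : testDegree x.length e (s.reg .i) + 1 ≤ x.length + 2) {q : List Gate × ℕ}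
    (hq : Out q.1 s) (hacc : s.reg .acc = q.2) :
    Out (testGates x.length gs (testDegree x.length e (s.reg .i))
        (testFactor x.length e (s.reg .i)) q).1 (Prog.eval x testProg s) ∧
      (Prog.eval x testProg s).reg .acc = (testGates x.length gs
        (testDegree x.length e (s.reg .i)) (testFactor x.length e (s.reg .i)) q).2 := by
  obtain ⟨g1, g2, g3⟩ := eval_degreeProg x hx s hc
  have hw1 : ∀ r, degreeProg.writes r = false → (Prog.eval x degreeProg s).reg r = s.reg r :=
    fun r hr => Prog.eval_reg_of_not_writes x r degreeProg hr s
  set s₁ := Prog.eval x degreeProg s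
  set d := testDegree x.length e (s.reg .i)
  have hc₁ : Consts s₁ := hc.congr (hw1 _ rfl) (hw1 _ rfl) (hw1 _ rfl)
  obtain ⟨g4, g5⟩ := eval_predProg x s₁ (hq.congr g1 (hw1 _ rfl) (hw1 _ rfl)) hc₁ (by omega)
  rw [g3] at g4 g5
  have hw2 : ∀ r, predProg.writes r = false →
      (Prog.eval x predProg s₁).reg r = s₁.reg r :=
    fun r hr => Prog.eval_reg_of_not_writes x r predProg hr s₁
  set s₂ := Prog.eval x predProg s₁
  have hc₂ : Consts s₂ := hc₁.congr (hw2 _ rfl) (hw2 _ rfl) (hw2 _ rfl)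
  have h1 : s₂.reg .nn = x.length := (hw2 _ rfl).trans g2
  have h2 : s₂.reg .i = s.reg .i := (hw2 _ rfl).trans (hw1 _ rfl)
  have h3 : s₂.reg .d = d := (hw2 _ rfl).trans g3
  have h4 : s₂.reg .acc = q.2 := ((hw2 _ rfl).trans (hw1 _ rfl)).trans hacc
  set s₃ : CStore := ⟨s₂.ctl, Function.update (Function.update (Function.update s₂.reg .J 2)
    .A 2) .P 1, s₂.out⟩ with hs₃
  have hs₃e : Prog.eval x (block [.copy .J .c2, .copy .A .c2, .copy .P .c1]) s₂ = s₃ := by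
    simp [Prog.eval, hs₃, hc₂.2.1, hc₂.2.2]
  have g6 := eval_testLoop x hx (s.reg .i) d
    ⟨(predStep^[d] (q.1, 2)).1, 2, (predStep^[d] (q.1, 2)).2, 2, 1⟩ s₃
    ⟨by simpa [Out, hs₃] using g4, by simp [hs₃], by simp [hs₃, g5], by simp [hs₃],
      by simp [hs₃], by simpa [Consts, hs₃] using hc₂, by simp [hs₃, h1], by simp [hs₃, h2],
      by simp [hs₃, h3]⟩ hd
  have h5 : (Prog.eval x testLoop s₃).reg .acc = q.2 := by
    rw [Prog.eval_reg_of_not_writes x .acc testLoop rfl]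
    simp [hs₃, h4]
  have e1 : Prog.eval x testProg s = Prog.eval x
      (block [gateMul .A .A, gateAdd .acc .last, .copy .acc .last])
      (Prog.eval x testLoop s₃) := by
    rw [← hs₃e]
    rfl
  rw [e1, testGates]
  set t := (testStep x.length gs (testFactor x.length e (s.reg .i)))^[d + 1]
    ⟨(predStep^[d] (q.1, 2)).1, 2, (predStep^[d] (q.1, 2)).2, 2, 1⟩
  set s₄ := Prog.eval x testLoop s₃
  obtain ⟨k1, -, -, k2, -⟩ := g6
  have k3 := (k1.emitGate (.mul t.A t.A)).emitGate (.add q.2 t.gates.length)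
  have e2 : (emitGate (.mul t.A t.A) s₄).reg .acc = q.2 := by
    rw [emitGate_reg _ _ (by decide) (by decide), h5]
  simp only [eval_block_cons, eval_block_nil, eval_gateMul, eval_gateAdd, Prog.eval, k2,
    emitGate_last, e2, k1.2.1]
  exact ⟨k3.congr rfl (by simp) (by simp), by simp [k1.2.1]⟩

/-- Write the gates for the constants and the variables. -/
def baseProg : CProg := block [initProg, .forN 0 .j (gateVar .j)]

theorem eval_baseProg (s : CStore) (h : s.out = []) :
    Out (baseGates x.length) (Prog.eval x baseProg s) ∧ Consts (Prog.eval x baseProg s) := by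
  obtain ⟨h1, h2⟩ := eval_initProg x s h
  have key := eval_forN_inv x 0 .j (gateVar .j)
    (fun k s' => Out (baseGates k) s' ∧ Consts s' ∧ s'.reg .j = k) (Prog.eval x initProg s)
    ⟨by simpa [Out, baseGates] using h1, by simpa [Consts] using h2, by simp⟩ (by
      rintro k - s' ⟨g1, g2, g3⟩
      have g4 := g1.emitGate (.var k)
      have e1 : baseGates (k + 1) = baseGates k ++ [.var k] := by
        simp [baseGates, List.range_succ]
      rw [e1]
      simp only [eval_gateVar, g3]
      exact ⟨g4.congr rfl (by simp [Store.inc]) (by simp [Store.inc]),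
        g2.congr (by simp [Store.inc, emitGate]) (by simp [Store.inc, emitGate])
          (by simp [Store.inc, emitGate]), by simp [Store.inc, emitGate, g3]⟩)
  exact ⟨key.1, key.2.1⟩

/-- The program that writes the circuit that tests a coefficient. -/
def reductionProg : CProg :=
  block [baseProg, .copy .acc .c2, .forN 1 .i testProg, finishProg]

theorem size_sum_le (e : List ℕ) : (e.map Nat.size).sum ≤ (encodeMonomial e).length := by
  induction e with
  | nil => simp
  | cons a e ih =>
    rw [encodeMonomial, List.flatMap_cons, List.length_append]
    change _ ≤ _ + (encodeMonomial e).length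
    simp only [List.map_cons, List.sum_cons, List.length_cons, List.length_map,
      Nat.size_eq_bits_len]
    omega

theorem lt_length_encode {gs : List Gate} {j : ℕ} (h : Gate.var j ∈ gs) :
    j < (gs.flatMap Gate.encode).length := by
  obtain ⟨l, l', rfl⟩ := List.append_of_mem h
  simp [Gate.encode]
  omega

theorem eval_reductionProg {gs : List Gate} {e : List ℕ}
    (hx : x = gs.flatMap Gate.encode ++ encodeMonomial e) (hgs : Acyclic gs) (hne : gs ≠ [])
    (s : CStore) (hs : s.out = []) :
    (Prog.eval x reductionProg s).out = (finish (reductionGates x.length gs e).1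
      (reductionGates x.length gs e).2).flatMap Gate.encode := by
  have hlen : x.length = (gs.flatMap Gate.encode).length + (encodeMonomial e).length := by
    rw [hx, List.length_append]
  have hgl := length_le_length_encode gs
  have hsz := size_sum_le e
  have hpos := List.length_pos_iff.2 hne
  obtain ⟨h1, h2⟩ := eval_baseProg x s hs
  set s₁ := Prog.eval x baseProg s
  have key := eval_forN_inv x 1 .i testProg
    (fun k s' => Out (allTests x.length gs (testDegree x.length e) (testFactor x.length e) k).1 s' ∧
      s'.reg .acc = (allTests x.length gs (testDegree x.length e) (testFactor x.length e) k).2 ∧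
      Consts s' ∧ s'.reg .i = k) ⟨s₁.ctl, Function.update s₁.reg .acc 2, s₁.out⟩
    ⟨by simpa [Out, allTests] using h1, by simp [allTests], by simpa [Consts] using h2, by simp⟩ (by
      rintro k - s' ⟨g1, g2, g3, g4⟩
      -- The `d + 1` evaluations fit into one loop: the digits counted by `d` are letters of the
      -- input, and the input is nonempty when `d = 2`.
      have hd : testDegree x.length e k + 1 ≤ x.length + 2 := by
        rw [testDegree]
        split <;> omega
      obtain ⟨g5, g6⟩ := eval_testProg x hx s' g3 (by rwa [g4]) g1 g2
      have hw : ∀ r, testProg.writes r = false → (Prog.eval x testProg s').reg r = s'.reg r :=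
        fun r hr => Prog.eval_reg_of_not_writes x r testProg hr s'
      rw [g4] at g5 g6
      exact ⟨g5.congr rfl (by simp [Store.inc]) (by simp [Store.inc]),
        by simpa [Store.inc, allTests] using g6, g3.congr (by simp [Store.inc, hw .c0 rfl])
          (by simp [Store.inc, hw .c1 rfl]) (by simp [Store.inc, hw .c2 rfl]),
        by simp [Store.inc, hw .i rfl, g4]⟩)
  obtain ⟨k1, k2, k3, -⟩ := key
  have k4 := eval_finishProg x k1 k3 (length_reductionGates_le hgs hne
    (fun j hj => (lt_length_encode hj).trans_le (by omega)) e (by omega) (by omega))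
  rw [k2] at k4
  rw [reductionGates]
  have e1 : Prog.eval x reductionProg s = Prog.eval x finishProg (Prog.eval x (.forN 1 .i testProg)
      ⟨s₁.ctl, Function.update s₁.reg .acc 2, s₁.out⟩) := by
    have e2 : Prog.eval x (.copy .acc .c2) s₁ =
        ⟨s₁.ctl, Function.update s₁.reg .acc 2, s₁.out⟩ := by
      simp [Prog.eval, h2.2.2]
    rw [← e2]
    rfl
  rw [e1]
  exact k4

/-! ### The reductions -/

/-- The program for the reduction of coefficient testing to identity testing. -/
def coeffToIdentity : CProg := .seq checkProg (.ite (fun f => f.ctx.isInstance) reductionProg skip)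

/-- The program for the reduction of identity testing to coefficient testing. -/
def identityToCoeff : CProg := .seq checkProg (.ite (fun f => f.ctx.isCircuit) evalProg skip)

theorem encode_ne_empty (C : Circuit) : C.encode ≠ [] := by
  have h1 := List.length_pos_iff.2 C.nonempty
  have h2 := length_le_length_encode C.gates
  rw [← List.length_pos_iff, Circuit.encode]
  omega

theorem Circuit.ext_of_encode_eq {C D : Circuit} (h : C.encode = D.encode) : C = D := by
  have := encode_injective h
  cases C
  cases D
  simpa using this

/-- A nonempty monomial contains the letter `pow`, which occurs in no circuit. -/
theorem eq_nil_of_encode {C D : Circuit} {e : List ℕ} (h : C.encode = D.encode ++ encodeMonomial e) :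
    e = [] := by
  rcases e with _ | ⟨a, e⟩
  · rfl
  · have h1 : Sym.pow ∈ C.encode := by
      rw [h]
      simp [encodeMonomial]
    have := (not_pow_bit_of_mem h1).1
    simp [Sym.isPow] at this

/-- A word that is no instance is mapped to the empty word, which is not in `ACIT` since a circuit
has a gate. -/
theorem mem_MLZMC_iff : x ∈ MLZMC ↔
    (Prog.eval x coeffToIdentity (Store.init Ctl.init)).out ∈ ACIT := by
  obtain ⟨h1, h2, -⟩ := eval_checkProg x
  have he : Prog.eval x coeffToIdentity (Store.init Ctl.init) =
      if (Prog.eval x checkProg (Store.init Ctl.init)).ctl.ctx.isInstance then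
        Prog.eval x reductionProg (Prog.eval x checkProg (Store.init Ctl.init))
      else Prog.eval x checkProg (Store.init Ctl.init) := rfl
  rw [he]
  split
  · rename_i hi
    have key : ∀ (C : Circuit) (e : List ℕ), x = C.encode ++ encodeMonomial e → ∃ D : Circuit,
        (Prog.eval x reductionProg (Prog.eval x checkProg (Store.init Ctl.init))).out =
          D.encode ∧ (D.poly = 0 ↔ IsMultilinear C.poly ∧ C.poly.coeff (monomialOf e) = 0) := by
      intro C e hx
      obtain ⟨D, hD, hiff⟩ := exists_circuit_reductionGates C x.length (fun j hj => by
        refine (lt_length_encode hj).trans_le ?_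
        rw [hx, List.length_append, Circuit.encode]
        omega) e
      refine ⟨D, ?_, hiff⟩
      rw [eval_reductionProg x hx C.acyclic C.nonempty _ h1, Circuit.encode, hD]
    constructor
    · rintro ⟨C, e, hx, hC⟩
      obtain ⟨D, hD, hiff⟩ := key C e hx
      exact ⟨D, hD, hiff.2 hC⟩
    · rintro ⟨D', hD', h0⟩
      obtain ⟨C, e, hx⟩ := h2.1 hi
      obtain ⟨D, hD, hiff⟩ := key C e hx
      -- Membership of the output provides some circuit with this encoding; by injectivity it is the
      -- one constructed.
      obtain rfl : D = D' := Circuit.ext_of_encode_eq (hD.symm.trans hD')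
      exact ⟨C, e, hx, hiff.1 h0⟩
  · rename_i hi
    constructor
    · rintro ⟨C, e, hx, -⟩
      exact absurd (h2.2 ⟨C, e, hx⟩) hi
    · rintro ⟨D, hD, -⟩
      rw [h1] at hD
      exact absurd hD.symm (encode_ne_empty D)

/-- The output is a bare circuit, which is an instance with the empty exponent list, that is, the
monomial `1`. Its coefficient in a constant polynomial is the constant. -/
theorem mem_ACIT_iff : x ∈ ACIT ↔
    (Prog.eval x identityToCoeff (Store.init Ctl.init)).out ∈ MLZMC := by
  obtain ⟨h1, -, h2⟩ := eval_checkProg x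
  have he : Prog.eval x identityToCoeff (Store.init Ctl.init) =
      if (Prog.eval x checkProg (Store.init Ctl.init)).ctl.ctx.isCircuit then
        Prog.eval x evalProg (Prog.eval x checkProg (Store.init Ctl.init))
      else Prog.eval x checkProg (Store.init Ctl.init) := rfl
  rw [he]
  split
  · rename_i hi
    obtain ⟨C, hx⟩ := h2.1 hi
    have h3 := eval_evalProg x hx _ h1
    have hl : C.gates.length ≤ x.length := by
      rw [hx]
      exact length_le_length_encode _
    obtain ⟨D, hD, a, hDa, ha⟩ := exists_circuit_evalGates C x.length hl fun j hj => by
      rw [hx]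
      exact lt_length_encode hj
    rw [h3, ← hD]
    have hml : IsMultilinear D.poly := by
      intro i
      rw [hDa, MvPolynomial.degreeOf_C]
      exact Nat.zero_le _
    have hco : D.poly.coeff (monomialOf []) = a := by
      rw [hDa]
      have : monomialOf [] = 0 := by
        ext i
        simp [monomialOf]
      rw [this, MvPolynomial.coeff_C, if_pos rfl]
    constructor
    · rintro ⟨C', hx', hC'⟩
      obtain rfl : C = C' := Circuit.ext_of_encode_eq (hx.symm.trans hx')
      exact ⟨D, [], by simp [encodeMonomial, Circuit.encode], hml, hco.trans (ha.2 hC')⟩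
    · rintro ⟨D', e, hD', -, h0⟩
      obtain rfl := eq_nil_of_encode (C := D) hD'
      obtain rfl : D = D' := Circuit.ext_of_encode_eq (hD'.trans (by simp [encodeMonomial]))
      exact ⟨C, hx, ha.1 (hco.symm.trans h0)⟩
  · rename_i hi
    constructor
    · rintro ⟨C, hx, -⟩
      exact absurd (h2.2 ⟨C, hx⟩) hi
    · rintro ⟨D, e, hD, -⟩
      rw [h1] at hD
      exact absurd (List.append_eq_nil_iff.1 hD.symm).1 (encode_ne_empty D)

end Arith

theorem proposition4 : Logspace.Equivalent Arith.MLZMC Arith.ACIT := by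
  have := Arith.finite_ctl
  have := Arith.finite_reg
  exact ⟨⟨_, Logspace.Prog.computable Arith.coeffToIdentity rfl Arith.Ctl.init, Arith.mem_MLZMC_iff⟩,
    ⟨_, Logspace.Prog.computable Arith.identityToCoeff rfl Arith.Ctl.init, Arith.mem_ACIT_iff⟩⟩
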